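/- Let $d\ge 1$ and let $\varrho$ be a nonzero finite positive measure whose support is compact and contained in $[a,\infty)$ for some $a>0$. Put $V(t):=-\log\int\varrho(\mathrm d\kappa)\,e^{-\kappa t^2/2}$, $t\in\mathbb R$. Let $\mathbb B(\Lambda)$ be the set of positively oriented nearest-neighbor edges of $\mathbb Z^d$ with both endpoints in $\Lambda\subset\mathbb Z^d$. A configuration $\eta=(\eta_b)\in\mathbb R^{\mathbb B(\mathbb Z^d)}$, extended by $\eta_{yx}=-\eta_{xy}$, obeys the loop conditions if the sum of $\eta$ around every cycle of length four in $\mathbb Z^d$ vanishes. For finite $\Lambda\subset\mathbb Z^d$ and such an $\eta$, let $\nu_\Lambda^{(\eta)}$ be the Lebesgue measure on the finite-dimensional affine space of all $\eta'$ that obey the loop conditions and satisfy $\eta'_b=\eta_b$ for $b\notin\mathbb B(\Lambda)$, and let $$\gamma_\Lambda(\mathrm d\eta'\mid\eta):=\frac1{Z_\Lambda(\eta)}\exp\Bigl\{-\sum_{\langle x,y\rangle:\ x\in\Lambda \text{ or } y\in\Lambda}V(\eta'_{xy})\Bigr\}\,\nu_\Lambda^{(\eta)}(\mathrm d\eta'),$$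 with $Z_\Lambda(\eta)$ the normalizing constant. A probability measure $\mu$ on $\mathbb R^{\mathbb B(\mathbb Z^d)}$ is a gradient Gibbs measure for $V$ if $\mu$-a.e. $\eta$ obeys the loop conditions and if, for every finite $\Lambda$, its regular conditional probability given $\sigma(\eta_b: b\notin\mathbb B(\Lambda))$ equals $\gamma_\Lambda(\cdot\mid\eta)$ for $\mu$-a.e. $\eta$. With $(\tau_x\eta)_{yz}:=\eta_{y+x,z+x}$, $\mu$ is translation-invariant if $\mu\circ\tau_x^{-1}=\mu$ for all $x\in\mathbb Z^d$, ergodic if $\mu(A)\in\{0,1\}$ for every event $A$ with $\tau_x^{-1}(A)=A$ for all $x$, and of zero tilt if every $\eta_b$ is $\mu$-integrable with $E_\mu(\eta_b)=0$. For $\eta$ obeying the loop conditions let $(\phi_x)_{x\in\mathbb Z^d}$ be the unique field with $\phi_0=0$ and $\eta_{xy}=\phi_y-\phi_x$ for all edges, and let $\phi(f):=\int_{\mathbb R^d}f(x)\,\phi_{\lfloor x\rfloor}\,\mathrm dx$, where $\lfloor\cdot\rfloor$ is taken coordinatewise. Let $\mathcal H_0:=\{\Delta g: g\in C_0^\infty(\mathbb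 R^d)\}$ with the norm $$\|\Delta g\|_{\mathcal H}:=\Bigl(\int_{\mathbb R^d}\bigl(|\Delta g(x)|^2+|\nabla g(x)|^2\bigr)\,\mathrm dx\Bigr)^{1/2},$$ and let $\mathcal H$ be the completion of $\mathcal H_0$ in this norm. Let $\mu$ be a translation-invariant, ergodic, zero-tilt gradient Gibbs measure for $V$. Then there is a constant $c<\infty$ such that, for every $f\in\mathcal H_0$, $\phi(f)\in L^2(\mu)$ and $$\|\phi(f)\|_{L^2(\mu)}\le c\,\|f\|_{\mathcal H}.$$ In particular, $f\mapsto\phi(f)$ extends uniquely to a continuous linear map from $\mathcal H$ to $L^2(\mu)$. -/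

import Mathlib

noncomputable section

namespace GradientField

open MeasureTheory ProbabilityTheory
open scoped ContDiff Laplacian Gradient

/-! ### Lattice, edges and gradient configurations -/

/-- The sites of the lattice `ℤ^d`. -/
abbrev Site (d : ℕ) : Type := Fin d → ℤ

/-- The positively oriented nearest-neighbour edges of `ℤ^d`: the pair `(x, i)` stands for the
edge from `x` to `x + e_i`. -/
abbrev Edge (d : ℕ) : Type := Site d × Fin d

/-- Configurations of gradient variables, i.e. elements of `ℝ^{𝔹(ℤ^d)}` with the product
`σ`-algebra. -/
abbrev Config (d : ℕ) : Type := Edge d → ℝ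

/-- The `i`-th coordinate unit vector of `ℤ^d`. -/
def unitVec {d : ℕ} (i : Fin d) : Site d := Pi.single i 1

/-- The end point `x + e_i` of the edge `(x, i)`; its starting point is `b.1`. -/
def Edge.head {d : ℕ} (b : Edge d) : Site d := b.1 + unitVec b.2

/-- The loop conditions: the signed sum of `η` around every cycle of length four vanishes.
Each such cycle of `ℤ^d` is `x, x + e_i, x + e_i + e_j, x + e_j` for some `x` and `i ≠ j`, up to
orientation and starting point; for `i = j` the equation is trivially true. -/
def LoopCondition {d : ℕ} (η : Config d) : Prop :=
  ∀ (x : Site d) (i j : Fin d),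
    η (x, i) + η (x + unitVec i, j) - η (x + unitVec j, i) - η (x, j) = 0

/-- `𝔹(Λ)`: the edges with both end points in `Λ`. -/
def edgesIn {d : ℕ} (Λ : Finset (Site d)) : Finset (Edge d) :=
  (Λ ×ˢ Finset.univ).filter fun b => Edge.head b ∈ Λ

/-- The edges `⟨x, y⟩` with `x ∈ Λ` and `y ∈ Λ ∪ ∂Λ`, i.e. those with an end point in `Λ`. -/
def edgesTouching {d : ℕ} (Λ : Finset (Site d)) : Finset (Edge d) :=
  (Λ ×ˢ Finset.univ) ∪ (Λ ×ˢ Finset.univ).image fun b => (b.1 - unitVec b.2, b.2)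

/-! ### The specification and gradient Gibbs measures -/

/-- The potential `V(η) = - log ∫ ϱ(dκ) exp(-κ η² / 2)`. -/
def potential (ϱ : Measure ℝ) (t : ℝ) : ℝ :=
  - Real.log (∫ κ, Real.exp (-(1 / 2) * κ * t ^ 2) ∂ϱ)

/-- Extension of a function on `𝔹(Λ)` by zero to all edges. -/
def extendZero {d : ℕ} {Λ : Finset (Site d)} (ξ : EuclideanSpace ℝ (edgesIn Λ)) : Config d :=
  fun b => if h : b ∈ edgesIn Λ then ξ ⟨b, h⟩ else 0

/-- The linear space of configurations on `𝔹(Λ)` whose extension by zero obeys the loop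
conditions. -/
def loopSpace {d : ℕ} (Λ : Finset (Site d)) :
    Submodule ℝ (EuclideanSpace ℝ (edgesIn Λ)) where
  carrier := {ξ | LoopCondition (extendZero ξ)}
  add_mem' := by
    intro a b ha hb x i j
    have h1 := ha x i j
    have h2 := hb x i j
    have h : ∀ e, extendZero (a + b) e = extendZero a e + extendZero b e := by
      intro e; unfold extendZero; split_ifs <;> simp
    simp only [h]; linarith
  zero_mem' := by
    intro x i j
    have h : ∀ e, extendZero (0 : EuclideanSpace ℝ (edgesIn Λ)) e = 0 := by
      intro e; unfold extendZero; split_ifs <;> simp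
    simp [h]
  smul_mem' := by
    intro c a ha x i j
    have h1 := ha x i j
    have h : ∀ e, extendZero (c • a) e = c * extendZero a e := by
      intro e; unfold extendZero; split_ifs <;> simp
    simp only [h]; linear_combination c * h1

/-- The a priori measure `ν_Λ^{(η)}`: Lebesgue measure on the affine space of all `η'` that agree
with `η` off `𝔹(Λ)` and obey the loop conditions. For an `η` that obeys the loop conditions this
space is the translate by `η` of `loopSpace Λ`. -/
def aPriori {d : ℕ} (Λ : Finset (Site d)) (η : Config d) : Measure (Config d) :=
  Measure.map (fun ξ : loopSpace Λ => η + extendZero (ξ : EuclideanSpace ℝ (edgesIn Λ)))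
    (volume : Measure (loopSpace Λ))

/-- The a priori measure with the Boltzmann weight of the edges touching `Λ`, unnormalized. -/
def gibbsWeight {d : ℕ} (V : ℝ → ℝ) (Λ : Finset (Site d)) (η : Config d) : Measure (Config d) :=
  (aPriori Λ η).withDensity
    fun η' => ENNReal.ofReal (Real.exp (- ∑ b ∈ edgesTouching Λ, V (η' b)))

/-- The specification `γ_Λ(· | η)`; the normalizing constant `Z_Λ(η)` is the total mass of
`gibbsWeight V Λ η`. -/
def gibbsSpec {d : ℕ} (V : ℝ → ℝ) (Λ : Finset (Site d)) (η : Config d) : Measure (Config d) :=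
  (gibbsWeight V Λ η Set.univ)⁻¹ • gibbsWeight V Λ η

/-- The `σ`-algebra generated by the coordinates `η_b`, `b ∉ 𝔹(Λ)`. -/
@[reducible] def sigmaOff {d : ℕ} (Λ : Finset (Site d)) : MeasurableSpace (Config d) :=
  MeasurableSpace.comap (fun (η : Config d) (b : {b : Edge d // b ∉ edgesIn Λ}) => η b)
    inferInstance

/-- `μ` is a gradient Gibbs measure for `V`: it is carried by configurations obeying the loop
conditions, and for each finite `Λ` its regular conditional probability given the gradients off
`𝔹(Λ)` is `γ_Λ`. -/
structure IsGradientGibbs {d : ℕ} (V : ℝ → ℝ) (μ : Measure (Config d)) [IsProbabilityMeasure μ] :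
    Prop where
  loop : ∀ᵐ η ∂μ, LoopCondition η
  gibbs : ∀ Λ : Finset (Site d), ∀ᵐ η ∂μ, condExpKernel μ (sigmaOff Λ) η = gibbsSpec V Λ η

/-- The translation `τ_x`. -/
def shift {d : ℕ} (x : Site d) (η : Config d) : Config d := fun b => η (b.1 + x, b.2)

/-- Translation invariance of a measure on gradient configurations. -/
def IsTranslationInvariant {d : ℕ} (μ : Measure (Config d)) : Prop :=
  ∀ x : Site d, μ.map (shift x) = μ

/-- Ergodicity: every event that is invariant under all translations has measure zero or one. -/
def IsErgodic {d : ℕ} (μ : Measure (Config d)) : Prop :=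
  ∀ A : Set (Config d), MeasurableSet A → (∀ x : Site d, shift x ⁻¹' A = A) → μ A = 0 ∨ μ A = 1

/-- Zero tilt: all gradients are integrable with mean zero. -/
def HasZeroTilt {d : ℕ} (μ : Measure (Config d)) : Prop :=
  ∀ b : Edge d, Integrable (fun η : Config d => η b) μ ∧ ∫ η, η b ∂μ = 0

/-! ### The random linear functional -/

open Classical in
/-- The field `φ` with `φ_0 = 0` whose gradients are `η`. It exists and is unique if `η` obeys the
loop conditions. -/
def height {d : ℕ} (η : Config d) : Site d → ℝ :=
  if h : ∃ φ : Site d → ℝ, φ 0 = 0 ∧ ∀ b : Edge d, η b = φ (Edge.head b) - φ b.1 then h.choose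
  else 0

/-- The Euclidean space `ℝ^d`. -/
abbrev Eucl (d : ℕ) : Type := EuclideanSpace ℝ (Fin d)

/-- The coordinatewise integer part of a point of `ℝ^d`. -/
def floorSite {d : ℕ} (x : Eucl d) : Site d := fun i => ⌊x i⌋

/-- The random variable `φ(f) = ∫ f(x) φ_{⌊x⌋} dx`. -/
def fieldAt {d : ℕ} (f : Eucl d → ℝ) (η : Config d) : ℝ :=
  ∫ x, f x * height η (floorSite x)

/-! ### The space `H₀` with its norm, and its completion -/

/-- The test functions `C_0^∞(ℝ^d)`. -/
structure IsTest {d : ℕ} (g : Eucl d → ℝ) : Prop where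
  smooth : ContDiff ℝ ∞ g
  compact : HasCompactSupport g

theorem two_le_infty : (2 : WithTop ℕ∞) ≤ ∞ := by
  exact WithTop.coe_le_coe.2 (le_top : (2 : ℕ∞) ≤ ⊤)

theorem IsTest.add {d : ℕ} {g h : Eucl d → ℝ} (hg : IsTest g) (hh : IsTest h) :
    IsTest (g + h) := ⟨hg.smooth.add hh.smooth, hg.compact.add hh.compact⟩

theorem IsTest.smul {d : ℕ} {g : Eucl d → ℝ} (c : ℝ) (hg : IsTest g) : IsTest (c • g) :=
  ⟨contDiff_const.smul hg.smooth, hg.compact.smul_left (f := fun _ => c)⟩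

theorem IsTest.two {d : ℕ} {g : Eucl d → ℝ} (hg : IsTest g) (x : Eucl d) : ContDiffAt ℝ 2 g x :=
  (hg.smooth.of_le two_le_infty).contDiffAt

theorem IsTest.differentiable {d : ℕ} {g : Eucl d → ℝ} (hg : IsTest g) : Differentiable ℝ g :=
  hg.smooth.differentiable (by simp)

theorem IsTest.lap_add {d : ℕ} {g h : Eucl d → ℝ} (hg : IsTest g) (hh : IsTest h) :
    Δ (g + h) = Δ g + Δ h := funext fun x => (hg.two x).laplacian_add (hh.two x)

theorem IsTest.lap_smul {d : ℕ} {g : Eucl d → ℝ} (c : ℝ) (hg : IsTest g) :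
    Δ (c • g) = c • Δ g := funext fun x => InnerProductSpace.laplacian_smul c (hg.two x)

theorem IsTest.grad_add {d : ℕ} {g h : Eucl d → ℝ} (hg : IsTest g) (hh : IsTest h) :
    ∇ (g + h) = ∇ g + ∇ h := by
  funext x
  simp only [gradient, Pi.add_apply, fderiv_add (hg.differentiable x) (hh.differentiable x),
    map_add]

theorem IsTest.grad_smul {d : ℕ} {g : Eucl d → ℝ} (c : ℝ) (hg : IsTest g) :
    ∇ (c • g) = c • ∇ g := by
  funext x
  simp [gradient, fderiv_const_smul (hg.differentiable x) c]

theorem IsTest.lap_eq {d : ℕ} (g : Eucl d → ℝ) :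
    Δ g = fun x => ∑ i : Fin d, iteratedFDeriv ℝ 2 g x
      ![EuclideanSpace.basisFun (Fin d) ℝ i, EuclideanSpace.basisFun (Fin d) ℝ i] := by
  rw [InnerProductSpace.laplacian_eq_iteratedFDeriv_orthonormalBasis g
    (EuclideanSpace.basisFun (Fin d) ℝ)]

theorem IsTest.lap_continuous {d : ℕ} {g : Eucl d → ℝ} (hg : IsTest g) : Continuous (Δ g) := by
  rw [IsTest.lap_eq]
  refine continuous_finsetSum _ fun i _ => ?_
  have : Continuous (iteratedFDeriv ℝ 2 g) :=
    hg.smooth.continuous_iteratedFDeriv two_le_infty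
  fun_prop

theorem IsTest.lap_compact {d : ℕ} {g : Eucl d → ℝ} (hg : IsTest g) :
    HasCompactSupport (Δ g) := by
  have h := hg.compact.iteratedFDeriv (𝕜 := ℝ) 2
  rw [IsTest.lap_eq]
  exact h.comp_left (g := fun (m : ContinuousMultilinearMap ℝ (fun _ : Fin 2 => Eucl d) ℝ) =>
    ∑ i : Fin d, m ![EuclideanSpace.basisFun (Fin d) ℝ i, EuclideanSpace.basisFun (Fin d) ℝ i])
    (by simp)

theorem IsTest.grad_continuous {d : ℕ} {g : Eucl d → ℝ} (hg : IsTest g) :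
    Continuous (∇ g) :=
  (InnerProductSpace.toDual ℝ (Eucl d)).symm.continuous.comp
    (hg.smooth.continuous_fderiv (by simp))

theorem IsTest.grad_compact {d : ℕ} {g : Eucl d → ℝ} (hg : IsTest g) :
    HasCompactSupport (∇ g) :=
  (hg.compact.fderiv (𝕜 := ℝ)).comp_left (g := (InnerProductSpace.toDual ℝ (Eucl d)).symm)
    (by simp)

theorem IsTest.integrable_inner {d : ℕ} {g h : Eucl d → ℝ} (hg : IsTest g) (hh : IsTest h) :
    Integrable fun x => inner ℝ (∇ g x) (∇ h x) := by
  refine Continuous.integrable_of_hasCompactSupport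
    (hg.grad_continuous.inner hh.grad_continuous) ?_
  refine hg.grad_compact.mono fun x hx => ?_
  simp only [Function.mem_support] at hx ⊢
  intro h0
  exact hx (by simp [h0])

theorem IsTest.integrable_mul {d : ℕ} {g h : Eucl d → ℝ} (hg : IsTest g) (hh : IsTest h) :
    Integrable fun x => Δ g x * Δ h x :=
  Continuous.integrable_of_hasCompactSupport (hg.lap_continuous.mul hh.lap_continuous)
    (hg.lap_compact.mul_right)

/-- Green's identity for test functions. -/
theorem IsTest.green {d : ℕ} {g h : Eucl d → ℝ} (hg : IsTest g) (hh : IsTest h) :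
    ∫ x, inner ℝ (∇ g x) (∇ h x) = - ∫ x, g x * Δ h x := by
  set e := EuclideanSpace.basisFun (Fin d) ℝ with he
  have hDh : ContDiff ℝ 1 (fderiv ℝ h) := hh.smooth.fderiv_right (by rw [one_add_one_eq_two]; exact two_le_infty)
  have hk : ∀ i, ContDiff ℝ 1 fun y => fderiv ℝ h y (e i) := fun i =>
    hDh.clm_apply contDiff_const
  have hcg : Continuous g := hg.smooth.continuous
  have hdg : ∀ i, Continuous fun y => fderiv ℝ g y (e i) := fun i =>
    (hg.smooth.continuous_fderiv (by simp)).clm_apply continuous_const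
  have hdk : ∀ i, Continuous fun y => fderiv ℝ (fun y => fderiv ℝ h y (e i)) y (e i) := fun i =>
    ((hk i).continuous_fderiv (by simp)).clm_apply continuous_const
  have hdgc : ∀ i, HasCompactSupport fun y => fderiv ℝ g y (e i) := fun i =>
    (hg.compact.fderiv (𝕜 := ℝ)).comp_left (g := fun L : Eucl d →L[ℝ] ℝ => L (e i)) (by simp)
  have i1 : ∀ i, Integrable fun x => fderiv ℝ g x (e i) * fderiv ℝ h x (e i) := fun i =>
    Continuous.integrable_of_hasCompactSupport ((hdg i).mul (hk i).continuous)
      (hdgc i).mul_right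
  have i2 : ∀ i, Integrable fun x =>
      g x * fderiv ℝ (fun y => fderiv ℝ h y (e i)) x (e i) := fun i =>
    Continuous.integrable_of_hasCompactSupport (hcg.mul (hdk i)) hg.compact.mul_right
  have i3 : ∀ i, Integrable fun x => g x * fderiv ℝ h x (e i) := fun i =>
    Continuous.integrable_of_hasCompactSupport (hcg.mul (hk i).continuous) hg.compact.mul_right
  have key : ∀ i, ∫ x, g x * fderiv ℝ (fun y => fderiv ℝ h y (e i)) x (e i)
      = - ∫ x, fderiv ℝ g x (e i) * fderiv ℝ h x (e i) := fun i =>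
    integral_mul_fderiv_eq_neg_fderiv_mul_of_integrable (i1 i) (i2 i) (i3 i)
      (fun x _ => hg.differentiable x) (fun x _ => (hk i).differentiable (by simp) x)
  have hin : ∀ x, inner ℝ (∇ g x) (∇ h x) = ∑ i, fderiv ℝ g x (e i) * fderiv ℝ h x (e i) := by
    intro x
    rw [← e.sum_inner_mul_inner]
    refine Finset.sum_congr rfl fun i _ => ?_
    rw [inner_gradient_left, inner_gradient_right]
    simp
  have hlap : ∀ x, Δ h x = ∑ i, fderiv ℝ (fun y => fderiv ℝ h y (e i)) x (e i) := by
    intro x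
    rw [IsTest.lap_eq]
    refine Finset.sum_congr rfl fun i _ => ?_
    rw [iteratedFDeriv_two_apply,
      fderiv_clm_apply (hDh.differentiable (by simp) x) (differentiableAt_const _)]
    simp [he]
  simp only [hin, hlap, Finset.mul_sum]
  rw [integral_finsetSum _ fun i _ => i1 i, integral_finsetSum _ fun i _ => i2 i,
    ← Finset.sum_neg_distrib]
  refine Finset.sum_congr rfl fun i _ => ?_
  rw [key i, neg_neg]

/-- The gradient of a test function is determined by its Laplacian. -/
theorem IsTest.grad_unique {d : ℕ} {g h : Eucl d → ℝ} (hg : IsTest g) (hh : IsTest h)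
    (hgh : Δ g = Δ h) : ∇ g = ∇ h := by
  have hn : IsTest ((-1 : ℝ) • h) := hh.smul _
  have hw : IsTest (g + (-1 : ℝ) • h) := hg.add hn
  have hl : Δ (g + (-1 : ℝ) • h) = 0 := by
    rw [hg.lap_add hn, hh.lap_smul, hgh]; funext x; simp
  have h0 := hw.green hw
  rw [hl] at h0
  simp only [Pi.zero_apply, mul_zero, integral_zero, neg_zero] at h0
  have hc : Continuous fun x => inner ℝ (∇ (g + (-1 : ℝ) • h) x) (∇ (g + (-1 : ℝ) • h) x) :=
    hw.grad_continuous.inner hw.grad_continuous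
  rw [integral_eq_zero_iff_of_nonneg (fun x => real_inner_self_nonneg)
    (hw.integrable_inner hw)] at h0
  have h1 := (hc.ae_eq_iff_eq volume continuous_zero).1 h0
  have h2 : ∇ (g + (-1 : ℝ) • h) = 0 := funext fun x => by
    have := congrFun h1 x
    simpa using this
  rw [hg.grad_add hn, hh.grad_smul] at h2
  funext x
  have := congrFun h2 x
  simp only [Pi.add_apply, neg_smul, one_smul, Pi.zero_apply] at this
  exact add_neg_eq_zero.1 this

/-- The functions `Δ g` with `g ∈ C_0^∞(ℝ^d)`, as a linear space of functions. -/
def laplacians (d : ℕ) : Submodule ℝ (Eucl d → ℝ) where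
  carrier := {f | ∃ g : Eucl d → ℝ, IsTest g ∧ Δ g = f}
  add_mem' := by
    rintro _ _ ⟨g, hg, rfl⟩ ⟨h, hh, rfl⟩
    exact ⟨g + h, hg.add hh, hg.lap_add hh⟩
  zero_mem' := by
    have hz : IsTest (0 : Eucl d → ℝ) := ⟨contDiff_const, HasCompactSupport.zero⟩
    refine ⟨0, hz, ?_⟩
    have := hz.lap_smul 0
    simpa using this
  smul_mem' := by
    rintro c _ ⟨g, hg, rfl⟩
    exact ⟨c • g, hg.smul c, hg.lap_smul c⟩

/-- The space `H₀ = {Δ g : g ∈ C_0^∞(ℝ^d)}`. This is a separate type (not the subtype itself) so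
that it does not carry the topology of pointwise convergence. -/
def H0 (d : ℕ) : Type := laplacians d

instance instAddCommGroupH0 (d : ℕ) : AddCommGroup (H0 d) :=
  inferInstanceAs (AddCommGroup (laplacians d))

instance instModuleH0 (d : ℕ) : Module ℝ (H0 d) := inferInstanceAs (Module ℝ (laplacians d))

/-- The function `f : ℝ^d → ℝ` underlying an element of `H₀`. -/
def H0.fn {d : ℕ} (f : H0 d) : Eucl d → ℝ := f.1

/-- A test function `g` with `Δ g = f`, that is, `g = Δ⁻¹ f`. -/
def H0.invLap {d : ℕ} (f : H0 d) : Eucl d → ℝ := f.2.choose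

theorem H0.isTest {d : ℕ} (f : H0 d) : IsTest f.invLap := f.2.choose_spec.1

theorem H0.lap_invLap {d : ℕ} (f : H0 d) : Δ f.invLap = f.fn := f.2.choose_spec.2

theorem H0.fn_add {d : ℕ} (f h : H0 d) : (f + h).fn = f.fn + h.fn := rfl

theorem H0.fn_smul {d : ℕ} (c : ℝ) (f : H0 d) : (c • f).fn = c • f.fn := rfl

theorem H0.grad_add {d : ℕ} (f h : H0 d) :
    ∇ (f + h).invLap = ∇ f.invLap + ∇ h.invLap := by
  rw [← f.isTest.grad_add h.isTest]
  refine (f + h).isTest.grad_unique (f.isTest.add h.isTest) ?_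
  rw [f.isTest.lap_add h.isTest, H0.lap_invLap, H0.lap_invLap, H0.lap_invLap, H0.fn_add]

theorem H0.grad_smul {d : ℕ} (c : ℝ) (f : H0 d) : ∇ (c • f).invLap = c • ∇ f.invLap := by
  rw [← f.isTest.grad_smul c]
  refine (c • f).isTest.grad_unique (f.isTest.smul c) ?_
  rw [f.isTest.lap_smul c, H0.lap_invLap, H0.lap_invLap, H0.fn_smul]

theorem H0.integrable_mul {d : ℕ} (f h : H0 d) : Integrable fun x => f.fn x * h.fn x := by
  rw [← f.lap_invLap, ← h.lap_invLap]
  exact f.isTest.integrable_mul h.isTest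

theorem H0.integrable_grad {d : ℕ} (f h : H0 d) :
    Integrable fun x => inner ℝ (∇ f.invLap x) (∇ h.invLap x) :=
  f.isTest.integrable_inner h.isTest

/-- The bilinear form `(f, h) + (f, -Δ⁻¹ h) = ∫ (f h + ∇ Δ⁻¹ f ⋅ ∇ Δ⁻¹ h) dx` on `H₀`. -/
def H0.form {d : ℕ} (f h : H0 d) : ℝ :=
  (∫ x, f.fn x * h.fn x) + ∫ x, inner ℝ (∇ f.invLap x) (∇ h.invLap x)

/-- The form is an inner product. -/
@[reducible] def H0.core (d : ℕ) : InnerProductSpace.Core ℝ (H0 d) where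
  inner f h := H0.form f h
  conj_inner_symm f h := by
    simp only [H0.form, conj_trivial]
    congr 1
    · exact integral_congr_ae (Filter.Eventually.of_forall fun x => mul_comm _ _)
    · exact integral_congr_ae (Filter.Eventually.of_forall fun x => real_inner_comm _ _)
  re_inner_nonneg f := by
    simp only [H0.form, RCLike.re_to_real]
    exact add_nonneg (integral_nonneg fun x => mul_self_nonneg _)
      (integral_nonneg fun x => real_inner_self_nonneg)
  add_left f h k := by
    simp only [H0.form, H0.fn_add, H0.grad_add, Pi.add_apply, add_mul, inner_add_left]
    rw [integral_add (f.integrable_mul k) (h.integrable_mul k),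
      integral_add (f.integrable_grad k) (h.integrable_grad k)]
    ring
  smul_left f h c := by
    simp only [H0.form, H0.fn_smul, H0.grad_smul, Pi.smul_apply, smul_eq_mul, mul_assoc,
      real_inner_smul_left, integral_const_mul, conj_trivial]
    ring
  definite f hf := by
    have h1 : 0 ≤ ∫ x, f.fn x * f.fn x := integral_nonneg fun x => mul_self_nonneg _
    have h2 : 0 ≤ ∫ x, inner ℝ (∇ f.invLap x) (∇ f.invLap x) :=
      integral_nonneg fun x => real_inner_self_nonneg
    have h3 : (∫ x, f.fn x * f.fn x) + ∫ x, inner ℝ (∇ f.invLap x) (∇ f.invLap x) = 0 := hf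
    have h4 : ∫ x, f.fn x * f.fn x = 0 := by linarith
    rw [integral_eq_zero_iff_of_nonneg (fun x => mul_self_nonneg _) (f.integrable_mul f)] at h4
    have hc : Continuous f.fn := by
      rw [← f.lap_invLap]; exact f.isTest.lap_continuous
    have h5 := ((hc.mul hc).ae_eq_iff_eq volume continuous_zero).1 h4
    refine Subtype.ext (funext fun x => ?_)
    exact mul_self_eq_zero.1 (congrFun h5 x)

/-- `H₀` with the norm `‖f‖_H = [(f, f) + (f, -Δ⁻¹ f)]^{1/2}`. -/
instance instNormedAddCommGroupH0 (d : ℕ) : NormedAddCommGroup (H0 d) :=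
  (H0.core d).toNormedAddCommGroup

instance instInnerProductSpaceH0 (d : ℕ) : InnerProductSpace ℝ (H0 d) :=
  InnerProductSpace.ofCore (H0.core d).toCore

/-- The norm of `f = Δ g` is `(∫ (|Δ g|² + |∇ g|²) dx)^{1/2}`, for every test function `g` with
`Δ g = f`. -/
theorem H0.norm_eq {d : ℕ} (f : H0 d) (g : Eucl d → ℝ) (hg : IsTest g) (hgf : Δ g = f.fn) :
    ‖f‖ = √(∫ x, (Δ g x ^ 2 + ‖∇ g x‖ ^ 2)) := by
  have h : ‖f‖ = √(H0.form f f) := rfl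
  have hgr : ∇ f.invLap = ∇ g :=
    f.isTest.grad_unique hg (by rw [f.lap_invLap, hgf])
  have i1 := hg.integrable_mul hg
  have i2 := hg.integrable_inner hg
  simp only [real_inner_self_eq_norm_sq, ← pow_two] at i1 i2
  rw [h, H0.form, hgr, ← hgf, integral_add i1 i2]
  simp only [real_inner_self_eq_norm_sq, ← pow_two]

/-- The Hilbert space `H`, the completion of `H₀`. -/
abbrev H (d : ℕ) : Type := UniformSpace.Completion (H0 d)

end GradientField

end

/-! The field `φ(Δ g)` is a finite linear functional of the gradients. The integral of `Δ g` over a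
unit cell is the net flux of `∇ g` through its faces, so summation by parts turns `φ(Δ g)` into `Σ
G_b η_b`, where `-G_b` is the flux through the face crossed by `b`, and `Σ G_b² ≤ 2 ‖Δ g‖²` in the
norm of `H` (`IsTest.exists_fieldAt_laplacian_eq_pairing`). What remains is the variance bound `E (Σ
G_b η_b)² ≤ 16 Γ / a` whenever `Γ > 0` and `Σ G_b² ≤ Γ` (`lintegral_pairing_sq_le`).

In a finite volume `exp(-V)` is a mixture of Gaussians. For fixed couplings `κ_b ∈ [a, A]` the field
is `h` plus a centred Gaussian fluctuation, where `h` is the `κ`-harmonic extension of the boundary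
condition. Since the energy dominates `a Σ η_b²`, the fluctuation has the right second moment,
uniformly in `κ` and in the volume.

The harmonic part has to be shown negligible, although only first moments of the gradients are known
to be finite. The squares are therefore capped at `m` and averaged over translates in a large box,
and the harmonicity of `h` is tested against a cutoff times `h`'s potential truncated at height `t`.
This energy estimate (`truncated_energy_le`) involves only first moments of gradients. The sites
where truncation acts are controlled by first moments of the heights, which grow sublinearly by the
mean ergodic theorem and zero tilt (`tendsto_integral_lineSum`). By symmetry of the Gaussian, first
moments of `h` are at most those of the full field, so the conditional estimates integrate to
estimates under `μ`. With box side of order `k` and `t` of order `ε k`, the error is of order `ε`;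
letting `ε → 0` and then `m → ∞` gives the variance bound. -/

noncomputable section

namespace GradientField

open MeasureTheory ProbabilityTheory Filter
open scoped ContDiff Laplacian Gradient ENNReal Topology

/-! ### Potentials of configurations obeying the loop conditions -/

/-- The gradient configuration of a field. -/
def grad {d : ℕ} (φ : Site d → ℝ) : Config d := fun b => φ b.head - φ b.1

theorem loopCondition_grad {d : ℕ} (φ : Site d → ℝ) : LoopCondition (grad φ) := by
  intro x i j
  simp only [grad, Edge.head]
  rw [add_right_comm x (unitVec i) (unitVec j)]
  ring

theorem LoopCondition.add {d : ℕ} {η ζ : Config d} (hη : LoopCondition η)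
    (hζ : LoopCondition ζ) : LoopCondition (η + ζ) := by
  intro x i j
  have h1 := hη x i j
  have h2 := hζ x i j
  simp only [Pi.add_apply]
  linarith

/-- Moving one step in direction `i` while summing up the gradient variable. -/
def stepPerm {d : ℕ} (η : Config d) (i : Fin d) : Equiv.Perm (Site d × ℝ) where
  toFun p := (p.1 + unitVec i, p.2 + η (p.1, i))
  invFun p := (p.1 - unitVec i, p.2 - η (p.1 - unitVec i, i))
  left_inv p := by simp
  right_inv p := by simp

/-- The loop condition around a square says precisely that the two ways along its sides collect the
same sum. -/
theorem LoopCondition.commute_stepPerm {d : ℕ} {η : Config d} (hη : LoopCondition η)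
    (i j : Fin d) : Commute (stepPerm η i) (stepPerm η j) := by
  refine Equiv.ext fun p => ?_
  have h := hη p.1 i j
  refine Prod.ext ?_ ?_
  · simp [stepPerm, add_right_comm]
  · simp only [stepPerm, Equiv.Perm.mul_apply, Equiv.coe_fn_mk]
    linarith

/-- The commuting steps define an action of the free abelian group `ℤ^d` on `Site d × ℝ`. Moving
`(0, 0)` by `x` reaches a point over `x`, whose second coordinate is the potential there. -/
theorem LoopCondition.exists_potential {d : ℕ} {η : Config d} (hη : LoopCondition η) :
    ∃ φ : Site d → ℝ, φ 0 = 0 ∧ η = grad φ := by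
  obtain ⟨F, hF'⟩ : ∃ F : (Fin d → Multiplicative ℤ) →* Equiv.Perm (Site d × ℝ),
      ∀ (i : Fin d) (m : Multiplicative ℤ),
        F (Pi.mulSingle i m) = stepPerm η i ^ m.toAdd := by
    have hc : Pairwise fun i j : Fin d => ∀ (x y : Multiplicative ℤ),
        Commute (zpowersHom _ (stepPerm η i) x) (zpowersHom _ (stepPerm η j) y) := by
      intro i j _ x y
      rw [zpowersHom_apply, zpowersHom_apply]
      exact (hη.commute_stepPerm i j).zpow_zpow _ _
    refine ⟨MonoidHom.noncommPiCoprod (fun i => zpowersHom _ (stepPerm η i)) hc, fun i m => ?_⟩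
    rw [MonoidHom.noncommPiCoprod_mulSingle, zpowersHom_apply]
  have hF : ∀ i, F (Pi.mulSingle i (Multiplicative.ofAdd 1)) = stepPerm η i := by
    intro i
    rw [hF', toAdd_ofAdd, zpow_one]
  -- The action covers the translations of the lattice; this identifies the edge whose gradient a
  -- further step adds.
  have hfst : ∀ (n : Fin d → Multiplicative ℤ) (p : Site d × ℝ),
      (F n p).1 = p.1 + fun i => (n i).toAdd := by
    intro n
    induction n using Pi.mulSingle_induction with
    | one => intro p; simp; rfl
    | mul a b ha hb =>
      intro p
      rw [map_mul, Equiv.Perm.mul_apply, ha, hb]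
      funext i
      simp [add_comm, add_left_comm]
    | mulSingle i m =>
      intro p
      have : ∀ (k : ℤ) (p : Site d × ℝ),
          ((stepPerm η i ^ k) p).1 = p.1 + k • unitVec i := by
        intro k
        induction k using Int.induction_on with
        | zero => intro p; simp
        | succ k ih =>
          intro p
          rw [zpow_add_one, Equiv.Perm.mul_apply, ih, add_smul, one_smul]
          simp [stepPerm, add_assoc, add_comm]
        | pred k ih =>
          intro p
          rw [zpow_sub_one, Equiv.Perm.mul_apply, ih, sub_smul, one_smul]
          have : ((stepPerm η i)⁻¹ p).1 = p.1 - unitVec i := rfl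
          rw [this]; abel
      rw [hF', this]
      congr 1
      funext j
      simp only [unitVec, Pi.smul_apply, Pi.single_apply, Pi.mulSingle_apply, smul_eq_mul]
      split_ifs <;> simp
  refine ⟨fun x => (F (fun i => Multiplicative.ofAdd (x i)) (0, 0)).2, ?_, ?_⟩
  · have : (fun i : Fin d => Multiplicative.ofAdd ((0 : Site d) i)) = 1 := rfl
    simp only [this, map_one]; rfl
  · funext b
    have h1 : (fun i : Fin d => Multiplicative.ofAdd (b.head i))
        = Pi.mulSingle b.2 (Multiplicative.ofAdd 1) *
          fun i : Fin d => Multiplicative.ofAdd (b.1 i) := by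
      funext i
      simp only [Edge.head, unitVec, Pi.mul_apply, Pi.add_apply, ofAdd_add, Pi.single_apply,
        Pi.mulSingle_apply]
      rw [mul_comm]
      split_ifs <;> simp
    have h2 := hfst (fun i : Fin d => Multiplicative.ofAdd (b.1 i)) (0, 0)
    simp only [grad, h1, map_mul, hF, Equiv.Perm.mul_apply]
    simp only [stepPerm, Equiv.coe_fn_mk, h2, zero_add, toAdd_ofAdd]
    rw [add_sub_cancel_left]

theorem LoopCondition.height_spec {d : ℕ} {η : Config d} (hη : LoopCondition η) :
    height η 0 = 0 ∧ grad (height η) = η := by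
  obtain ⟨φ, h0, h1⟩ := hη.exists_potential
  have hex : ∃ φ : Site d → ℝ, φ 0 = 0 ∧ ∀ b : Edge d, η b = φ b.head - φ b.1 :=
    ⟨φ, h0, fun b => congrFun h1 b⟩
  rw [height, dif_pos hex]
  exact ⟨hex.choose_spec.1, funext fun b => (hex.choose_spec.2 b).symm⟩

/-! ### Heights as explicit sums along lattice paths -/

/-- The site with the first `n` coordinates of `z`, the others being zero. -/
def truncSite {d : ℕ} (z : Site d) (n : ℕ) : Site d := fun j => if (j : ℕ) < n then z j else 0

/-- The sum of the gradient variables over the straight path of length `n` from `x` in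
direction `i`. -/
def lineSum {d : ℕ} (x : Site d) (i : Fin d) (n : ℕ) (η : Config d) : ℝ :=
  ∑ k ∈ Finset.range n, η (x + (k : ℤ) • unitVec i, i)

/-- The sum of the gradient variables over a path from `0` to a site `z` with nonnegative
coordinates. -/
def pathSum {d : ℕ} (z : Site d) (η : Config d) : ℝ :=
  ∑ i : Fin d, lineSum (truncSite z i) i (z i).toNat η

theorem lineSum_add {d : ℕ} (x : Site d) (i : Fin d) (n : ℕ) (η ζ : Config d) :
    lineSum x i n (η + ζ) = lineSum x i n η + lineSum x i n ζ := by
  simp [lineSum, Finset.sum_add_distrib]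

theorem pathSum_add {d : ℕ} (z : Site d) (η ζ : Config d) :
    pathSum z (η + ζ) = pathSum z η + pathSum z ζ := by
  simp [pathSum, lineSum_add, Finset.sum_add_distrib]

theorem measurable_lineSum {d : ℕ} (x : Site d) (i : Fin d) (n : ℕ) :
    Measurable (lineSum x i n) := by
  unfold lineSum; fun_prop

theorem measurable_pathSum {d : ℕ} (z : Site d) : Measurable (pathSum z) :=
  Finset.measurable_fun_sum _ fun _ _ => measurable_lineSum _ _ _

theorem lineSum_grad {d : ℕ} (x : Site d) (i : Fin d) (n : ℕ) (φ : Site d → ℝ) :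
    lineSum x i n (grad φ) = φ (x + (n : ℤ) • unitVec i) - φ x := by
  have := Finset.sum_range_sub (fun k : ℕ => φ (x + (k : ℤ) • unitVec i)) n
  simp only [Nat.cast_zero, zero_smul, add_zero] at this
  rw [← this]
  refine Finset.sum_congr rfl fun k _ => ?_
  simp only [grad, Edge.head, Nat.cast_succ, add_smul, one_smul, add_assoc]

/-- The path raises one coordinate after another, and the sum telescopes. Nonnegativity of `z` makes
`(z i).toNat` the actual length of each segment. -/
theorem pathSum_grad {d : ℕ} {z : Site d} (hz : 0 ≤ z) (φ : Site d → ℝ) :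
    pathSum z (grad φ) = φ z - φ 0 := by
  have h := Finset.sum_range_sub (fun n : ℕ => φ (truncSite z n)) d
  have hd : truncSite z d = z := by funext j; simp [truncSite]
  have h0 : truncSite z 0 = 0 := by funext j; simp [truncSite]
  simp only [hd, h0] at h
  rw [← h, ← Fin.sum_univ_eq_sum_range (fun n => φ (truncSite z (n + 1)) - φ (truncSite z n)),
    pathSum]
  refine Finset.sum_congr rfl fun i _ => ?_
  rw [lineSum_grad]
  congr 2
  funext j
  have hzi : max (z i) 0 = z i := max_eq_left (hz i)
  simp only [truncSite, unitVec, Int.toNat_eq_max, Pi.add_apply, Pi.smul_apply, Pi.single_apply,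
    smul_eq_mul, hzi]
  rcases lt_trichotomy j i with hj | rfl | hj
  · have h' : (j : ℕ) < i := hj
    simp [h', hj.ne, Nat.lt_succ_of_lt h']
  · simp
  · have h' : (i : ℕ) < j := hj
    simp [h'.not_gt, hj.ne', show ¬ (j : ℕ) < (i : ℕ) + 1 by omega]

/-- This replaces `height`, which is defined by choice, by a finite linear combination of
coordinates, visibly measurable and additive. -/
theorem LoopCondition.pathSum_eq_height {d : ℕ} {η : Config d} (hη : LoopCondition η)
    {z : Site d} (hz : 0 ≤ z) : pathSum z η = height η z := by
  obtain ⟨h0, h1⟩ := hη.height_spec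
  conv_lhs => rw [← h1]
  rw [pathSum_grad hz, h0, sub_zero]

/-! ### Centred Gaussian weights on finite-dimensional spaces -/

/-- The unnormalized centred Gaussian density of a quadratic form. -/
def gaussWeight {E : Type*} [AddCommGroup E] [Module ℝ E] (Q : E →ₗ[ℝ] E →ₗ[ℝ] ℝ) (x : E) :
    ℝ≥0∞ :=
  ENNReal.ofReal (Real.exp (-(Q x x) / 2))

/-- Definiteness makes `Q` injective into the dual space, which has the same dimension. -/
theorem exists_riesz {E : Type*} [AddCommGroup E] [Module ℝ E] [FiniteDimensional ℝ E]
    (Q : E →ₗ[ℝ] E →ₗ[ℝ] ℝ) (hpos : ∀ x, Q x x = 0 → x = 0) (l : E →ₗ[ℝ] ℝ) :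
    ∃ g, ∀ x, Q g x = l x := by
  have hinj : Function.Injective Q := by
    rw [injective_iff_map_eq_zero]
    intro x hx
    exact hpos x (by rw [hx]; rfl)
  have hsurj : Function.Surjective Q :=
    (LinearMap.injective_iff_surjective_of_finrank_eq_finrank
      (Subspace.dual_finrank_eq (K := ℝ) (V := E)).symm).1 hinj
  obtain ⟨g, hg⟩ := hsurj l
  exact ⟨g, fun x => by rw [hg]⟩

theorem sq_le_two_mul_exp_add_exp (x : ℝ) : x ^ 2 ≤ 2 * (Real.exp x + Real.exp (-x)) := by
  have h1 := Real.exp_pos x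
  have h2 := Real.exp_pos (-x)
  rcases le_total 0 x with h | h
  · have := Real.quadratic_le_exp_of_nonneg h
    nlinarith
  · have := Real.quadratic_le_exp_of_nonneg (neg_nonneg.2 h)
    nlinarith

section GaussianWeight

variable {E : Type*} [NormedAddCommGroup E] [InnerProductSpace ℝ E] [FiniteDimensional ℝ E]
  [MeasurableSpace E] [BorelSpace E]

theorem measurable_gaussWeight (Q : E →ₗ[ℝ] E →ₗ[ℝ] ℝ) : Measurable (gaussWeight Q) := by
  have hQ : Continuous fun x => Q x x := by
    have h1 : Continuous fun x => (Q x).toContinuousLinearMap :=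
      (LinearMap.toContinuousLinearMap.toLinearMap ∘ₗ Q).continuous_of_finiteDimensional
    exact h1.clm_apply continuous_id
  exact ENNReal.measurable_ofReal.comp (Real.measurable_exp.comp (hQ.measurable.neg.div_const 2))

/-- Completing the square turns the exponential tilt into a translation by `g`, under which Lebesgue
measure is invariant. -/
theorem lintegral_exp_mul_gaussWeight (Q : E →ₗ[ℝ] E →ₗ[ℝ] ℝ) (hsymm : ∀ x y, Q x y = Q y x)
    (g : E) :
    ∫⁻ x, ENNReal.ofReal (Real.exp (Q g x)) * gaussWeight Q x
      = ENNReal.ofReal (Real.exp (Q g g / 2)) * ∫⁻ x, gaussWeight Q x := by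
  rw [← lintegral_sub_right_eq_self (gaussWeight Q) g, ← lintegral_const_mul]
  · refine lintegral_congr fun x => ?_
    simp only [gaussWeight]
    rw [← ENNReal.ofReal_mul (Real.exp_pos _).le, ← ENNReal.ofReal_mul (Real.exp_pos _).le,
      ← Real.exp_add, ← Real.exp_add]
    congr 2
    simp only [map_sub, LinearMap.sub_apply, hsymm x g]
    ring
  · exact (measurable_gaussWeight Q).comp (measurable_id.sub_const g)

/-- Write `l = √s Q(g, ·)`. The hypothesis at `g` itself gives `Q g g ≤ 1`, so the exponential
moments of `±Q(g, ·)` are at most `e^{1/2} ≤ 2` times the total mass, and they dominate the square.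
The constant `8 = 2 (2 + 2)` is crude. No normalization enters, so the total mass need not be known
to be finite or nonzero. -/
theorem lintegral_sq_mul_gaussWeight_le (Q : E →ₗ[ℝ] E →ₗ[ℝ] ℝ) (hsymm : ∀ x y, Q x y = Q y x)
    (hpos : ∀ x, Q x x = 0 → x = 0) (l : E →ₗ[ℝ] ℝ) {s : ℝ} (hs : 0 < s)
    (hl : ∀ x, l x ^ 2 ≤ s * Q x x) :
    ∫⁻ x, ENNReal.ofReal (l x ^ 2) * gaussWeight Q x
      ≤ ENNReal.ofReal (8 * s) * ∫⁻ x, gaussWeight Q x := by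
  obtain ⟨g, hg⟩ := exists_riesz Q hpos ((√s)⁻¹ • l)
  have hss : √s ^ 2 = s := Real.sq_sqrt hs.le
  have hsp : 0 < √s := Real.sqrt_pos.2 hs
  have hl' : ∀ x, l x = √s * Q g x := fun x => by
    rw [hg, LinearMap.smul_apply, smul_eq_mul, mul_inv_cancel_left₀ hsp.ne']
  have hgg : Q g g ≤ 1 := by
    have h1 := hl g
    rw [hl', mul_pow, hss] at h1
    have h2 : Q g g ^ 2 ≤ Q g g := le_of_mul_le_mul_left h1 hs
    nlinarith
  have hexp : Real.exp (Q g g / 2) ≤ 2 := by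
    have h1 : Real.exp (Q g g / 2) ≤ Real.exp (1 / 2) := Real.exp_le_exp.2 (by linarith)
    have h2 : Real.exp (1 / 2) ^ 2 = Real.exp 1 := by rw [← Real.exp_nat_mul]; norm_num
    have h3 := Real.exp_one_lt_d9
    nlinarith [Real.exp_pos (1 / 2)]
  have hmeas : ∀ g, Measurable fun x => ENNReal.ofReal (Real.exp (Q g x)) * gaussWeight Q x := by
    intro g
    have : Continuous fun x => Q g x := (Q g).continuous_of_finiteDimensional
    exact (by fun_prop : Measurable fun x => ENNReal.ofReal (Real.exp (Q g x))).mul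
      (measurable_gaussWeight Q)
  have hpt : ∀ x, ENNReal.ofReal (l x ^ 2) * gaussWeight Q x ≤
      ENNReal.ofReal (2 * s) * (ENNReal.ofReal (Real.exp (Q g x)) * gaussWeight Q x +
        ENNReal.ofReal (Real.exp (Q (-g) x)) * gaussWeight Q x) := by
    intro x
    rw [← add_mul, ← mul_assoc, ← ENNReal.ofReal_add (Real.exp_pos _).le (Real.exp_pos _).le,
      ← ENNReal.ofReal_mul (by positivity)]
    gcongr
    have := sq_le_two_mul_exp_add_exp (Q g x)
    rw [hl', mul_pow, hss, map_neg, LinearMap.neg_apply]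
    nlinarith
  have hneg : Q (-g) (-g) = Q g g := by simp
  calc ∫⁻ x, ENNReal.ofReal (l x ^ 2) * gaussWeight Q x
      ≤ ∫⁻ x, ENNReal.ofReal (2 * s) * (ENNReal.ofReal (Real.exp (Q g x)) * gaussWeight Q x +
        ENNReal.ofReal (Real.exp (Q (-g) x)) * gaussWeight Q x) := lintegral_mono hpt
    _ = ENNReal.ofReal (2 * s) * (ENNReal.ofReal (Real.exp (Q g g / 2)) * (∫⁻ x, gaussWeight Q x) +
        ENNReal.ofReal (Real.exp (Q g g / 2)) * ∫⁻ x, gaussWeight Q x) := by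
      rw [lintegral_const_mul' _ _ ENNReal.ofReal_ne_top, lintegral_add_left (hmeas _),
        lintegral_exp_mul_gaussWeight Q hsymm, lintegral_exp_mul_gaussWeight Q hsymm, hneg]
    _ ≤ ENNReal.ofReal (2 * s) * (ENNReal.ofReal 2 * (∫⁻ x, gaussWeight Q x) +
        ENNReal.ofReal 2 * ∫⁻ x, gaussWeight Q x) := by gcongr
    _ = ENNReal.ofReal (8 * s) * ∫⁻ x, gaussWeight Q x := by
      rw [← add_mul, ← mul_assoc, ← ENNReal.ofReal_add (by norm_num) (by norm_num),
        ← ENNReal.ofReal_mul (by positivity)]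
      congr 2; ring

/-- The weight is even, so `c + l` and `c - l` have the same absolute moment, and `2|c| ≤ |c + l x|
+ |c - l x|`. This bounds quantities of the conditional mean by first moments of the field. -/
theorem abs_mul_lintegral_gaussWeight_le (Q : E →ₗ[ℝ] E →ₗ[ℝ] ℝ) (l : E →ₗ[ℝ] ℝ) (c : ℝ) :
    ENNReal.ofReal |c| * ∫⁻ x, gaussWeight Q x
      ≤ ∫⁻ x, ENNReal.ofReal |c + l x| * gaussWeight Q x := by
  have hcont : Continuous l := l.continuous_of_finiteDimensional
  have hmeas : Measurable fun x => ENNReal.ofReal |c + l x| * gaussWeight Q x :=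
    (by fun_prop : Measurable fun x => ENNReal.ofReal |c + l x|).mul (measurable_gaussWeight Q)
  have hev : ∀ x, gaussWeight Q (-x) = gaussWeight Q x := by
    intro x; simp [gaussWeight]
  have h1 : ∫⁻ x, ENNReal.ofReal |c - l x| * gaussWeight Q x
      = ∫⁻ x, ENNReal.ofReal |c + l x| * gaussWeight Q x := by
    rw [← lintegral_neg_eq_self]
    refine lintegral_congr fun x => ?_
    rw [hev, map_neg, sub_neg_eq_add]
  have h2 : 2 * (ENNReal.ofReal |c| * ∫⁻ x, gaussWeight Q x)
      ≤ 2 * ∫⁻ x, ENNReal.ofReal |c + l x| * gaussWeight Q x := by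
    calc 2 * (ENNReal.ofReal |c| * ∫⁻ x, gaussWeight Q x)
        = ∫⁻ x, ENNReal.ofReal (2 * |c|) * gaussWeight Q x := by
          rw [lintegral_const_mul _ (measurable_gaussWeight Q), ENNReal.ofReal_mul (by norm_num),
            ENNReal.ofReal_ofNat, mul_assoc]
      _ ≤ ∫⁻ x, (ENNReal.ofReal |c + l x| * gaussWeight Q x
            + ENNReal.ofReal |c - l x| * gaussWeight Q x) := by
          refine lintegral_mono fun x => ?_
          rw [← add_mul, ← ENNReal.ofReal_add (abs_nonneg _) (abs_nonneg _)]
          gcongr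
          calc 2 * |c| = |(c + l x) + (c - l x)| := by
                rw [show c + l x + (c - l x) = 2 * c by ring, abs_mul]; norm_num
            _ ≤ _ := abs_add_le _ _
      _ = 2 * ∫⁻ x, ENNReal.ofReal |c + l x| * gaussWeight Q x := by
          rw [lintegral_add_left hmeas, h1, two_mul]
  exact (ENNReal.mul_le_mul_iff_right (by norm_num) (by norm_num)).1 h2

end GaussianWeight

/-! ### A truncated energy estimate for harmonic fields -/

/-- Truncation of a real number to the interval `[-t, t]`. -/
def clip (t u : ℝ) : ℝ := max (-t) (min u t)

theorem abs_clip_le {t : ℝ} (ht : 0 ≤ t) (u : ℝ) : |clip t u| ≤ t := by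
  rw [abs_le]
  exact ⟨le_max_left _ _, max_le (by linarith) (min_le_right _ _)⟩

theorem clip_of_abs_le {t u : ℝ} (h : |u| ≤ t) : clip t u = u := by
  rw [abs_le] at h
  rw [clip, min_eq_left h.2, max_eq_right h.1]

theorem abs_clip_sub_le (t u v : ℝ) : |clip t u - clip t v| ≤ |u - v| := by
  unfold clip
  refine (abs_max_sub_max_le_max _ _ _ _).trans ?_
  rw [sub_self, abs_zero]
  refine max_le (abs_nonneg _) ((abs_min_sub_min_le_max _ _ _ _).trans ?_)
  rw [sub_self, abs_zero]
  exact max_le le_rfl (abs_nonneg _)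

theorem clip_mono (t : ℝ) : Monotone (clip t) := fun _ _ h =>
  max_le_max le_rfl (min_le_min h le_rfl)

/-- Truncation is monotone and contracting, so its increments have the sign of `u - v` and no larger
size. -/
theorem clip_sub_sq_le (t u v : ℝ) :
    (clip t u - clip t v) ^ 2 ≤ (u - v) * (clip t u - clip t v) := by
  have h := abs_clip_sub_le t u v
  rcases le_total u v with huv | huv
  · have := clip_mono t huv
    rw [abs_of_nonpos (by linarith), abs_of_nonpos (by linarith)] at h
    nlinarith
  · have := clip_mono t huv
    rw [abs_of_nonneg (by linarith), abs_of_nonneg (by linarith)] at h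
    nlinarith

/-- A Caccioppoli estimate with test function `ξ · clip t ψ`. Because `clip` is bounded by `t`, the
term in which the cutoff is differentiated costs only `A δ t |∇ψ|`, linear in the gradient, instead
of a square. -/
theorem truncated_energy_le {d : ℕ} (T : Finset (Edge d)) {κ : Edge d → ℝ} {a A δ t : ℝ}
    (hκ : ∀ b ∈ T, a ≤ κ b ∧ κ b ≤ A) (ha : 0 < a) (ht : 0 ≤ t)
    (ψ ξ : Site d → ℝ) (hξ : ∀ x, 0 ≤ ξ x) (hδ : ∀ b, |grad ξ b| ≤ δ)
    (hharm : ∑ b ∈ T, κ b * grad ψ b * grad (fun x => ξ x * clip t (ψ x)) b = 0) :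
    ∑ b ∈ T, ξ b.head * grad (fun x => clip t (ψ x)) b ^ 2
      ≤ A * δ * t / a * ∑ b ∈ T, |grad ψ b| := by
  have h1 : ∀ b ∈ T, a * (ξ b.head * grad (fun x => clip t (ψ x)) b ^ 2) ≤
      κ b * grad ψ b * grad (fun x => ξ x * clip t (ψ x)) b + A * δ * t * |grad ψ b| := by
    intro b hb
    obtain ⟨hk1, hk2⟩ := hκ b hb
    have hk0 : 0 < κ b := ha.trans_le hk1
    -- Discrete product rule, with `ξ` evaluated at the head of the edge and the truncated field at
    -- its tail.
    have e : κ b * grad ψ b * grad (fun x => ξ x * clip t (ψ x)) b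
        = κ b * (ξ b.head * (grad ψ b * grad (fun x => clip t (ψ x)) b))
          + κ b * (grad ψ b * (grad ξ b * clip t (ψ b.1))) := by
      simp only [grad]; ring
    have h2 : a * (ξ b.head * grad (fun x => clip t (ψ x)) b ^ 2) ≤
        κ b * (ξ b.head * (grad ψ b * grad (fun x => clip t (ψ x)) b)) := by
      have := clip_sub_sq_le t (ψ b.head) (ψ b.1)
      simp only [grad]
      have h0 := hξ b.head
      gcongr
    have h3 : |κ b * (grad ψ b * (grad ξ b * clip t (ψ b.1)))| ≤ A * δ * t * |grad ψ b| := by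
      rw [abs_mul, abs_mul, abs_mul, abs_of_pos hk0]
      calc κ b * (|grad ψ b| * (|grad ξ b| * |clip t (ψ b.1)|))
          ≤ A * (|grad ψ b| * (δ * t)) := by
            gcongr
            · exact hk0.le.trans hk2
            · exact (abs_nonneg _).trans (hδ b)
            · exact hδ b
            · exact abs_clip_le ht _
        _ = _ := by ring
    have := neg_abs_le (κ b * (grad ψ b * (grad ξ b * clip t (ψ b.1))))
    linarith
  have h2 := Finset.sum_le_sum h1
  rw [← Finset.mul_sum, Finset.sum_add_distrib, hharm, zero_add, ← Finset.mul_sum] at h2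
  rw [div_mul_eq_mul_div, le_div_iff₀ ha, mul_comm _ a]
  exact h2

/-! ### Linear functionals of the gradients and their translates -/

/-- The linear functional `Σ_{b ∈ S} G_b η_b`. -/
def pairing {d : ℕ} (S : Finset (Edge d)) (G : Edge d → ℝ) (η : Config d) : ℝ :=
  ∑ b ∈ S, G b * η b

theorem pairing_add {d : ℕ} (S : Finset (Edge d)) (G : Edge d → ℝ) (η ζ : Config d) :
    pairing S G (η + ζ) = pairing S G η + pairing S G ζ := by
  simp [pairing, mul_add, Finset.sum_add_distrib]

theorem measurable_pairing {d : ℕ} (S : Finset (Edge d)) (G : Edge d → ℝ) :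
    Measurable (pairing S G) := by
  unfold pairing; fun_prop

theorem pairing_sq_le {d : ℕ} (S : Finset (Edge d)) (G : Edge d → ℝ) (η : Config d) :
    pairing S G η ^ 2 ≤ (∑ b ∈ S, G b ^ 2) * ∑ b ∈ S, η b ^ 2 :=
  Finset.sum_mul_sq_le_sq_mul_sq _ _ _

/-- If `|ψ| ≤ t` at all end points of `S`, truncation changes nothing and Cauchy–Schwarz applies.
Otherwise some `|ψ|` exceeds `t`, and the cap `m` is paid for as in Markov's inequality. -/
theorem min_pairing_grad_sq_le {d : ℕ} (S : Finset (Edge d)) (G : Edge d → ℝ) (ψ : Site d → ℝ)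
    {t m : ℝ} (ht : 0 < t) (hm : 0 ≤ m) :
    min (pairing S G (grad ψ) ^ 2) m ≤
      (∑ b ∈ S, G b ^ 2) * (∑ b ∈ S, grad (fun x => clip t (ψ x)) b ^ 2)
        + m / t * ∑ b ∈ S, (|ψ b.1| + |ψ b.head|) := by
  have h1 : 0 ≤ (∑ b ∈ S, G b ^ 2) * ∑ b ∈ S, grad (fun x => clip t (ψ x)) b ^ 2 := by positivity
  have h2 : 0 ≤ m / t * ∑ b ∈ S, (|ψ b.1| + |ψ b.head|) := by positivity
  by_cases h : ∀ b ∈ S, |ψ b.1| ≤ t ∧ |ψ b.head| ≤ t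
  · have : pairing S G (grad ψ) = pairing S G (grad fun x => clip t (ψ x)) := by
      refine Finset.sum_congr rfl fun b hb => ?_
      simp only [grad, clip_of_abs_le (h b hb).1, clip_of_abs_le (h b hb).2]
    rw [this]
    exact (min_le_left _ _).trans ((pairing_sq_le _ _ _).trans (by linarith))
  · push Not at h
    obtain ⟨b, hb, hbt⟩ := h
    have h3 : t ≤ |ψ b.1| + |ψ b.head| := by
      by_cases h4 : |ψ b.1| ≤ t
      · linarith [hbt h4, abs_nonneg (ψ b.1)]
      · linarith [abs_nonneg (ψ b.head)]
    have h4 : |ψ b.1| + |ψ b.head| ≤ ∑ b ∈ S, (|ψ b.1| + |ψ b.head|) :=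
      Finset.single_le_sum (f := fun b : Edge d => |ψ b.1| + |ψ b.head|)
        (fun b _ => by positivity) hb
    have h5 : m ≤ m / t * ∑ b ∈ S, (|ψ b.1| + |ψ b.head|) := by
      rw [div_mul_eq_mul_div, le_div_iff₀ ht]
      exact mul_le_mul_of_nonneg_left (h3.trans h4) hm
    exact (min_le_right _ _).trans (by linarith)

/-- Translation of an edge. -/
def Edge.translate {d : ℕ} (x : Site d) (b : Edge d) : Edge d := (b.1 + x, b.2)

theorem Edge.head_translate {d : ℕ} (x : Site d) (b : Edge d) :
    (b.translate x).head = b.head + x := by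
  simp [Edge.translate, Edge.head, add_right_comm]

theorem shift_grad {d : ℕ} (x : Site d) (ψ : Site d → ℝ) :
    shift x (grad ψ) = grad fun y => ψ (y + x) := by
  funext b
  change grad ψ (b.translate x) = _
  rw [grad, Edge.head_translate]; rfl

/-- For a fixed edge of `S` its translates by distinct `x` are distinct edges of `T`, so each of the
`S.card` sums is at most the sum over `T`. -/
theorem sum_sum_translate_le {d : ℕ} (B : Finset (Site d)) (S T : Finset (Edge d))
    (F : Edge d → ℝ) (hF : ∀ b ∈ T, 0 ≤ F b) (h : ∀ x ∈ B, ∀ b ∈ S, b.translate x ∈ T) :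
    ∑ x ∈ B, ∑ b ∈ S, F (b.translate x) ≤ S.card * ∑ b ∈ T, F b := by
  rw [Finset.sum_comm, ← nsmul_eq_mul]
  refine Finset.sum_le_card_nsmul _ _ _ fun b hb => ?_
  have hinj : Set.InjOn (fun x => b.translate x) (B : Set (Site d)) := by
    intro x _ y _ hxy
    exact add_left_cancel (congrArg Prod.fst hxy)
  rw [← Finset.sum_image (f := F) hinj]
  refine Finset.sum_le_sum_of_subset_of_nonneg ?_ fun b hb _ => hF b hb
  intro c hc
  obtain ⟨x, hx, rfl⟩ := Finset.mem_image.1 hc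
  exact h x hx b hb

/-- The truncated energy estimate, summed over translates of a linear functional. -/
theorem sum_min_pairing_shift_le {d : ℕ} (B : Finset (Site d)) (S T : Finset (Edge d))
    {κ : Edge d → ℝ} {a A δ t m : ℝ} (hκ : ∀ b ∈ T, a ≤ κ b ∧ κ b ≤ A) (ha : 0 < a)
    (ht : 0 < t) (hm : 0 ≤ m) (G : Edge d → ℝ) (ψ ξ : Site d → ℝ) (hξ : ∀ x, 0 ≤ ξ x)
    (hδ : ∀ b, |grad ξ b| ≤ δ)
    (hB : ∀ x ∈ B, ∀ b ∈ S, b.translate x ∈ T ∧ ξ (b.head + x) = 1)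
    (hharm : ∑ b ∈ T, κ b * grad ψ b * grad (fun x => ξ x * clip t (ψ x)) b = 0) :
    ∑ x ∈ B, min (pairing S G (shift x (grad ψ)) ^ 2) m ≤
      (∑ b ∈ S, G b ^ 2) * (S.card * (A * δ * t / a)) * (∑ b ∈ T, |grad ψ b|)
        + m / t * ∑ x ∈ B, ∑ b ∈ S, (|ψ (b.1 + x)| + |ψ (b.head + x)|) := by
  -- On translated edges of `S` the cutoff is `1`, so the weight required by the energy estimate can
  -- be inserted at no cost.
  have h1 : ∀ x ∈ B, min (pairing S G (shift x (grad ψ)) ^ 2) m ≤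
      (∑ b ∈ S, G b ^ 2) * (∑ b ∈ S, ξ (b.translate x).head *
        grad (fun x => clip t (ψ x)) (b.translate x) ^ 2)
        + m / t * ∑ b ∈ S, (|ψ (b.1 + x)| + |ψ (b.head + x)|) := by
    intro x hx
    rw [shift_grad]
    refine (min_pairing_grad_sq_le S G _ ht hm).trans (le_of_eq ?_)
    congr 2
    refine Finset.sum_congr rfl fun b hb => ?_
    rw [Edge.head_translate, (hB x hx b hb).2, one_mul, ← shift_grad x fun x => clip t (ψ x)]
    rfl
  refine (Finset.sum_le_sum h1).trans ?_
  rw [Finset.sum_add_distrib, ← Finset.mul_sum, ← Finset.mul_sum]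
  gcongr ?_ + _
  rw [mul_assoc, mul_assoc]
  refine mul_le_mul_of_nonneg_left ?_ (by positivity)
  refine (sum_sum_translate_le B S T
    (fun b => ξ b.head * grad (fun x => clip t (ψ x)) b ^ 2)
    (fun b _ => mul_nonneg (hξ _) (sq_nonneg _)) fun x hx b hb => (hB x hx b hb).1).trans ?_
  gcongr
  exact truncated_energy_le T hκ ha ht.le ψ ξ hξ hδ hharm

/-! ### The Gaussian finite-volume estimate -/

/-- Extension by zero, as a linear map on the loop space. -/
def loopExtend {d : ℕ} (Λ : Finset (Site d)) : loopSpace Λ →ₗ[ℝ] Config d where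
  toFun ξ := extendZero (ξ : EuclideanSpace ℝ (edgesIn Λ))
  map_add' ξ ζ := by
    funext b
    simp only [extendZero, Pi.add_apply]
    split_ifs <;> simp
  map_smul' c ξ := by
    funext b
    simp only [extendZero, Pi.smul_apply]
    split_ifs <;> simp

theorem loopCondition_loopExtend {d : ℕ} {Λ : Finset (Site d)} (ξ : loopSpace Λ) :
    LoopCondition (loopExtend Λ ξ) := ξ.2

theorem mem_edgesIn {d : ℕ} {Λ : Finset (Site d)} {b : Edge d} :
    b ∈ edgesIn Λ ↔ b.1 ∈ Λ ∧ b.head ∈ Λ := by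
  simp [edgesIn]

theorem edgesIn_subset_edgesTouching {d : ℕ} (Λ : Finset (Site d)) :
    edgesIn Λ ⊆ edgesTouching Λ := by
  intro b hb
  have := (mem_edgesIn.1 hb).1
  simp [edgesTouching, this]

theorem loopExtend_apply_mem {d : ℕ} {Λ : Finset (Site d)} (ξ : loopSpace Λ) {b : Edge d}
    (hb : b ∈ edgesIn Λ) :
    loopExtend Λ ξ b = (ξ : EuclideanSpace ℝ (edgesIn Λ)) ⟨b, hb⟩ := by
  change extendZero _ b = _
  rw [extendZero, dif_pos hb]

theorem measurable_loopExtend {d : ℕ} (Λ : Finset (Site d)) : Measurable (loopExtend Λ) := by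
  refine measurable_pi_lambda _ fun b => ?_
  exact ((LinearMap.proj b ∘ₗ loopExtend Λ).continuous_of_finiteDimensional).measurable

/-- A field supported in the interior of `Λ` has its gradient in the loop space. -/
theorem exists_loopExtend_eq_grad {d : ℕ} {Λ : Finset (Site d)} {v : Site d → ℝ}
    (hv : ∀ b : Edge d, b ∉ edgesIn Λ → v b.1 = 0 ∧ v b.head = 0) :
    ∃ ξ : loopSpace Λ, loopExtend Λ ξ = grad v := by
  have h : extendZero (Λ := Λ) (WithLp.toLp 2 fun b => grad v b) = grad v := by
    funext b
    rw [extendZero]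
    split_ifs with hb
    · rfl
    · simp [grad, hv b hb]
  refine ⟨⟨WithLp.toLp 2 fun b => grad v b, ?_⟩, h⟩
  change LoopCondition _
  rw [h]
  exact loopCondition_grad v

/-- The quadratic form `Σ_b κ_b ξ_b ζ_b` on the loop space. -/
def energyForm {d : ℕ} (Λ : Finset (Site d)) (κ : Edge d → ℝ) :
    loopSpace Λ →ₗ[ℝ] loopSpace Λ →ₗ[ℝ] ℝ :=
  LinearMap.mk₂ ℝ
    (fun ξ ζ => ∑ b ∈ edgesTouching Λ, κ b * loopExtend Λ ξ b * loopExtend Λ ζ b)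
    (fun ξ ζ χ => by
      simp only [map_add, Pi.add_apply, ← Finset.sum_add_distrib]
      exact Finset.sum_congr rfl fun b _ => by ring)
    (fun c ξ ζ => by
      simp only [map_smul, Pi.smul_apply, smul_eq_mul, Finset.mul_sum]
      exact Finset.sum_congr rfl fun b _ => by ring)
    (fun ξ ζ χ => by
      simp only [map_add, Pi.add_apply, ← Finset.sum_add_distrib]
      exact Finset.sum_congr rfl fun b _ => by ring)
    (fun c ξ ζ => by
      simp only [map_smul, Pi.smul_apply, smul_eq_mul, Finset.mul_sum]
      exact Finset.sum_congr rfl fun b _ => by ring)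

theorem energyForm_apply {d : ℕ} (Λ : Finset (Site d)) (κ : Edge d → ℝ) (ξ ζ : loopSpace Λ) :
    energyForm Λ κ ξ ζ = ∑ b ∈ edgesTouching Λ, κ b * loopExtend Λ ξ b * loopExtend Λ ζ b := rfl

theorem energyForm_symm {d : ℕ} (Λ : Finset (Site d)) (κ : Edge d → ℝ) (ξ ζ : loopSpace Λ) :
    energyForm Λ κ ξ ζ = energyForm Λ κ ζ ξ := by
  simp only [energyForm_apply]
  exact Finset.sum_congr rfl fun b _ => by ring

theorem le_energyForm {d : ℕ} (Λ : Finset (Site d)) {κ : Edge d → ℝ} {a : ℝ}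
    (hκ : ∀ b ∈ edgesTouching Λ, a ≤ κ b) (ξ : loopSpace Λ) :
    a * ∑ b ∈ edgesTouching Λ, loopExtend Λ ξ b ^ 2 ≤ energyForm Λ κ ξ ξ := by
  rw [energyForm_apply, Finset.mul_sum]
  refine Finset.sum_le_sum fun b hb => ?_
  rw [mul_assoc, ← pow_two]
  exact mul_le_mul_of_nonneg_right (hκ b hb) (sq_nonneg _)

theorem eq_zero_of_energyForm_eq_zero {d : ℕ} (Λ : Finset (Site d)) {κ : Edge d → ℝ} {a : ℝ}
    (ha : 0 < a) (hκ : ∀ b ∈ edgesTouching Λ, a ≤ κ b) (ξ : loopSpace Λ)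
    (h : energyForm Λ κ ξ ξ = 0) : ξ = 0 := by
  have h1 := le_energyForm Λ hκ ξ
  rw [h] at h1
  have h0 : 0 ≤ ∑ b ∈ edgesTouching Λ, loopExtend Λ ξ b ^ 2 := by positivity
  have h2 : ∑ b ∈ edgesTouching Λ, loopExtend Λ ξ b ^ 2 = 0 := by nlinarith
  rw [Finset.sum_eq_zero_iff_of_nonneg fun b _ => sq_nonneg _] at h2
  refine Subtype.ext ?_
  ext ⟨b, hb⟩
  have := h2 b (edgesIn_subset_edgesTouching Λ hb)
  rw [loopExtend_apply_mem ξ hb] at this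
  simpa using this

/-- Cauchy–Schwarz and ellipticity of the energy form. In `lintegral_sq_mul_gaussWeight_le` this
gives a fluctuation bound independent of the volume and of the couplings. -/
theorem pairing_shift_loopExtend_sq_le {d : ℕ} (Λ : Finset (Site d)) {κ : Edge d → ℝ} {a Γ : ℝ}
    (ha : 0 < a) (hκ : ∀ b ∈ edgesTouching Λ, a ≤ κ b) (S : Finset (Edge d)) (G : Edge d → ℝ)
    (hΓ : ∑ b ∈ S, G b ^ 2 ≤ Γ) {x : Site d}
    (hS : ∀ b ∈ S, b.translate x ∈ edgesTouching Λ) (ξ : loopSpace Λ) :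
    pairing S G (shift x (loopExtend Λ ξ)) ^ 2 ≤ Γ / a * energyForm Λ κ ξ ξ := by
  have h1 := pairing_sq_le S G (shift x (loopExtend Λ ξ))
  have h2 := sum_sum_translate_le {x} S (edgesTouching Λ) (fun b => loopExtend Λ ξ b ^ 2)
    (fun b _ => sq_nonneg _) (by simpa using hS)
  have h3 := le_energyForm Λ hκ ξ
  have hinj : Set.InjOn (fun b : Edge d => b.translate x) (S : Set (Edge d)) := by
    intro b _ c _ hbc
    have h := congrArg Prod.fst hbc
    have h' := congrArg Prod.snd hbc
    exact Prod.ext (add_right_cancel h) h'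
  have h4 : ∑ b ∈ S, shift x (loopExtend Λ ξ) b ^ 2
      ≤ ∑ b ∈ edgesTouching Λ, loopExtend Λ ξ b ^ 2 := by
    change ∑ b ∈ S, loopExtend Λ ξ (b.translate x) ^ 2 ≤ _
    rw [← Finset.sum_image (f := fun b => loopExtend Λ ξ b ^ 2) hinj]
    refine Finset.sum_le_sum_of_subset_of_nonneg ?_ fun b _ _ => sq_nonneg _
    intro c hc
    obtain ⟨b, hb, rfl⟩ := Finset.mem_image.1 hc
    exact hS b hb
  have hG : 0 ≤ ∑ b ∈ S, G b ^ 2 := by positivity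
  have hG' : 0 ≤ Γ := hG.trans hΓ
  rw [div_mul_eq_mul_div, le_div_iff₀ ha]
  calc pairing S G (shift x (loopExtend Λ ξ)) ^ 2 * a
      ≤ (Γ * ∑ b ∈ edgesTouching Λ, loopExtend Λ ξ b ^ 2) * a := by
        gcongr
        exact h1.trans (mul_le_mul hΓ h4 (by positivity) hG')
    _ = Γ * (a * ∑ b ∈ edgesTouching Λ, loopExtend Λ ξ b ^ 2) := by ring
    _ ≤ _ := by gcongr

/-- The Gaussian Boltzmann factor with coupling constants `κ`. -/
def gaussFactor {d : ℕ} (T : Finset (Edge d)) (κ : Edge d → ℝ) (η : Config d) : ℝ≥0∞ :=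
  ENNReal.ofReal (Real.exp (-(1 / 2) * ∑ b ∈ T, κ b * η b ^ 2))

/-- The sum of truncated squares of a linear functional over translates. -/
def truncSq {d : ℕ} (B : Finset (Site d)) (S : Finset (Edge d)) (G : Edge d → ℝ) (m : ℝ)
    (η : Config d) : ℝ≥0∞ :=
  ∑ x ∈ B, ENNReal.ofReal (min (pairing S G (shift x η) ^ 2) m)

/-- The error term of the finite-volume estimate. -/
def errorTerm {d : ℕ} (B : Finset (Site d)) (S T : Finset (Edge d)) (c₀ c₁ c₂ : ℝ)
    (η : Config d) : ℝ≥0∞ :=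
  B.card * ENNReal.ofReal c₀ + (ENNReal.ofReal c₁ * (∑ b ∈ T, ENNReal.ofReal |η b|)
    + ENNReal.ofReal c₂ * ∑ x ∈ B, ∑ b ∈ S,
      (ENNReal.ofReal |pathSum (b.1 + x) η| + ENNReal.ofReal |pathSum (b.head + x) η|))

theorem measurable_shift {d : ℕ} (x : Site d) : Measurable (shift (d := d) x) :=
  measurable_pi_lambda _ fun b => measurable_pi_apply (b.translate x)

theorem measurable_truncSq {d : ℕ} (B : Finset (Site d)) (S : Finset (Edge d)) (G : Edge d → ℝ)
    (m : ℝ) : Measurable (truncSq B S G m) := by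
  refine Finset.measurable_fun_sum _ fun x _ => ENNReal.measurable_ofReal.comp ?_
  exact ((((measurable_pairing S G).comp (measurable_shift x)).pow_const 2).min measurable_const)

theorem measurable_errorTerm {d : ℕ} (B : Finset (Site d)) (S T : Finset (Edge d))
    (c₀ c₁ c₂ : ℝ) : Measurable (errorTerm B S T c₀ c₁ c₂) := by
  have hP : ∀ z : Site d, Measurable fun η : Config d => ENNReal.ofReal |pathSum z η| := fun z =>
    ENNReal.measurable_ofReal.comp (measurable_pathSum z).abs
  have hE : ∀ b : Edge d, Measurable fun η : Config d => ENNReal.ofReal |η b| := fun b =>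
    ENNReal.measurable_ofReal.comp (measurable_pi_apply b).abs
  refine measurable_const.add (((Finset.measurable_fun_sum _ fun b _ => hE b).const_mul _).add
    ((Finset.measurable_fun_sum _ fun x _ => Finset.measurable_fun_sum _ fun b _ => ?_).const_mul _))
  exact (hP _).add (hP _)

theorem ofReal_sum_abs_le {ι : Type*} (s : Finset ι) (f : ι → ℝ) :
    ENNReal.ofReal (∑ i ∈ s, |f i|) = ∑ i ∈ s, ENNReal.ofReal |f i| :=
  ENNReal.ofReal_sum_of_nonneg fun _ _ => abs_nonneg _

/-- The geometric setting of the finite-volume estimate: a volume `Λ` with a cutoff function `ξ`,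
and a set `B` of translations that keep the edges of `S` where the cutoff function is `1`. -/
structure IsCutoff {d : ℕ} (Λ B : Finset (Site d)) (S : Finset (Edge d)) (ξ : Site d → ℝ)
    (δ : ℝ) : Prop where
  nonneg_of_mem : ∀ x ∈ Λ, 0 ≤ x
  nonneg : ∀ x, 0 ≤ ξ x
  lipschitz : ∀ b, |grad ξ b| ≤ δ
  eq_zero : ∀ b : Edge d, b ∉ edgesIn Λ → ξ b.1 = 0 ∧ ξ b.head = 0
  translate_mem : ∀ x ∈ B, ∀ b ∈ S, b.translate x ∈ edgesIn Λ
  eq_one : ∀ x ∈ B, ∀ b ∈ S, ξ (b.head + x) = 1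

/-- The cap is kept only on `u`, later the harmonic part; `v` will be the fluctuation, whose full
second moment is available. -/
theorem min_add_sq_le {u v m : ℝ} (hm : 0 ≤ m) :
    min ((u + v) ^ 2) m ≤ 2 * v ^ 2 + 2 * min (u ^ 2) m := by
  have h : (u + v) ^ 2 ≤ 2 * u ^ 2 + 2 * v ^ 2 := by nlinarith [sq_nonneg (u - v)]
  rcases le_total (u ^ 2) m with hu | hu
  · rw [min_eq_left hu]
    exact (min_le_left _ _).trans (by linarith)
  · rw [min_eq_right hu]
    exact (min_le_right _ _).trans (by nlinarith [sq_nonneg v])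

theorem shift_add {d : ℕ} (x : Site d) (η ζ : Config d) :
    shift x (η + ζ) = shift x η + shift x ζ := rfl

section FiniteVolume

variable {d : ℕ} {Λ B : Finset (Site d)} {S : Finset (Edge d)} {ξ : Site d → ℝ} {δ : ℝ}
  {κ : Edge d → ℝ} {a A Γ t m : ℝ} {G : Edge d → ℝ} {h : Config d}

/-- The truncated squares of a harmonic configuration are controlled by first moments. -/
theorem IsCutoff.truncSq_harmonic_le (hc : IsCutoff Λ B S ξ δ) (ha : 0 < a)
    (hκ : ∀ b ∈ edgesTouching Λ, a ≤ κ b ∧ κ b ≤ A) (hA : 0 ≤ A) (hδ : 0 ≤ δ) (ht : 0 < t)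
    (hm : 0 ≤ m) (hΓ : ∑ b ∈ S, G b ^ 2 ≤ Γ) (hh : LoopCondition h)
    (hharm : ∀ ζ : loopSpace Λ, ∑ b ∈ edgesTouching Λ, κ b * h b * loopExtend Λ ζ b = 0) :
    ∑ x ∈ B, min (pairing S G (shift x h) ^ 2) m ≤
      Γ * (S.card * (A * δ * t / a)) * (∑ b ∈ edgesTouching Λ, |h b|)
        + m / t * ∑ x ∈ B, ∑ b ∈ S, (|pathSum (b.1 + x) h| + |pathSum (b.head + x) h|) := by
  obtain ⟨h0, hgr⟩ := hh.height_spec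
  have hv : ∀ b : Edge d, b ∉ edgesIn Λ → ξ b.1 * clip t (height h b.1) = 0 ∧
      ξ b.head * clip t (height h b.head) = 0 := by
    intro b hb
    obtain ⟨h1, h2⟩ := hc.eq_zero b hb
    simp [h1, h2]
  -- The cutoff vanishes at both ends of each edge outside `edgesIn Λ`, so the gradient of the
  -- truncated field times the cutoff is an admissible variation against which `h` is harmonic.
  obtain ⟨ζ, hζ⟩ := exists_loopExtend_eq_grad (v := fun x => ξ x * clip t (height h x)) hv
  have key := sum_min_pairing_shift_le (m := m) B S (edgesTouching Λ) hκ ha ht hm G (height h) ξ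
    hc.nonneg hc.lipschitz
    (fun x hx b hb => ⟨edgesIn_subset_edgesTouching _ (hc.translate_mem x hx b hb),
      hc.eq_one x hx b hb⟩)
    (by have := hharm ζ; rw [hζ] at this; rw [hgr]; exact this)
  rw [hgr] at key
  refine key.trans ?_
  have hp : ∀ x ∈ B, ∀ b ∈ S, pathSum (b.1 + x) h = height h (b.1 + x) ∧
      pathSum (b.head + x) h = height h (b.head + x) := by
    intro x hx b hb
    obtain ⟨h1, h2⟩ := mem_edgesIn.1 (hc.translate_mem x hx b hb)
    rw [Edge.head_translate] at h2
    exact ⟨hh.pathSum_eq_height (hc.nonneg_of_mem _ h1),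
      hh.pathSum_eq_height (hc.nonneg_of_mem _ h2)⟩
  have he : ∑ x ∈ B, ∑ b ∈ S, (|height h (b.1 + x)| + |height h (b.head + x)|)
      = ∑ x ∈ B, ∑ b ∈ S, (|pathSum (b.1 + x) h| + |pathSum (b.head + x) h|) :=
    Finset.sum_congr rfl fun x hx => Finset.sum_congr rfl fun b hb => by
      rw [(hp x hx b hb).1, (hp x hx b hb).2]
  rw [he]
  gcongr

/-- By harmonicity of `h` the Gaussian weight around it is centred. `min_add_sq_le` splits off the
fluctuation, which costs `2 · 8 Γ / a` per translate, from the deterministic harmonic part. The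
latter is bounded by first moments of `h`, which evenness of the weight bounds by those of `h + ζ`.
The right-hand side thus mentions only the whole field, and `h` disappears from the later estimates.
-/
theorem IsCutoff.lintegral_truncSq_le_of_harmonic (hc : IsCutoff Λ B S ξ δ) (ha : 0 < a)
    (hκ : ∀ b ∈ edgesTouching Λ, a ≤ κ b ∧ κ b ≤ A) (hA : 0 ≤ A) (hδ : 0 ≤ δ) (ht : 0 < t)
    (hm : 0 ≤ m) (hΓ0 : 0 < Γ) (hΓ : ∑ b ∈ S, G b ^ 2 ≤ Γ) (hh : LoopCondition h)
    (hharm : ∀ ζ : loopSpace Λ, ∑ b ∈ edgesTouching Λ, κ b * h b * loopExtend Λ ζ b = 0) :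
    ∫⁻ ζ, truncSq B S G m (h + loopExtend Λ ζ) * gaussWeight (energyForm Λ κ) ζ ≤
      ∫⁻ ζ, errorTerm B S (edgesTouching Λ) (16 * (Γ / a))
        (2 * (Γ * (S.card * (A * δ * t / a)))) (2 * (m / t)) (h + loopExtend Λ ζ)
          * gaussWeight (energyForm Λ κ) ζ := by
  set w := gaussWeight (energyForm Λ κ) with hw
  set Z := ∫⁻ ζ, w ζ with hZ
  have hwm : Measurable w := measurable_gaussWeight _
  have hκa : ∀ b ∈ edgesTouching Λ, a ≤ κ b := fun b hb => (hκ b hb).1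
  have hSm : ∀ x ∈ B, ∀ b ∈ S, b.translate x ∈ edgesTouching Λ := fun x hx b hb =>
    edgesIn_subset_edgesTouching _ (hc.translate_mem x hx b hb)
  have hext := measurable_loopExtend Λ
  -- the fluctuation part
  have hfluct : ∀ x ∈ B, ∫⁻ ζ, ENNReal.ofReal (pairing S G (shift x (loopExtend Λ ζ)) ^ 2) * w ζ
      ≤ ENNReal.ofReal (8 * (Γ / a)) * Z := by
    intro x hx
    let l : loopSpace Λ →ₗ[ℝ] ℝ :=
      { toFun := fun ζ => pairing S G (shift x (loopExtend Λ ζ))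
        map_add' := fun ζ ζ' => by rw [map_add, shift_add, pairing_add]
        map_smul' := fun c ζ => by
          simp only [map_smul, RingHom.id_apply, smul_eq_mul, pairing, Finset.mul_sum]
          exact Finset.sum_congr rfl fun b _ => by
            simp only [shift, Pi.smul_apply, smul_eq_mul]; ring }
    exact lintegral_sq_mul_gaussWeight_le (energyForm Λ κ) (energyForm_symm Λ κ)
      (eq_zero_of_energyForm_eq_zero Λ ha hκa) l (by positivity)
      (pairing_shift_loopExtend_sq_le Λ ha hκa S G hΓ (hSm x hx))
  have hmfl : ∀ x, Measurable fun ζ : loopSpace Λ =>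
      ENNReal.ofReal (pairing S G (shift x (loopExtend Λ ζ)) ^ 2) * w ζ := fun x =>
    (ENNReal.measurable_ofReal.comp
      (((measurable_pairing S G).comp ((measurable_shift x).comp hext)).pow_const 2)).mul hwm
  -- first moments
  have habs : ∀ (L : Config d → ℝ) (l : loopSpace Λ →ₗ[ℝ] ℝ),
      (∀ ζ, L (h + loopExtend Λ ζ) = L h + l ζ) →
      ENNReal.ofReal |L h| * Z ≤ ∫⁻ ζ, ENNReal.ofReal |L (h + loopExtend Λ ζ)| * w ζ := by
    intro L l hL
    simp only [hL]
    exact abs_mul_lintegral_gaussWeight_le (energyForm Λ κ) l (L h)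
  have hedge : ∀ b : Edge d, ENNReal.ofReal |h b| * Z
      ≤ ∫⁻ ζ, ENNReal.ofReal |(h + loopExtend Λ ζ) b| * w ζ := fun b =>
    habs (fun η => η b) (LinearMap.proj b ∘ₗ loopExtend Λ) fun ζ => rfl
  have hpath : ∀ z : Site d, ENNReal.ofReal |pathSum z h| * Z
      ≤ ∫⁻ ζ, ENNReal.ofReal |pathSum z (h + loopExtend Λ ζ)| * w ζ := by
    intro z
    refine habs (pathSum z)
      { toFun := fun ζ => pathSum z (loopExtend Λ ζ)
        map_add' := fun ζ ζ' => by rw [map_add, pathSum_add]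
        map_smul' := fun c ζ => by
          simp only [map_smul, RingHom.id_apply, smul_eq_mul, pathSum, lineSum, Finset.mul_sum,
            Pi.smul_apply] } fun ζ => pathSum_add _ _ _
  have hme : ∀ b : Edge d, Measurable fun ζ : loopSpace Λ =>
      ENNReal.ofReal |(h + loopExtend Λ ζ) b| * w ζ := fun b =>
    (ENNReal.measurable_ofReal.comp
      ((measurable_pi_apply b).comp (hext.const_add h)).abs).mul hwm
  have hmp : ∀ z : Site d, Measurable fun ζ : loopSpace Λ =>
      ENNReal.ofReal |pathSum z (h + loopExtend Λ ζ)| * w ζ := fun z =>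
    (ENNReal.measurable_ofReal.comp
      ((measurable_pathSum z).comp (hext.const_add h)).abs).mul hwm
  set c₁ := 2 * (Γ * (S.card * (A * δ * t / a))) with hc₁
  set c₂ := 2 * (m / t) with hc₂
  have hc₁0 : 0 ≤ c₁ := by positivity
  have hc₂0 : 0 ≤ c₂ := by positivity
  have hdet := hc.truncSq_harmonic_le ha hκ hA hδ ht hm hΓ hh hharm
  have hdet' : (∑ x ∈ B, ENNReal.ofReal (2 * min (pairing S G (shift x h) ^ 2) m))
      ≤ ENNReal.ofReal c₁ * (∑ b ∈ edgesTouching Λ, ENNReal.ofReal |h b|)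
      + ENNReal.ofReal c₂ * ∑ x ∈ B, ∑ b ∈ S,
        (ENNReal.ofReal |pathSum (b.1 + x) h| + ENNReal.ofReal |pathSum (b.head + x) h|) := by
    have e1 : ∀ x : Site d, ∀ b : Edge d,
        ENNReal.ofReal |pathSum (b.1 + x) h| + ENNReal.ofReal |pathSum (b.head + x) h|
        = ENNReal.ofReal (|pathSum (b.1 + x) h| + |pathSum (b.head + x) h|) := fun x b =>
      (ENNReal.ofReal_add (abs_nonneg _) (abs_nonneg _)).symm
    simp only [e1]
    rw [← ENNReal.ofReal_sum_of_nonneg fun x _ => by positivity, ← ofReal_sum_abs_le]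
    have e2 : ∑ x ∈ B, ∑ b ∈ S,
        ENNReal.ofReal (|pathSum (b.1 + x) h| + |pathSum (b.head + x) h|) =
        ENNReal.ofReal (∑ x ∈ B, ∑ b ∈ S, (|pathSum (b.1 + x) h| + |pathSum (b.head + x) h|)) := by
      rw [ENNReal.ofReal_sum_of_nonneg fun x _ => by positivity]
      refine Finset.sum_congr rfl fun x _ => ?_
      rw [ENNReal.ofReal_sum_of_nonneg fun x _ => by positivity]
    rw [e2, ← ENNReal.ofReal_mul hc₁0, ← ENNReal.ofReal_mul hc₂0,
      ← ENNReal.ofReal_add (by positivity) (by positivity), ← Finset.mul_sum]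
    refine ENNReal.ofReal_le_ofReal ?_
    rw [hc₁, hc₂, mul_assoc 2, mul_assoc 2, ← mul_add]
    gcongr
  calc ∫⁻ ζ, truncSq B S G m (h + loopExtend Λ ζ) * w ζ
      ≤ ∫⁻ ζ, ((∑ x ∈ B, 2 * (ENNReal.ofReal (pairing S G (shift x (loopExtend Λ ζ)) ^ 2) * w ζ))
        + (∑ x ∈ B, ENNReal.ofReal (2 * min (pairing S G (shift x h) ^ 2) m)) * w ζ) := by
        refine lintegral_mono fun ζ => ?_
        rw [truncSq, Finset.sum_mul, Finset.sum_mul, ← Finset.sum_add_distrib]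
        refine Finset.sum_le_sum fun x _ => ?_
        rw [← mul_assoc, ← add_mul]
        gcongr
        rw [show ∀ u : ℝ, 2 * ENNReal.ofReal u = ENNReal.ofReal (2 * u) from fun u => by
            rw [ENNReal.ofReal_mul (by norm_num), ENNReal.ofReal_ofNat], ← ENNReal.ofReal_add (by positivity) (by positivity), shift_add, pairing_add]
        exact ENNReal.ofReal_le_ofReal (min_add_sq_le hm)
    _ = (∑ x ∈ B, 2 * ∫⁻ ζ, ENNReal.ofReal (pairing S G (shift x (loopExtend Λ ζ)) ^ 2) * w ζ)
        + (∑ x ∈ B, ENNReal.ofReal (2 * min (pairing S G (shift x h) ^ 2) m)) * Z := by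
        rw [lintegral_add_right _ (hwm.const_mul _), lintegral_const_mul _ hwm,
          lintegral_finsetSum _ fun x _ => (hmfl x).const_mul _]
        simp only [lintegral_const_mul _ (hmfl _), hZ]
    _ ≤ B.card * ENNReal.ofReal (16 * (Γ / a)) * Z +
        (ENNReal.ofReal c₁ * (∑ b ∈ edgesTouching Λ, ENNReal.ofReal |h b|)
        + ENNReal.ofReal c₂ * ∑ x ∈ B, ∑ b ∈ S,
          (ENNReal.ofReal |pathSum (b.1 + x) h| + ENNReal.ofReal |pathSum (b.head + x) h|)) * Z := by
        gcongr
        rw [mul_assoc, ← nsmul_eq_mul]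
        refine Finset.sum_le_card_nsmul _ _ _ fun x hx => ?_
        rw [show 16 * (Γ / a) = 2 * (8 * (Γ / a)) by ring, ENNReal.ofReal_mul (by norm_num),
          ENNReal.ofReal_ofNat, mul_assoc]
        gcongr
        exact hfluct x hx
    _ ≤ B.card * ENNReal.ofReal (16 * (Γ / a)) * Z +
        (ENNReal.ofReal c₁ * (∑ b ∈ edgesTouching Λ,
            ∫⁻ ζ, ENNReal.ofReal |(h + loopExtend Λ ζ) b| * w ζ)
        + ENNReal.ofReal c₂ * ∑ x ∈ B, ∑ b ∈ S,
          ((∫⁻ ζ, ENNReal.ofReal |pathSum (b.1 + x) (h + loopExtend Λ ζ)| * w ζ) +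
            ∫⁻ ζ, ENNReal.ofReal |pathSum (b.head + x) (h + loopExtend Λ ζ)| * w ζ)) := by
        refine add_le_add le_rfl ?_
        rw [add_mul, mul_assoc, mul_assoc, Finset.sum_mul, Finset.sum_mul]
        simp only [Finset.sum_mul, add_mul]
        gcongr
        · exact hedge _
        · exact hpath _
        · exact hpath _
    _ = _ := by
        have hmpp : ∀ x ∈ B, Measurable fun ζ : loopSpace Λ => ∑ b ∈ S,
            (ENNReal.ofReal |pathSum (b.1 + x) (h + loopExtend Λ ζ)| * w ζ +
            ENNReal.ofReal |pathSum (b.head + x) (h + loopExtend Λ ζ)| * w ζ) := fun x _ =>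
          Finset.measurable_fun_sum _ fun b _ => (hmp _).add (hmp _)
        have hm1 : Measurable fun ζ : loopSpace Λ => ∑ b ∈ edgesTouching Λ,
            ENNReal.ofReal |(h + loopExtend Λ ζ) b| * w ζ :=
          Finset.measurable_fun_sum _ fun b _ => hme b
        have hm2 := Finset.measurable_fun_sum B hmpp
        simp only [errorTerm, add_mul, mul_assoc, Finset.sum_mul]
        rw [lintegral_add_left ((hwm.const_mul _).const_mul _),
          lintegral_add_left (hm1.const_mul _),
          lintegral_const_mul _ hm1, lintegral_const_mul _ hm2,
          lintegral_const_mul _ (hwm.const_mul _), lintegral_const_mul _ hwm,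
          lintegral_finsetSum _ fun b _ => hme b, lintegral_finsetSum _ hmpp]
        congr 3
        refine Finset.sum_congr rfl fun x _ => ?_
        have hms : ∀ b ∈ S, Measurable fun ζ : loopSpace Λ =>
            ENNReal.ofReal |pathSum (b.1 + x) (h + loopExtend Λ ζ)| * w ζ +
            ENNReal.ofReal |pathSum (b.head + x) (h + loopExtend Λ ζ)| * w ζ := fun b _ =>
          (hmp _).add (hmp _)
        rw [lintegral_finsetSum _ hms]
        exact Finset.sum_congr rfl fun b _ => (lintegral_add_left (hmp _) _).symm

/-- The finite-volume estimate for fixed coupling constants. -/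
theorem IsCutoff.lintegral_truncSq_mul_gaussFactor_le (hc : IsCutoff Λ B S ξ δ) (ha : 0 < a)
    (hκ : ∀ b ∈ edgesTouching Λ, a ≤ κ b ∧ κ b ≤ A) (hA : 0 ≤ A) (hδ : 0 ≤ δ) (ht : 0 < t)
    (hm : 0 ≤ m) (hΓ0 : 0 < Γ) (hΓ : ∑ b ∈ S, G b ^ 2 ≤ Γ) {η : Config d}
    (hη : LoopCondition η) :
    ∫⁻ ζ, truncSq B S G m (η + loopExtend Λ ζ)
        * gaussFactor (edgesTouching Λ) κ (η + loopExtend Λ ζ) ≤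
      ∫⁻ ζ, errorTerm B S (edgesTouching Λ) (16 * (Γ / a))
        (2 * (Γ * (S.card * (A * δ * t / a)))) (2 * (m / t)) (η + loopExtend Λ ζ)
          * gaussFactor (edgesTouching Λ) κ (η + loopExtend Λ ζ) := by
  -- The Riesz representative `ζ₀` of this functional is the correction that makes `η + ζ₀`
  -- orthogonal, in the `κ`-weighted energy, to all admissible variations.
  let l : loopSpace Λ →ₗ[ℝ] ℝ :=
    { toFun := fun ζ => -∑ b ∈ edgesTouching Λ, κ b * η b * loopExtend Λ ζ b
      map_add' := fun ζ ζ' => by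
        simp only [map_add, Pi.add_apply, mul_add, Finset.sum_add_distrib]; ring
      map_smul' := fun c ζ => by
        simp only [map_smul, RingHom.id_apply, smul_eq_mul, Pi.smul_apply, mul_neg,
          Finset.mul_sum]
        congr 1
        exact Finset.sum_congr rfl fun b _ => by ring }
  obtain ⟨ζ₀, hζ₀⟩ := exists_riesz (energyForm Λ κ)
    (eq_zero_of_energyForm_eq_zero Λ ha fun b hb => (hκ b hb).1) l
  set h := η + loopExtend Λ ζ₀ with hdef
  have hh : LoopCondition h := hη.add (loopCondition_loopExtend ζ₀)
  have hharm : ∀ ζ : loopSpace Λ, ∑ b ∈ edgesTouching Λ, κ b * h b * loopExtend Λ ζ b = 0 := by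
    intro ζ
    have h1 : energyForm Λ κ ζ₀ ζ = -∑ b ∈ edgesTouching Λ, κ b * η b * loopExtend Λ ζ b := hζ₀ ζ
    rw [energyForm_apply] at h1
    simp only [hdef, Pi.add_apply, mul_add, add_mul, Finset.sum_add_distrib, h1]
    ring
  -- The cross term in the energy vanishes by harmonicity, so the Boltzmann factor splits into a
  -- constant and the centred weight.
  have hfac : ∀ ζ : loopSpace Λ, gaussFactor (edgesTouching Λ) κ (h + loopExtend Λ ζ)
      = gaussFactor (edgesTouching Λ) κ h * gaussWeight (energyForm Λ κ) ζ := by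
    intro ζ
    rw [gaussFactor, gaussFactor, gaussWeight, ← ENNReal.ofReal_mul (Real.exp_pos _).le,
      ← Real.exp_add, energyForm_apply]
    congr 2
    have h1 := hharm ζ
    have h2 : ∑ b ∈ edgesTouching Λ, κ b * (h + loopExtend Λ ζ) b ^ 2
        = ∑ b ∈ edgesTouching Λ, κ b * h b ^ 2
          + 2 * (∑ b ∈ edgesTouching Λ, κ b * h b * loopExtend Λ ζ b)
          + ∑ b ∈ edgesTouching Λ, κ b * loopExtend Λ ζ b * loopExtend Λ ζ b := by
      rw [Finset.mul_sum, ← Finset.sum_add_distrib, ← Finset.sum_add_distrib]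
      exact Finset.sum_congr rfl fun b _ => by simp only [Pi.add_apply]; ring
    rw [h2, h1]; ring
  -- Recentring at `h` is a translation by `ζ₀` in the loop space, which preserves its Lebesgue
  -- measure.
  have htrans : ∀ F : Config d → ℝ≥0∞,
      ∫⁻ ζ, F (η + loopExtend Λ ζ) * gaussFactor (edgesTouching Λ) κ (η + loopExtend Λ ζ)
      = gaussFactor (edgesTouching Λ) κ h *
        ∫⁻ ζ, F (h + loopExtend Λ ζ) * gaussWeight (energyForm Λ κ) ζ := by
    intro F
    rw [← lintegral_add_left_eq_self _ ζ₀, ← lintegral_const_mul' (gaussFactor (edgesTouching Λ) κ h) _ ENNReal.ofReal_ne_top]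
    refine lintegral_congr fun ζ => ?_
    rw [map_add, ← add_assoc, ← hdef, hfac]
    ring
  rw [htrans, htrans]
  refine mul_le_mul' le_rfl ?_
  exact hc.lintegral_truncSq_le_of_harmonic ha hκ hA hδ ht hm hΓ0 hΓ hh hharm

end FiniteVolume

/-! ### The potential as a mixture of Gaussians -/

section Mixture

variable {ϱ : Measure ℝ} [IsFiniteMeasure ϱ] {a A : ℝ}

theorem integrable_exp_kappa (hϱ : ∀ᵐ κ ∂ϱ, 0 ≤ κ) (t : ℝ) :
    Integrable (fun κ => Real.exp (-(1 / 2) * κ * t ^ 2)) ϱ := by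
  refine Integrable.of_bound (by fun_prop) 1 ?_
  filter_upwards [hϱ] with κ hκ
  rw [Real.norm_eq_abs, Real.abs_exp, Real.exp_le_one_iff]
  nlinarith [mul_nonneg hκ (sq_nonneg t)]

/-- Since `ϱ ≠ 0`, the integral is positive and `exp` undoes the logarithm. -/
theorem exp_neg_potential (hne : ϱ ≠ 0) (hϱ : ∀ᵐ κ ∂ϱ, 0 ≤ κ) (t : ℝ) :
    Real.exp (-potential ϱ t) = ∫ κ, Real.exp (-(1 / 2) * κ * t ^ 2) ∂ϱ := by
  rw [potential, neg_neg, Real.exp_log]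
  have := NeZero.mk hne
  exact integral_exp_pos (integrable_exp_kappa hϱ t)

theorem measurable_potential : Measurable (potential ϱ) := by
  have h : StronglyMeasurable (Function.uncurry fun t κ : ℝ => Real.exp (-(1 / 2) * κ * t ^ 2)) :=
    (by fun_prop : Continuous _).stronglyMeasurable
  exact (Real.measurable_log.comp h.integral_prod_right.measurable).neg

/-- Coupling constants on all edges from coupling constants on `T`. -/
def extendCoupling {d : ℕ} (T : Finset (Edge d)) (k : T → ℝ) (b : Edge d) : ℝ :=
  if h : b ∈ T then k ⟨b, h⟩ else 0

theorem gaussFactor_extendCoupling {d : ℕ} (T : Finset (Edge d)) (k : T → ℝ) (η : Config d) :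
    gaussFactor T (extendCoupling T k) η
      = ENNReal.ofReal (∏ b : T, Real.exp (-(1 / 2) * k b * η b ^ 2)) := by
  rw [gaussFactor, ← Real.exp_sum, ← Finset.sum_coe_sort, Finset.mul_sum]
  congr 2
  refine Finset.sum_congr rfl fun b _ => ?_
  rw [extendCoupling, dif_pos b.2, mul_assoc]

/-- The product over edges of the one-edge integrals is an integral over the product measure: the
Boltzmann weight is a mixture of Gaussian factors with one independent coupling per edge. -/
theorem ofReal_exp_neg_sum_potential {d : ℕ} (hne : ϱ ≠ 0) (hϱ : ∀ᵐ κ ∂ϱ, 0 ≤ κ)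
    (T : Finset (Edge d)) (η : Config d) :
    ENNReal.ofReal (Real.exp (-∑ b ∈ T, potential ϱ (η b)))
      = ∫⁻ k, gaussFactor T (extendCoupling T k) η ∂(Measure.pi fun _ : T => ϱ) := by
  simp only [gaussFactor_extendCoupling]
  rw [← ofReal_integral_eq_lintegral_ofReal
    (Integrable.fintype_prod (f := fun (b : T) κ => Real.exp (-(1 / 2) * κ * η b ^ 2))
      fun b => integrable_exp_kappa hϱ _)
    (Filter.Eventually.of_forall fun k => Finset.prod_nonneg fun _ _ => (Real.exp_pos _).le),
    integral_fintype_prod_eq_prod (𝕜 := ℝ)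
      (f := fun (b : T) κ => Real.exp (-(1 / 2) * κ * η b ^ 2)),
    ← Finset.sum_neg_distrib, Real.exp_sum, ← Finset.prod_coe_sort]
  congr 1
  exact Finset.prod_congr rfl fun b _ => exp_neg_potential hne hϱ _

theorem ae_extendCoupling {d : ℕ} (hϱ : ∀ᵐ κ ∂ϱ, a ≤ κ ∧ κ ≤ A) (T : Finset (Edge d)) :
    ∀ᵐ k ∂(Measure.pi fun _ : T => ϱ), ∀ b ∈ T,
      a ≤ extendCoupling T k b ∧ extendCoupling T k b ≤ A := by
  have h : ∀ᵐ k ∂(Measure.pi fun _ : T => ϱ), ∀ b : T, a ≤ k b ∧ k b ≤ A :=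
    ae_all_iff.2 fun b => (Measure.tendsto_eval_ae_ae (μ := fun _ : T => ϱ) (i := b)).eventually hϱ
  filter_upwards [h] with k hk b hb
  rw [extendCoupling, dif_pos hb]
  exact hk ⟨b, hb⟩

theorem lintegral_gibbsWeight {d : ℕ} {V : ℝ → ℝ} (hV : Measurable V) (Λ : Finset (Site d))
    (η : Config d) {F : Config d → ℝ≥0∞} (hF : Measurable F) :
    ∫⁻ η', F η' ∂(gibbsWeight V Λ η) = ∫⁻ ζ : loopSpace Λ, F (η + loopExtend Λ ζ) *
      ENNReal.ofReal (Real.exp (-∑ b ∈ edgesTouching Λ, V ((η + loopExtend Λ ζ) b))) := by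
  have hW : Measurable fun η' : Config d =>
      ENNReal.ofReal (Real.exp (-∑ b ∈ edgesTouching Λ, V (η' b))) := by
    refine ENNReal.measurable_ofReal.comp (Real.measurable_exp.comp (Measurable.neg ?_))
    exact Finset.measurable_fun_sum _ fun b _ => hV.comp (measurable_pi_apply b)
  have hm : Measurable fun ζ : loopSpace Λ => η + loopExtend Λ ζ :=
    (measurable_loopExtend Λ).const_add η
  rw [gibbsWeight, lintegral_withDensity_eq_lintegral_mul _ hW hF, aPriori]
  change ∫⁻ η', _ ∂(Measure.map (fun ζ : loopSpace Λ => η + loopExtend Λ ζ) volume) = _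
  rw [lintegral_map (hW.mul hF) hm]
  exact lintegral_congr fun ζ => mul_comm _ _

theorem measurable_gaussFactor_extendCoupling {d : ℕ} (T : Finset (Edge d)) {X : Type*}
    [MeasurableSpace X] {f : X → Config d} {k : X → T → ℝ} (hf : Measurable f)
    (hk : Measurable k) : Measurable fun p => gaussFactor T (extendCoupling T (k p)) (f p) := by
  simp only [gaussFactor_extendCoupling]
  refine ENNReal.measurable_ofReal.comp (Finset.measurable_fun_prod _ fun b _ => ?_)
  have h1 : Measurable fun p => f p b := (measurable_pi_apply _).comp hf
  have h2 : Measurable fun p => k p b := (measurable_pi_apply _).comp hk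
  exact Real.measurable_exp.comp ((h2.const_mul _).mul (h1.pow_const 2))

theorem lintegral_mul_exp_potential {d : ℕ} (hne : ϱ ≠ 0) (hϱ : ∀ᵐ κ ∂ϱ, 0 ≤ κ)
    (T : Finset (Edge d)) {E : Type*} [MeasurableSpace E] (ν : Measure E) [SFinite ν]
    {f : E → Config d} (hf : Measurable f) {F : Config d → ℝ≥0∞} (hF : Measurable F) :
    ∫⁻ ζ, F (f ζ) * ENNReal.ofReal (Real.exp (-∑ b ∈ T, potential ϱ (f ζ b))) ∂ν =
      ∫⁻ k, (∫⁻ ζ, F (f ζ) * gaussFactor T (extendCoupling T k) (f ζ) ∂ν)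
        ∂(Measure.pi fun _ : T => ϱ) := by
  have hs : Measurable fun p : (T → ℝ) × E => f p.2 := hf.comp measurable_snd
  have hg2 : Measurable fun p : (T → ℝ) × E =>
      F (f p.2) * gaussFactor T (extendCoupling T p.1) (f p.2) :=
    (hF.comp hs).mul (measurable_gaussFactor_extendCoupling T hs measurable_fst)
  rw [lintegral_lintegral_swap hg2.aemeasurable]
  refine lintegral_congr fun ζ => ?_
  rw [ofReal_exp_neg_sum_potential hne hϱ, lintegral_const_mul _
    (measurable_gaussFactor_extendCoupling T measurable_const measurable_id')]

theorem lintegral_gibbsWeight_potential {d : ℕ} (hne : ϱ ≠ 0) (hϱ : ∀ᵐ κ ∂ϱ, 0 ≤ κ)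
    (Λ : Finset (Site d)) (η : Config d) {F : Config d → ℝ≥0∞} (hF : Measurable F) :
    ∫⁻ η', F η' ∂(gibbsWeight (potential ϱ) Λ η) =
      ∫⁻ k, (∫⁻ ζ : loopSpace Λ, F (η + loopExtend Λ ζ) *
        gaussFactor (edgesTouching Λ) (extendCoupling (edgesTouching Λ) k) (η + loopExtend Λ ζ))
        ∂(Measure.pi fun _ : edgesTouching Λ => ϱ) := by
  rw [lintegral_gibbsWeight measurable_potential Λ η hF,
    lintegral_mul_exp_potential hne hϱ (edgesTouching Λ) volume
      ((measurable_loopExtend Λ).const_add η) hF]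

theorem lintegral_gibbsSpec {d : ℕ} (V : ℝ → ℝ) (Λ : Finset (Site d)) (η : Config d)
    (F : Config d → ℝ≥0∞) : ∫⁻ η', F η' ∂(gibbsSpec V Λ η)
      = (gibbsWeight V Λ η Set.univ)⁻¹ * ∫⁻ η', F η' ∂(gibbsWeight V Λ η) := by
  rw [gibbsSpec, lintegral_smul_measure, smul_eq_mul]

/-! ### The DLR equation in integrated form -/

theorem sigmaOff_le {d : ℕ} (Λ : Finset (Site d)) :
    sigmaOff Λ ≤ (inferInstance : MeasurableSpace (Config d)) := by
  refine Measurable.comap_le ?_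
  exact measurable_pi_lambda _ fun b => measurable_pi_apply _

/-- Averaging the conditional law over the conditioning returns `μ`; the Gibbs property replaces the
conditional law by the specification. -/
theorem IsGradientGibbs.lintegral_eq {d : ℕ} {V : ℝ → ℝ} {μ : Measure (Config d)}
    [IsProbabilityMeasure μ] (hμ : IsGradientGibbs V μ) (Λ : Finset (Site d))
    {F : Config d → ℝ≥0∞} (hF : Measurable F) :
    ∫⁻ η, F η ∂μ = ∫⁻ η, ∫⁻ η', F η' ∂(gibbsSpec V Λ η) ∂μ := by
  have h1 : ∫⁻ η, F η ∂μ = ∫⁻ η, ∫⁻ η', F η' ∂(condExpKernel μ (sigmaOff Λ) η) ∂μ := by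
    conv_lhs => rw [← condExpKernel_comp_trim (μ := μ) (sigmaOff_le Λ)]
    rw [Measure.lintegral_bind (Kernel.aemeasurable _) hF.aemeasurable,
      lintegral_trim (sigmaOff_le Λ) hF.lintegral_kernel]
  rw [h1]
  refine lintegral_congr_ae ?_
  filter_upwards [hμ.gibbs Λ] with η hη
  rw [hη]

/-- For fixed couplings both sides carry the same unnormalized weight, so the inequality survives
integration over `κ`, multiplication by the inverse partition function and integration over `μ`.
Neither positivity nor finiteness of the partition function is needed. -/
theorem IsGradientGibbs.lintegral_truncSq_le {d : ℕ} {μ : Measure (Config d)}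
    [IsProbabilityMeasure μ] (hμ : IsGradientGibbs (potential ϱ) μ) (hne : ϱ ≠ 0)
    (hϱ : ∀ᵐ κ ∂ϱ, a ≤ κ ∧ κ ≤ A) (ha : 0 < a) (hA : 0 ≤ A) {Λ B : Finset (Site d)}
    {S : Finset (Edge d)} {ξ : Site d → ℝ} {δ Γ t m : ℝ} {G : Edge d → ℝ}
    (hc : IsCutoff Λ B S ξ δ) (hδ : 0 ≤ δ) (ht : 0 < t)
    (hm : 0 ≤ m) (hΓ0 : 0 < Γ) (hΓ : ∑ b ∈ S, G b ^ 2 ≤ Γ) :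
    ∫⁻ η, truncSq B S G m η ∂μ ≤
      ∫⁻ η, errorTerm B S (edgesTouching Λ) (16 * (Γ / a))
        (2 * (Γ * (S.card * (A * δ * t / a)))) (2 * (m / t)) η ∂μ := by
  have h0 : ∀ᵐ κ ∂ϱ, 0 ≤ κ := hϱ.mono fun κ h => ha.le.trans h.1
  rw [hμ.lintegral_eq Λ (measurable_truncSq _ _ _ _),
    hμ.lintegral_eq Λ (measurable_errorTerm _ _ _ _ _ _)]
  refine lintegral_mono_ae ?_
  filter_upwards [hμ.loop] with η hη
  rw [lintegral_gibbsSpec, lintegral_gibbsSpec,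
    lintegral_gibbsWeight_potential hne h0 Λ η (measurable_truncSq _ _ _ _),
    lintegral_gibbsWeight_potential hne h0 Λ η (measurable_errorTerm _ _ _ _ _ _)]
  refine mul_le_mul' le_rfl (lintegral_mono_ae ?_)
  filter_upwards [ae_extendCoupling hϱ (edgesTouching Λ)] with k hk
  exact hc.lintegral_truncSq_mul_gaussFactor_le ha hk hA hδ ht hm hΓ0 hΓ hη

end Mixture

/-! ### The mean ergodic theorem in `L¹` -/

section MeanErgodic

variable {Ω : Type*} {T : Ω → Ω}

/-- The ergodic average of `f` along `T`. -/
def ergodicAvg (T : Ω → Ω) (n : ℕ) (f : Ω → ℝ) : Ω → ℝ :=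
  (n : ℝ)⁻¹ • ∑ k ∈ Finset.range n, f ∘ T^[k]

theorem ergodicAvg_sub (n : ℕ) (f g : Ω → ℝ) :
    ergodicAvg T n (f - g) = ergodicAvg T n f - ergodicAvg T n g := by
  rw [ergodicAvg, ergodicAvg, ergodicAvg, ← smul_sub, ← Finset.sum_sub_distrib]
  rfl

variable [MeasurableSpace Ω] {μ : Measure Ω}

theorem memLp_ergodicAvg {p : ℝ≥0∞} (hT : MeasurePreserving T μ μ) (n : ℕ) {f : Ω → ℝ}
    (hf : MemLp f p μ) : MemLp (ergodicAvg T n f) p μ :=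
  (memLp_finsetSum' _ fun k _ => hf.comp_measurePreserving (hT.iterate k)).const_smul _

theorem toLp_ergodicAvg {p : ℝ≥0∞} (hT : MeasurePreserving T μ μ) (n : ℕ)
    {f : Ω → ℝ} (hf : MemLp f p μ) : (memLp_ergodicAvg hT n hf).toLp _ =
      (n : ℝ)⁻¹ • ∑ k ∈ Finset.range n, (Lp.compMeasurePreserving T hT)^[k] (hf.toLp f) := by
  have h1 : ∀ k, (Lp.compMeasurePreserving T hT)^[k] (hf.toLp f)
      = (hf.comp_measurePreserving (hT.iterate k)).toLp _ := by
    intro k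
    rw [Lp.compMeasurePreserving_iterate, Lp.toLp_compMeasurePreserving]
  simp only [h1]
  have h2 : ∀ s : Finset ℕ,
      ∑ k ∈ s, (hf.comp_measurePreserving (hT.iterate k)).toLp _
      = (memLp_finsetSum' s fun k _ => hf.comp_measurePreserving (hT.iterate k)).toLp
        (∑ k ∈ s, f ∘ T^[k]) := by
    intro s
    induction s using Finset.cons_induction with
    | empty => simp
    | cons a s ha ih =>
      rw [Finset.sum_cons, ih, ← MemLp.toLp_add]
      congr 1
      rw [Finset.sum_cons]
  rw [h2, ← MemLp.toLp_const_smul]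
  rfl

theorem norm_toLp_ergodicAvg_le (hT : MeasurePreserving T μ μ) (n : ℕ) {f : Ω → ℝ}
    (hf : MemLp f 1 μ) : ‖(memLp_ergodicAvg hT n hf).toLp _‖ ≤ ‖hf.toLp f‖ := by
  rw [toLp_ergodicAvg, norm_smul, norm_inv, Real.norm_natCast]
  have h1 : ∀ k, ‖(Lp.compMeasurePreserving T hT)^[k] (hf.toLp f)‖ = ‖hf.toLp f‖ := by
    intro k
    rw [Lp.compMeasurePreserving_iterate, Lp.norm_compMeasurePreserving]
  have h2 : ‖∑ k ∈ Finset.range n, (Lp.compMeasurePreserving T hT)^[k] (hf.toLp f)‖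
      ≤ n * ‖hf.toLp f‖ := by
    refine (norm_sum_le _ _).trans ?_
    simp [h1]
  rcases Nat.eq_zero_or_pos n with rfl | hn
  · simp
  · have : (0 : ℝ) < n := by exact_mod_cast hn
    rw [inv_mul_le_iff₀ this]
    exact h2

/-- Von Neumann's theorem: averages of powers of a contraction of a Hilbert space converge to the
projection onto its fixed vectors. -/
theorem cauchySeq_toLp_two_ergodicAvg (hT : MeasurePreserving T μ μ) {f : Ω → ℝ}
    (hf : MemLp f 2 μ) : CauchySeq fun n => (memLp_ergodicAvg hT n hf).toLp _ := by
  let K : Lp ℝ 2 μ →L[ℝ] Lp ℝ 2 μ :=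
    (Lp.compMeasurePreservingₗᵢ ℝ T hT).toContinuousLinearMap
  have h := (K.tendsto_birkhoffAverage_orthogonalProjection
    (LinearIsometry.norm_toContinuousLinearMap_le _) (hf.toLp f)).cauchySeq
  have e : (fun n => (memLp_ergodicAvg hT n hf).toLp _)
      = fun n => birkhoffAverage ℝ K id n (hf.toLp f) := by
    funext n
    rw [toLp_ergodicAvg]
    rfl
  rw [e]
  exact h

/-- Simple functions are dense in `L¹` and lie in `L²`. Averaging contracts `L¹`, and on a
probability space the `L¹` norm is at most the `L²` norm, so the `L²` case passes to the limit. -/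
theorem cauchySeq_toLp_one_ergodicAvg [IsProbabilityMeasure μ] (hT : MeasurePreserving T μ μ)
    {f : Ω → ℝ} (hf : MemLp f 1 μ) :
    CauchySeq fun n => (memLp_ergodicAvg hT n hf).toLp _ := by
  rw [Metric.cauchySeq_iff']
  intro ε hε
  obtain ⟨g, hg1, hg2⟩ := hf.exists_simpleFunc_eLpNorm_sub_lt (by simp)
    (ε := ENNReal.ofReal (ε / 4)) (by simpa using hε)
  have hg : MemLp g 2 μ := g.memLp_of_isFiniteMeasure 2 μ
  obtain ⟨N, hN⟩ := Metric.cauchySeq_iff'.1 (cauchySeq_toLp_two_ergodicAvg hT hg) (ε / 4)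
    (by positivity)
  refine ⟨N, fun n hn => ?_⟩
  have hfg : ∀ k, dist ((memLp_ergodicAvg hT k hf).toLp _)
      ((memLp_ergodicAvg hT k hg2).toLp _) < ε / 4 := by
    intro k
    rw [dist_eq_norm, ← MemLp.toLp_sub, MemLp.toLp_congr _ (memLp_ergodicAvg hT k (hf.sub hg2))
      (by rw [ergodicAvg_sub])]
    have h1 := norm_toLp_ergodicAvg_le hT k (hf.sub hg2)
    have h2 : ‖(hf.sub hg2).toLp _‖ < ε / 4 := by
      rw [Lp.norm_toLp]
      exact (ENNReal.lt_ofReal_iff_toReal_lt hg1.ne_top).1 hg1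
    exact h1.trans_lt h2
  have hgg : dist ((memLp_ergodicAvg hT n hg2).toLp _)
      ((memLp_ergodicAvg hT N hg2).toLp _) < ε / 4 := by
    refine lt_of_le_of_lt ?_ (hN n hn)
    rw [dist_eq_norm, dist_eq_norm, ← MemLp.toLp_sub, ← MemLp.toLp_sub, Lp.norm_toLp,
      Lp.norm_toLp]
    have hm := (memLp_ergodicAvg hT n hg).sub (memLp_ergodicAvg hT N hg)
    exact ENNReal.toReal_mono hm.eLpNorm_ne_top
      (eLpNorm_le_eLpNorm_of_exponent_le (by norm_num) hm.1)
  have h1 := hfg n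
  have h2 := hfg N
  have t1 := dist_triangle ((memLp_ergodicAvg hT n hf).toLp _)
    ((memLp_ergodicAvg hT n hg2).toLp _) ((memLp_ergodicAvg hT N hf).toLp _)
  have t2 := dist_triangle ((memLp_ergodicAvg hT n hg2).toLp _)
    ((memLp_ergodicAvg hT N hg2).toLp _) ((memLp_ergodicAvg hT N hf).toLp _)
  rw [dist_comm ((memLp_ergodicAvg hT N hg2).toLp _)] at t2
  linarith

end MeanErgodic

/-! ### Consequences of ergodicity -/

theorem shift_shift {d : ℕ} (x y : Site d) (η : Config d) :
    shift x (shift y η) = shift (x + y) η := by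
  funext b
  simp [shift, add_assoc]

theorem shift_zero {d : ℕ} (η : Config d) : shift 0 η = η := by
  funext b
  simp [shift]

theorem IsTranslationInvariant.measurePreserving {d : ℕ} {μ : Measure (Config d)}
    (hμ : IsTranslationInvariant μ) (x : Site d) : MeasurePreserving (shift x) μ μ :=
  ⟨measurable_shift x, hμ x⟩

/-- The translations that fix `U` almost everywhere form a subgroup, and the unit vectors generate
`ℤ^d`. -/
theorem ae_shift_eq_of_unitVec {d : ℕ} {μ : Measure (Config d)}
    (hμ : IsTranslationInvariant μ) {U : Config d → ℝ}
    (hU : ∀ i : Fin d, U ∘ shift (unitVec i) =ᵐ[μ] U) (x : Site d) : U ∘ shift x =ᵐ[μ] U := by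
  let K : AddSubgroup (Site d) :=
    { carrier := {x | U ∘ shift x =ᵐ[μ] U}
      zero_mem' := by
        change U ∘ shift 0 =ᵐ[μ] U
        exact Filter.Eventually.of_forall fun η => by simp [shift_zero]
      add_mem' := fun {x y} hx hy => by
        have h := (hμ.measurePreserving y).quasiMeasurePreserving.ae_eq_comp hx
        refine EventuallyEq.trans (Filter.Eventually.of_forall fun η => ?_) (h.trans hy)
        simp [shift_shift]
      neg_mem' := fun {x} hx => by
        have h := (hμ.measurePreserving (-x)).quasiMeasurePreserving.ae_eq_comp hx
        refine EventuallyEq.trans h.symm (Filter.Eventually.of_forall fun η => ?_)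
        simp [shift_shift, shift_zero] }
  have h : x ∈ K := by
    have hx : x = ∑ i, x i • unitVec i := by
      conv_lhs => rw [← Finset.univ_sum_single x]
      refine Finset.sum_congr rfl fun i _ => ?_
      simp [unitVec, ← Pi.single_smul]
    rw [hx]
    exact K.sum_mem fun i _ => K.zsmul_mem (hU i) _
  exact h

/-- Ergodicity speaks of strictly invariant events. A level set of `U` is invariant only up to null
sets, so it is replaced by the intersection of its countably many translates. -/
theorem IsErgodic.ae_eq_const {d : ℕ} {μ : Measure (Config d)} [IsProbabilityMeasure μ]
    (herg : IsErgodic μ) {U : Config d → ℝ} (hm : Measurable U)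
    (hU : ∀ x : Site d, U ∘ shift x =ᵐ[μ] U) : ∃ c : ℝ, U =ᵐ[μ] fun _ => c := by
  refine exists_eventuallyEq_const_of_forall_separating MeasurableSet fun s hs => ?_
  set A := U ⁻¹' s with hA
  set A' := ⋂ x : Site d, shift x ⁻¹' A with hA'
  have hAm : MeasurableSet A' := MeasurableSet.iInter fun x => measurable_shift x (hm hs)
  have hinv : ∀ y : Site d, shift y ⁻¹' A' = A' := by
    intro y
    ext η
    simp only [hA', Set.mem_preimage, Set.mem_iInter, shift_shift]
    refine ⟨fun h x => ?_, fun h x => h _⟩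
    have := h (x - y)
    rwa [sub_add_cancel] at this
  have hae : ∀ᵐ η ∂μ, (η ∈ A' ↔ U η ∈ s) := by
    filter_upwards [ae_all_iff.2 hU] with η hη
    simp only [hA', hA, Set.mem_iInter, Set.mem_preimage]
    refine ⟨fun h => ?_, fun h x => ?_⟩
    · have := h 0
      rwa [shift_zero] at this
    · have := hη x
      simp only [Function.comp_apply] at this
      rwa [this]
  rcases herg A' hAm hinv with h | h
  · right
    have h0 : ∀ᵐ η ∂μ, η ∉ A' := measure_eq_zero_iff_ae_notMem.1 h
    filter_upwards [hae, h0] with η h1 h2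
    exact fun h3 => h2 (h1.2 h3)
  · left
    have h0 : ∀ᵐ η ∂μ, η ∈ A' := (prob_compl_eq_zero_iff hAm).2 h
    filter_upwards [hae, h0] with η h1 h2
    exact h1.1 h2

theorem shift_iterate {d : ℕ} (x : Site d) (k : ℕ) :
    (shift x)^[k] = shift ((k : ℤ) • x) := by
  induction k with
  | zero => funext η; simp [shift_zero]
  | succ k ih =>
    funext η
    rw [Function.iterate_succ_apply, ih, shift_shift, Nat.cast_succ, add_smul, one_smul]

theorem ergodicAvg_shift {d : ℕ} (i : Fin d) (n : ℕ) :
    ergodicAvg (shift (unitVec i)) n (fun η : Config d => η (0, i))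
      = fun η => (n : ℝ)⁻¹ * lineSum 0 i n η := by
  funext η
  simp [ergodicAvg, lineSum, shift_iterate, shift]

/-- Around a long thin rectangle, two parallel line sums differ only by the two short sides. -/
theorem LoopCondition.lineSum_shift_sub {d : ℕ} {η : Config d} (hη : LoopCondition η)
    (i j : Fin d) (n : ℕ) :
    lineSum 0 i n (shift (unitVec j) η) - lineSum 0 i n η
      = η ((n : ℤ) • unitVec i, j) - η (0, j) := by
  obtain ⟨φ, -, rfl⟩ := hη.exists_potential
  rw [shift_grad, lineSum_grad, lineSum_grad]
  simp only [grad, Edge.head, zero_add]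
  ring

/-- A single shift need not be ergodic, so the `L¹` limit `U` of the averages is first shown to be
invariant under every unit shift: by the rectangle identity, shifting in direction `j` changes the
average by two gradients divided by `n`. Ergodicity under all of `ℤ^d` then makes `U` constant, and
zero tilt makes the constant zero. -/
theorem tendsto_integral_lineSum {d : ℕ} {μ : Measure (Config d)} [IsProbabilityMeasure μ]
    (hloop : ∀ᵐ η ∂μ, LoopCondition η) (hinv : IsTranslationInvariant μ) (herg : IsErgodic μ)
    (htilt : HasZeroTilt μ) (i : Fin d) :
    Tendsto (fun n : ℕ => (n : ℝ)⁻¹ * ∫ η, |lineSum 0 i n η| ∂μ) atTop (𝓝 0) := by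
  have hT := hinv.measurePreserving (unitVec i)
  have hb : ∀ b : Edge d, MemLp (fun η : Config d => η b) 1 μ := fun b =>
    memLp_one_iff_integrable.2 (htilt b).1
  have hL : ∀ n : ℕ, MemLp (fun η => (n : ℝ)⁻¹ * lineSum 0 i n η) 1 μ := fun n => by
    rw [← ergodicAvg_shift]; exact memLp_ergodicAvg hT n (hb _)
  obtain ⟨U, hU⟩ : ∃ U : Lp ℝ 1 μ, Tendsto (fun n => (hL n).toLp _) atTop (𝓝 U) := by
    refine cauchySeq_tendsto_of_complete ?_
    convert cauchySeq_toLp_one_ergodicAvg hT (hb (0, i)) using 2 with n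
    refine MemLp.toLp_congr _ _ ?_
    rw [ergodicAvg_shift]
  have hUinv : ∀ j : Fin d, U ∘ shift (unitVec j) =ᵐ[μ] U := by
    intro j
    have hTj := hinv.measurePreserving (unitVec j)
    have hK : Tendsto (fun n => Lp.compMeasurePreserving (shift (unitVec j)) hTj ((hL n).toLp _))
        atTop (𝓝 (Lp.compMeasurePreserving (shift (unitVec j)) hTj U)) :=
      ((Lp.isometry_compMeasurePreserving hTj).continuous.tendsto U).comp hU
    have hdiff : Tendsto (fun n => Lp.compMeasurePreserving (shift (unitVec j)) hTj
        ((hL n).toLp _) - (hL n).toLp _) atTop (𝓝 0) := by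
      have hbound : ∀ n : ℕ, ‖Lp.compMeasurePreserving (shift (unitVec j)) hTj
          ((hL n).toLp _) - (hL n).toLp _‖ ≤ (n : ℝ)⁻¹ * (2 * ‖(hb (0, j)).toLp _‖) := by
        intro n
        have hshift := (hinv.measurePreserving ((n : ℤ) • unitVec i))
        have e : Lp.compMeasurePreserving (shift (unitVec j)) hTj ((hL n).toLp _) - (hL n).toLp _
            = (n : ℝ)⁻¹ • (Lp.compMeasurePreserving (shift ((n : ℤ) • unitVec i)) hshift
              ((hb (0, j)).toLp _) - (hb (0, j)).toLp _) := by
          rw [Lp.toLp_compMeasurePreserving, Lp.toLp_compMeasurePreserving, ← MemLp.toLp_sub,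
            ← MemLp.toLp_sub, ← MemLp.toLp_const_smul]
          refine MemLp.toLp_congr _ _ ?_
          filter_upwards [hloop] with η hη
          have := hη.lineSum_shift_sub i j n
          simp only [Pi.sub_apply, Function.comp_apply, Pi.smul_apply, smul_eq_mul]
          rw [← mul_sub, this]
          simp [shift]
        rw [e, norm_smul, norm_inv, Real.norm_natCast]
        refine mul_le_mul_of_nonneg_left ((norm_sub_le _ _).trans ?_) (by positivity)
        rw [Lp.norm_compMeasurePreserving, two_mul]
      refine squeeze_zero_norm hbound ?_
      simpa using (tendsto_inv_atTop_nhds_zero_nat (𝕜 := ℝ)).mul_const (2 * ‖(hb (0, j)).toLp _‖)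
    have heq : Lp.compMeasurePreserving (shift (unitVec j)) hTj U - U = 0 :=
      tendsto_nhds_unique (hK.sub hU) hdiff
    have h1 := Lp.coeFn_compMeasurePreserving U hTj
    rw [sub_eq_zero.1 heq] at h1
    exact h1.symm
  obtain ⟨c, hc⟩ := herg.ae_eq_const (Lp.stronglyMeasurable U).measurable
    (ae_shift_eq_of_unitVec hinv hUinv)
  have hint : Tendsto (fun n => ∫ η, ((hL n).toLp _ : Lp ℝ 1 μ) η ∂μ) atTop (𝓝 (∫ η, U η ∂μ)) :=
    (continuous_integral.tendsto U).comp hU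
  have hzero : ∀ n, ∫ η, ((hL n).toLp _ : Lp ℝ 1 μ) η ∂μ = 0 := by
    intro n
    rw [integral_congr_ae (hL n).coeFn_toLp, integral_const_mul]
    simp only [lineSum]
    rw [integral_finsetSum _ fun k _ => (htilt _).1]
    simp [(htilt _).2]
  simp only [hzero] at hint
  have hc0 : c = 0 := by
    have h1 : ∫ η, U η ∂μ = c := by rw [integral_congr_ae hc]; simp
    rw [← h1]
    exact (tendsto_nhds_unique hint tendsto_const_nhds)
  have hU0 : U = 0 := by
    rw [Lp.eq_zero_iff_ae_eq_zero]
    rw [hc0] at hc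
    exact hc
  rw [hU0] at hU
  have hn := hU.norm
  rw [norm_zero] at hn
  refine hn.congr fun n => ?_
  rw [L1.norm_eq_integral_norm, ← integral_const_mul]
  refine integral_congr_ae ?_
  filter_upwards [(hL n).coeFn_toLp] with η hη
  rw [hη, norm_mul, norm_inv, Real.norm_natCast, Real.norm_eq_abs]

/-! ### The box geometry -/

theorem norm_unitVec_le {d : ℕ} (i : Fin d) : ‖(unitVec i : Site d)‖ ≤ 1 := by
  rw [pi_norm_le_iff_of_nonneg zero_le_one]
  intro j
  simp only [unitVec, Pi.single_apply]
  split_ifs <;> simp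

theorem site_norm_le_iff {d : ℕ} {x : Site d} {n : ℕ} :
    ‖x‖ ≤ n ↔ ∀ i, |x i| ≤ (n : ℤ) := by
  rw [pi_norm_le_iff_of_nonneg (by positivity)]
  refine forall_congr' fun i => ?_
  rw [Int.norm_eq_abs]
  exact_mod_cast Iff.rfl

/-- The box `[lo, hi]^d`. -/
def box (d lo hi : ℕ) : Finset (Site d) := Finset.Icc (fun _ => (lo : ℤ)) (fun _ => (hi : ℤ))

theorem mem_box {d lo hi : ℕ} {x : Site d} :
    x ∈ box d lo hi ↔ ∀ i, (lo : ℤ) ≤ x i ∧ x i ≤ hi := by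
  rw [box, Finset.mem_Icc, Pi.le_def, Pi.le_def, ← forall_and]

theorem card_box (d lo hi : ℕ) : (box d lo hi).card = (hi + 1 - lo) ^ d := by
  rw [box, Pi.card_Icc]
  simp only [Int.card_Icc, Finset.prod_const, Finset.card_univ, Fintype.card_fin]
  congr 1
  omega

/-- The centre `(n, …, n)` of the box `[0, 2n]^d`. -/
def boxCenter (d n : ℕ) : Site d := fun _ => n

theorem mem_box_of_norm_sub_le {d r k lo hi : ℕ} {x : Site d} (h : ‖x - boxCenter d r‖ ≤ k)
    (h1 : lo + k ≤ r) (h2 : r + k ≤ hi) : x ∈ box d lo hi := by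
  rw [site_norm_le_iff] at h
  rw [mem_box]
  intro i
  have := abs_le.1 (h i)
  simp only [boxCenter, Pi.sub_apply] at this
  omega

theorem norm_sub_le_of_mem_box {d r k lo hi : ℕ} {x : Site d} (h : x ∈ box d lo hi)
    (h1 : r ≤ lo + k) (h2 : hi ≤ r + k) : ‖x - boxCenter d r‖ ≤ k := by
  rw [mem_box] at h
  rw [site_norm_le_iff]
  intro i
  have := h i
  simp only [boxCenter, Pi.sub_apply]
  rw [abs_le]
  omega

/-- The cutoff function of the box `[0, 8k]^d`, equal to `1` within distance `2k` of the centre. -/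
def boxCutoff (d k : ℕ) (x : Site d) : ℝ :=
  max 0 (min 1 (2 - ‖x - boxCenter d (4 * k)‖ / (2 * k)))

theorem boxCutoff_eq_one {d k : ℕ} (hk : 0 < k) {x : Site d}
    (h : ‖x - boxCenter d (4 * k)‖ ≤ 2 * k) : boxCutoff d k x = 1 := by
  have hk' : (0 : ℝ) < 2 * k := by positivity
  have : ‖x - boxCenter d (4 * k)‖ / (2 * k) ≤ 1 := (div_le_one hk').2 h
  rw [boxCutoff, min_eq_left (by linarith), max_eq_right zero_le_one]

theorem boxCutoff_eq_zero {d k : ℕ} (hk : 0 < k) {x : Site d}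
    (h : 4 * k ≤ ‖x - boxCenter d (4 * k)‖) : boxCutoff d k x = 0 := by
  have hk' : (0 : ℝ) < 2 * k := by positivity
  have : 2 ≤ ‖x - boxCenter d (4 * k)‖ / (2 * k) := (le_div_iff₀ hk').2 (by linarith)
  rw [boxCutoff, max_eq_left]
  exact (min_le_right _ _).trans (by linarith)

theorem abs_grad_boxCutoff_le {d k : ℕ} (hk : 0 < k) (b : Edge d) :
    |grad (boxCutoff d k) b| ≤ 1 / (2 * k) := by
  have hk' : (0 : ℝ) < 2 * k := by positivity
  have h1 : |‖b.head - boxCenter d (4 * k)‖ - ‖b.1 - boxCenter d (4 * k)‖| ≤ 1 := by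
    refine (abs_norm_sub_norm_le _ _).trans ?_
    rw [sub_sub_sub_cancel_right, Edge.head, add_sub_cancel_left]
    exact norm_unitVec_le _
  simp only [grad, boxCutoff]
  refine (abs_max_sub_max_le_max _ _ _ _).trans (max_le (by simp) ?_)
  refine (abs_min_sub_min_le_max _ _ _ _).trans (max_le (by simp) ?_)
  rw [show ∀ u v : ℝ, 2 - u / (2 * k) - (2 - v / (2 * k)) = -((u - v) / (2 * k)) from
    fun u v => by ring, abs_neg, abs_div, abs_of_pos hk']
  gcongr

/-- Around the centre `(4k, …, 4k)`, translations in `B` range over radius `k` and edges of `S` over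
radius `k`, so translated edges stay within radius `2k`, where the cutoff is `1`. It decreases to
`0` at radius `4k`, with slope `1/(2k)`. The box starts at the origin so that `pathSum` computes
heights in it. -/
theorem isCutoff_box {d k : ℕ} (hk : 0 < k) {S : Finset (Edge d)}
    (hS : ∀ b ∈ S, ‖b.1‖ ≤ k ∧ ‖b.head‖ ≤ k) :
    IsCutoff (box d 0 (8 * k)) (box d (3 * k) (5 * k)) S (boxCutoff d k) (1 / (2 * k)) := by
  have hmove : ∀ x ∈ box d (3 * k) (5 * k), ∀ y : Site d, ‖y‖ ≤ k →
      ‖y + x - boxCenter d (4 * k)‖ ≤ (2 * k : ℕ) := by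
    intro x hx y hy
    have h1 := norm_sub_le_of_mem_box (r := 4 * k) (k := k) hx (by omega) (by omega)
    rw [add_sub_assoc]
    refine (norm_add_le _ _).trans ?_
    push_cast
    linarith
  refine ⟨fun x hx i => ?_, fun x => le_max_left _ _, abs_grad_boxCutoff_le hk, fun b hb => ?_,
    fun x hx b hb => ?_, fun x hx b hb => ?_⟩
  · have := (mem_box.1 hx i).1
    simpa using this
  · have hout : ∀ x : Site d, x ∉ box d 0 (8 * k) → 4 * k + 1 ≤ ‖x - boxCenter d (4 * k)‖ := by
      intro x hx
      by_contra hlt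
      push Not at hlt
      refine hx (mem_box_of_norm_sub_le (r := 4 * k) (k := 4 * k) ?_ (by omega) (by omega))
      rw [site_norm_le_iff]
      intro i
      have h1 := (norm_le_pi_norm (x - boxCenter d (4 * k)) i).trans_lt hlt
      rw [Int.norm_eq_abs] at h1
      have h2 : |(x - boxCenter d (4 * k)) i| < 4 * (k : ℤ) + 1 := by exact_mod_cast h1
      push_cast
      omega
    have hd : |‖b.head - boxCenter d (4 * k)‖ - ‖b.1 - boxCenter d (4 * k)‖| ≤ 1 := by
      refine (abs_norm_sub_norm_le _ _).trans ?_
      rw [sub_sub_sub_cancel_right, Edge.head, add_sub_cancel_left]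
      exact norm_unitVec_le _
    rw [abs_le] at hd
    rw [mem_edgesIn, not_and_or] at hb
    rcases hb with hb | hb
    · have := hout _ hb
      exact ⟨boxCutoff_eq_zero hk (by linarith), boxCutoff_eq_zero hk (by linarith)⟩
    · have := hout _ hb
      exact ⟨boxCutoff_eq_zero hk (by linarith), boxCutoff_eq_zero hk (by linarith)⟩
  · rw [mem_edgesIn, Edge.head_translate]
    exact ⟨mem_box_of_norm_sub_le (hmove x hx _ (hS b hb).1) (by omega) (by omega),
      mem_box_of_norm_sub_le (hmove x hx _ (hS b hb).2) (by omega) (by omega)⟩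
  · refine boxCutoff_eq_one hk ?_
    have := hmove x hx _ (hS b hb).2
    push_cast at this
    exact this

theorem card_edgesTouching_le {d : ℕ} (Λ : Finset (Site d)) :
    (edgesTouching Λ).card ≤ 2 * (d * Λ.card) := by
  refine (Finset.card_union_le _ _).trans ?_
  have h1 : (Λ ×ˢ (Finset.univ : Finset (Fin d))).card = d * Λ.card := by
    rw [Finset.card_product, Finset.card_univ, Fintype.card_fin, mul_comm]
  rw [two_mul]
  exact Nat.add_le_add h1.le (Finset.card_image_le.trans h1.le)

/-- Since `8k + 1 ≤ 4 (2k + 1)`, the number of edges per translation in `B` is bounded uniformly in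
`k`. -/
theorem card_edgesTouching_box_le {d k : ℕ} :
    (edgesTouching (box d 0 (8 * k))).card ≤ 2 * d * 4 ^ d * (box d (3 * k) (5 * k)).card := by
  refine (card_edgesTouching_le _).trans ?_
  rw [card_box, card_box, mul_assoc 2, mul_assoc 2, mul_assoc d, ← mul_pow]
  gcongr
  omega

/-! ### Sublinear growth -/

section Growth

variable {d : ℕ} {μ : Measure (Config d)}

theorem lintegral_lineSum_translate (hinv : IsTranslationInvariant μ) (x : Site d) (i : Fin d)
    (n : ℕ) : ∫⁻ η, ENNReal.ofReal |lineSum x i n η| ∂μ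
      = ∫⁻ η, ENNReal.ofReal |lineSum 0 i n η| ∂μ := by
  have h := (hinv.measurePreserving x).lintegral_comp
    (f := fun η => ENNReal.ofReal |lineSum 0 i n η|)
    (ENNReal.measurable_ofReal.comp (measurable_lineSum 0 i n).abs)
  rw [← h]
  refine lintegral_congr fun η => ?_
  simp only [lineSum, shift, zero_add, add_comm x]

/-- Long lines are controlled by the ergodic theorem; the finitely many short ones have bounded
first moments, absorbed once `ε N` is large. The bound is thus uniform in `n ≤ N`. -/
theorem exists_lintegral_lineSum_le [IsProbabilityMeasure μ] (hloop : ∀ᵐ η ∂μ, LoopCondition η)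
    (hinv : IsTranslationInvariant μ) (herg : IsErgodic μ) (htilt : HasZeroTilt μ) {ε : ℝ}
    (hε : 0 < ε) (i : Fin d) : ∃ N₀ : ℕ, ∀ N ≥ N₀, ∀ n ≤ N,
      ∫⁻ η, ENNReal.ofReal |lineSum 0 i n η| ∂μ ≤ ENNReal.ofReal (ε * N) := by
  have hint : ∀ n, Integrable (lineSum 0 i n) μ := fun n =>
    integrable_finsetSum _ fun k _ => (htilt _).1
  have heq : ∀ n, ∫⁻ η, ENNReal.ofReal |lineSum 0 i n η| ∂μ
      = ENNReal.ofReal (∫ η, |lineSum 0 i n η| ∂μ) := fun n =>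
    (ofReal_integral_eq_lintegral_ofReal (hint n).abs
      (Filter.Eventually.of_forall fun η => abs_nonneg _)).symm
  obtain ⟨N₁, hN₁⟩ := Filter.eventually_atTop.1
    ((tendsto_integral_lineSum hloop hinv herg htilt i).eventually (gt_mem_nhds hε))
  set C := ∑ n ∈ Finset.range (N₁ + 1), ∫ η, |lineSum 0 i n η| ∂μ with hC
  obtain ⟨N₂, hN₂⟩ := exists_nat_ge (C / ε)
  refine ⟨N₂, fun N hN n hn => ?_⟩
  rw [heq]
  refine ENNReal.ofReal_le_ofReal ?_
  rcases le_or_gt n N₁ with h | h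
  · have h1 : ∫ η, |lineSum 0 i n η| ∂μ ≤ C :=
      Finset.single_le_sum (f := fun n => ∫ η, |lineSum 0 i n η| ∂μ)
        (fun n _ => integral_nonneg fun η => abs_nonneg _) (Finset.mem_range.2 (by omega))
    have h2 : (N₂ : ℝ) ≤ N := by exact_mod_cast hN
    rw [div_le_iff₀ hε] at hN₂
    nlinarith
  · have hn0 : (0 : ℝ) < n := by exact_mod_cast (by omega : 0 < n)
    have h1 := (hN₁ n h.le).le
    rw [inv_mul_le_iff₀ hn0] at h1
    have h2 : (n : ℝ) ≤ N := by exact_mod_cast hn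
    nlinarith

theorem exists_lintegral_pathSum_le [IsProbabilityMeasure μ] (hloop : ∀ᵐ η ∂μ, LoopCondition η)
    (hinv : IsTranslationInvariant μ) (herg : IsErgodic μ) (htilt : HasZeroTilt μ) {ε : ℝ}
    (hε : 0 < ε) : ∃ N₀ : ℕ, ∀ N ≥ N₀, ∀ z ∈ box d 0 N,
      ∫⁻ η, ENNReal.ofReal |pathSum z η| ∂μ ≤ ENNReal.ofReal (d * (ε * N)) := by
  choose N₀ hN₀ using exists_lintegral_lineSum_le hloop hinv herg htilt hε
  refine ⟨∑ i, N₀ i, fun N hN z hz => ?_⟩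
  rw [mem_box] at hz
  calc ∫⁻ η, ENNReal.ofReal |pathSum z η| ∂μ
      ≤ ∫⁻ η, ∑ i : Fin d, ENNReal.ofReal |lineSum (truncSite z i) i (z i).toNat η| ∂μ := by
        refine lintegral_mono fun η => ?_
        rw [← ofReal_sum_abs_le]
        exact ENNReal.ofReal_le_ofReal (Finset.abs_sum_le_sum_abs _ _)
    _ = ∑ i : Fin d, ∫⁻ η, ENNReal.ofReal |lineSum 0 i (z i).toNat η| ∂μ := by
        have hm : ∀ i ∈ (Finset.univ : Finset (Fin d)), Measurable fun η : Config d =>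
            ENNReal.ofReal |lineSum (truncSite z i) i (z i).toNat η| := fun i _ =>
          ENNReal.measurable_ofReal.comp (measurable_lineSum _ _ _).abs
        rw [lintegral_finsetSum _ hm]
        exact Finset.sum_congr rfl fun i _ => lintegral_lineSum_translate hinv _ _ _
    _ ≤ ∑ _i : Fin d, ENNReal.ofReal (ε * N) := by
        refine Finset.sum_le_sum fun i _ => hN₀ i N ?_ _ ?_
        · exact (Finset.single_le_sum (f := N₀) (fun _ _ => Nat.zero_le _)
            (Finset.mem_univ i)).trans hN
        · have := (hz i).2
          omega
    _ = ENNReal.ofReal (d * (ε * N)) := by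
        rw [Finset.sum_const, Finset.card_univ, Fintype.card_fin, nsmul_eq_mul,
          ENNReal.ofReal_mul (Nat.cast_nonneg d), ENNReal.ofReal_natCast]

/-! ### Averages over translates and first moments -/

theorem lintegral_truncSq (hinv : IsTranslationInvariant μ) (B : Finset (Site d))
    (S : Finset (Edge d)) (G : Edge d → ℝ) (m : ℝ) :
    ∫⁻ η, truncSq B S G m η ∂μ
      = B.card * ∫⁻ η, ENNReal.ofReal (min (pairing S G η ^ 2) m) ∂μ := by
  have hm : Measurable fun η => ENNReal.ofReal (min (pairing S G η ^ 2) m) :=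
    ENNReal.measurable_ofReal.comp (((measurable_pairing S G).pow_const 2).min measurable_const)
  have hms : ∀ x ∈ B, Measurable fun η =>
      ENNReal.ofReal (min (pairing S G (shift x η) ^ 2) m) := fun x _ =>
    hm.comp (measurable_shift x)
  simp only [truncSq]
  rw [lintegral_finsetSum _ hms, ← nsmul_eq_mul,
    ← Finset.sum_const]
  exact Finset.sum_congr rfl fun x _ => (hinv.measurePreserving x).lintegral_comp hm

theorem exists_lintegral_abs_le (hinv : IsTranslationInvariant μ) (htilt : HasZeroTilt μ) :
    ∃ M : ℝ, 0 ≤ M ∧ ∀ b : Edge d, ∫⁻ η, ENNReal.ofReal |η b| ∂μ ≤ ENNReal.ofReal M := by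
  refine ⟨∑ i : Fin d, ∫ η, |η (0, i)| ∂μ,
    Finset.sum_nonneg fun i _ => integral_nonneg fun η => abs_nonneg _, fun b => ?_⟩
  have h := (hinv.measurePreserving b.1).lintegral_comp
    (f := fun η : Config d => ENNReal.ofReal |η (0, b.2)|)
    (ENNReal.measurable_ofReal.comp (measurable_pi_apply _).abs)
  simp only [shift, zero_add] at h
  rw [h, ← ofReal_integral_eq_lintegral_ofReal (htilt _).1.abs
      (Filter.Eventually.of_forall fun η => abs_nonneg _)]
  exact ENNReal.ofReal_le_ofReal (Finset.single_le_sum (f := fun i => ∫ η, |η (0, i)| ∂μ)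
    (fun i _ => integral_nonneg fun η => abs_nonneg _) (Finset.mem_univ b.2))

theorem lintegral_errorTerm_le [IsProbabilityMeasure μ] {B : Finset (Site d)} {S T : Finset (Edge d)} {c₀ c₁ c₂ M P : ℝ}
    (hM : ∀ b : Edge d, ∫⁻ η, ENNReal.ofReal |η b| ∂μ ≤ ENNReal.ofReal M)
    (hP : ∀ x ∈ B, ∀ b ∈ S, ∫⁻ η, ENNReal.ofReal |pathSum (b.1 + x) η| ∂μ ≤ ENNReal.ofReal P ∧
      ∫⁻ η, ENNReal.ofReal |pathSum (b.head + x) η| ∂μ ≤ ENNReal.ofReal P) :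
    ∫⁻ η, errorTerm B S T c₀ c₁ c₂ η ∂μ ≤ B.card * ENNReal.ofReal c₀
      + (ENNReal.ofReal c₁ * (T.card * ENNReal.ofReal M)
        + ENNReal.ofReal c₂ * (B.card * (S.card * (2 * ENNReal.ofReal P)))) := by
  have hPm : ∀ z : Site d, Measurable fun η : Config d => ENNReal.ofReal |pathSum z η| := fun z =>
    ENNReal.measurable_ofReal.comp (measurable_pathSum z).abs
  have hE : ∀ b : Edge d, Measurable fun η : Config d => ENNReal.ofReal |η b| := fun b =>
    ENNReal.measurable_ofReal.comp (measurable_pi_apply b).abs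
  have h1 : Measurable fun η : Config d => ∑ b ∈ T, ENNReal.ofReal |η b| :=
    Finset.measurable_fun_sum _ fun b _ => hE b
  have h2 : ∀ x ∈ B, Measurable fun η : Config d => ∑ b ∈ S,
      (ENNReal.ofReal |pathSum (b.1 + x) η| + ENNReal.ofReal |pathSum (b.head + x) η|) :=
    fun x _ => Finset.measurable_fun_sum _ fun b _ => (hPm _).add (hPm _)
  have h3 := Finset.measurable_fun_sum B h2
  have h4 : ∀ x : Site d, ∀ b ∈ S, Measurable fun η : Config d =>
      ENNReal.ofReal |pathSum (b.1 + x) η| + ENNReal.ofReal |pathSum (b.head + x) η| :=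
    fun x b _ => (hPm _).add (hPm _)
  simp only [errorTerm]
  rw [lintegral_add_left measurable_const, lintegral_const, measure_univ, mul_one,
    lintegral_add_left (h1.const_mul _), lintegral_const_mul _ h1, lintegral_const_mul _ h3,
    lintegral_finsetSum _ fun b _ => hE b, lintegral_finsetSum _ h2]
  gcongr
  · rw [← nsmul_eq_mul]
    exact Finset.sum_le_card_nsmul _ _ _ fun b _ => hM b
  · rw [← nsmul_eq_mul]
    refine Finset.sum_le_card_nsmul _ _ _ fun x hx => ?_
    rw [lintegral_finsetSum _ (h4 x), ← nsmul_eq_mul]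
    refine Finset.sum_le_card_nsmul _ _ _ fun b hb => ?_
    rw [lintegral_add_left (hPm _), two_mul]
    exact add_le_add (hP x hx b hb).1 (hP x hx b hb).2

end Growth

/-! ### The variance bound -/

section Variance

variable {d : ℕ} {ϱ : Measure ℝ} [IsFiniteMeasure ϱ] {a A : ℝ} {μ : Measure (Config d)}
  [IsProbabilityMeasure μ]

/-- With `δ = 1/(2k)` and `t = 2kε`, the gradient error is of order `δ t = ε` per translate, since
there are at most `2d 4^d |B|` edges. Heights in the box have first moments of order `ε² k`, so the
height error is of order `m ε² k / t`, again `m ε`. Division by `|B|` leaves a constant `C`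
independent of `ε` and `k`. -/
theorem lintegral_min_pairing_sq_le_add (hμ : IsGradientGibbs (potential ϱ) μ) (hne : ϱ ≠ 0)
    (hϱ : ∀ᵐ κ ∂ϱ, a ≤ κ ∧ κ ≤ A) (ha : 0 < a) (hA : 0 ≤ A)
    (hinv : IsTranslationInvariant μ) (herg : IsErgodic μ) (htilt : HasZeroTilt μ)
    (S : Finset (Edge d)) (G : Edge d → ℝ) {Γ m : ℝ} (hm : 0 ≤ m) (hΓ0 : 0 < Γ)
    (hΓ : ∑ b ∈ S, G b ^ 2 ≤ Γ) : ∃ C : ℝ, 0 ≤ C ∧ ∀ ε : ℝ, 0 < ε →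
      ∫⁻ η, ENNReal.ofReal (min (pairing S G η ^ 2) m) ∂μ
        ≤ ENNReal.ofReal (16 * (Γ / a)) + ENNReal.ofReal (C * ε) := by
  obtain ⟨M, hM0, hM⟩ := exists_lintegral_abs_le hinv htilt
  refine ⟨2 * (Γ * (S.card * (A / a))) * (2 * d * 4 ^ d * M) + 16 * m * d * S.card,
    by positivity, fun ε hε => ?_⟩
  -- Growth rate `ε²` rather than `ε`: one power is lost on division by `t = 2kε`.
  obtain ⟨N₀, hN₀⟩ := exists_lintegral_pathSum_le hμ.loop hinv herg htilt
    (show (0 : ℝ) < ε ^ 2 by positivity)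
  obtain ⟨k, hk0, hkN, hkS⟩ : ∃ k : ℕ, 0 < k ∧ N₀ ≤ 8 * k ∧
      ∀ b ∈ S, ‖b.1‖ ≤ k ∧ ‖b.head‖ ≤ k := by
    obtain ⟨r, hr⟩ := exists_nat_ge (∑ b ∈ S, (‖b.1‖ + ‖b.head‖))
    refine ⟨r + N₀ + 1, by omega, by omega, fun b hb => ?_⟩
    have h1 : ‖b.1‖ + ‖b.head‖ ≤ ∑ b ∈ S, (‖b.1‖ + ‖b.head‖) :=
      Finset.single_le_sum (f := fun b : Edge d => ‖b.1‖ + ‖b.head‖)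
        (fun b _ => by positivity) hb
    push_cast
    have h2 := norm_nonneg b.1
    have h3 := norm_nonneg b.head
    have h4 : (0 : ℝ) ≤ N₀ := Nat.cast_nonneg _
    constructor <;> linarith
  have hkr : (0 : ℝ) < k := by exact_mod_cast hk0
  have hc := isCutoff_box hk0 hkS
  set Λ := box d 0 (8 * k) with hΛ
  set B := box d (3 * k) (5 * k) with hB
  have key := hμ.lintegral_truncSq_le hne hϱ ha hA (t := ε * (2 * k)) hc (by positivity)
    (by positivity) hm hΓ0 hΓ
  rw [lintegral_truncSq hinv] at key
  have herr := lintegral_errorTerm_le (μ := μ) (B := B) (S := S) (T := edgesTouching Λ)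
    (c₀ := 16 * (Γ / a)) (c₁ := 2 * (Γ * (S.card * (A * (1 / (2 * k)) * (ε * (2 * k)) / a))))
    (c₂ := 2 * (m / (ε * (2 * k)))) (M := M) (P := d * (ε ^ 2 * (8 * k : ℕ))) hM (by
      intro x hx b hb
      obtain ⟨h1, h2⟩ := mem_edgesIn.1 (hc.translate_mem x hx b hb)
      rw [Edge.head_translate] at h2
      exact ⟨hN₀ _ hkN _ h1, hN₀ _ hkN _ h2⟩)
  have hBpos : B.card ≠ 0 := by
    rw [hB, card_box]
    exact pow_ne_zero _ (by omega)
  have hT : ((edgesTouching Λ).card : ℝ) ≤ 2 * d * 4 ^ d * B.card := by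
    exact_mod_cast card_edgesTouching_box_le (d := d) (k := k)
  have hfinal := key.trans herr
  refine (ENNReal.mul_le_mul_iff_right (a := (B.card : ℝ≥0∞)) (by exact_mod_cast hBpos)
    (ENNReal.natCast_ne_top _)).1 (hfinal.trans ?_)
  rw [mul_add]
  gcongr
  rw [← ENNReal.ofReal_natCast, ← ENNReal.ofReal_natCast, ← ENNReal.ofReal_natCast,
    ← ENNReal.ofReal_ofNat 2, ← ENNReal.ofReal_mul (by positivity),
    ← ENNReal.ofReal_mul (by positivity),
    ← ENNReal.ofReal_mul (by positivity), ← ENNReal.ofReal_mul (by positivity),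
    ← ENNReal.ofReal_mul (by positivity), ← ENNReal.ofReal_mul (by positivity),
    ← ENNReal.ofReal_mul (by positivity), ← ENNReal.ofReal_add (by positivity) (by positivity)]
  refine ENNReal.ofReal_le_ofReal ?_
  have e1 : A * (1 / (2 * k)) * (ε * (2 * k)) / a = A / a * ε := by field_simp
  have e2 : 2 * (m / (ε * (2 * (k : ℝ)))) *
      (B.card * (S.card * (2 * (d * (ε ^ 2 * (8 * k : ℕ))))))
      = B.card * (16 * m * d * S.card * ε) := by
    push_cast
    field_simp
    ring
  rw [e1, e2]
  calc 2 * (Γ * (S.card * (A / a * ε))) * ((edgesTouching Λ).card * M)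
        + B.card * (16 * m * d * S.card * ε)
      ≤ 2 * (Γ * (S.card * (A / a * ε))) * ((2 * d * 4 ^ d * B.card) * M)
        + B.card * (16 * m * d * S.card * ε) := by gcongr
    _ = _ := by ring

theorem lintegral_min_pairing_sq_le (hμ : IsGradientGibbs (potential ϱ) μ) (hne : ϱ ≠ 0)
    (hϱ : ∀ᵐ κ ∂ϱ, a ≤ κ ∧ κ ≤ A) (ha : 0 < a) (hA : 0 ≤ A)
    (hinv : IsTranslationInvariant μ) (herg : IsErgodic μ) (htilt : HasZeroTilt μ)
    (S : Finset (Edge d)) (G : Edge d → ℝ) {Γ m : ℝ} (hm : 0 ≤ m) (hΓ0 : 0 < Γ)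
    (hΓ : ∑ b ∈ S, G b ^ 2 ≤ Γ) :
    ∫⁻ η, ENNReal.ofReal (min (pairing S G η ^ 2) m) ∂μ ≤ ENNReal.ofReal (16 * (Γ / a)) := by
  obtain ⟨C, hC, h⟩ := lintegral_min_pairing_sq_le_add hμ hne hϱ ha hA hinv herg htilt S G hm
    hΓ0 hΓ
  refine ENNReal.le_of_forall_pos_le_add fun ε hε _ => ?_
  have hε' : (0 : ℝ) < ε := hε
  refine (h (ε / (C + 1)) (by positivity)).trans ?_
  gcongr
  rw [← ENNReal.ofReal_coe_nnreal]
  refine ENNReal.ofReal_le_ofReal ?_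
  rw [mul_div_assoc', div_le_iff₀ (by positivity)]
  nlinarith

/-- Linear functionals of the gradients have second moments bounded by the `ℓ²` norm. -/
theorem lintegral_pairing_sq_le (hμ : IsGradientGibbs (potential ϱ) μ) (hne : ϱ ≠ 0)
    (hϱ : ∀ᵐ κ ∂ϱ, a ≤ κ ∧ κ ≤ A) (ha : 0 < a) (hA : 0 ≤ A)
    (hinv : IsTranslationInvariant μ) (herg : IsErgodic μ) (htilt : HasZeroTilt μ)
    (S : Finset (Edge d)) (G : Edge d → ℝ) {Γ : ℝ} (hΓ0 : 0 < Γ)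
    (hΓ : ∑ b ∈ S, G b ^ 2 ≤ Γ) :
    ∫⁻ η, ENNReal.ofReal (pairing S G η ^ 2) ∂μ ≤ ENNReal.ofReal (16 * (Γ / a)) := by
  -- The bound does not depend on the cap, which is removed by monotone convergence.
  have hsup : ∀ η, ENNReal.ofReal (pairing S G η ^ 2)
      = ⨆ n : ℕ, ENNReal.ofReal (min (pairing S G η ^ 2) n) := by
    intro η
    refine le_antisymm ?_ (iSup_le fun n => ENNReal.ofReal_le_ofReal (min_le_left _ _))
    obtain ⟨n, hn⟩ := exists_nat_ge (pairing S G η ^ 2)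
    refine le_iSup_of_le n ?_
    rw [min_eq_left hn]
  simp only [hsup]
  rw [lintegral_iSup]
  · exact iSup_le fun n => lintegral_min_pairing_sq_le hμ hne hϱ ha hA hinv herg htilt S G
      (Nat.cast_nonneg n) hΓ0 hΓ
  · exact fun n => ENNReal.measurable_ofReal.comp
      (((measurable_pairing S G).pow_const 2).min measurable_const)
  · intro n n' hn η
    exact ENNReal.ofReal_le_ofReal (min_le_min le_rfl (by exact_mod_cast hn))

end Variance

/-! ### Partial derivatives of test functions -/

/-- The `i`-th partial derivative. -/
def pderiv {d : ℕ} (i : Fin d) (g : Eucl d → ℝ) (x : Eucl d) : ℝ :=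
  fderiv ℝ g x (EuclideanSpace.basisFun (Fin d) ℝ i)

section Derivatives

variable {d : ℕ} {g h : Eucl d → ℝ}

theorem IsTest.pderiv (hg : IsTest g) (i : Fin d) : IsTest (pderiv i g) where
  smooth := (hg.smooth.fderiv_right (m := ∞) le_rfl).clm_apply contDiff_const
  compact := (hg.compact.fderiv (𝕜 := ℝ)).comp_left
    (g := fun L : Eucl d →L[ℝ] ℝ => L (EuclideanSpace.basisFun (Fin d) ℝ i)) (by simp)

theorem IsTest.integrable (hg : IsTest g) : Integrable g :=
  hg.smooth.continuous.integrable_of_hasCompactSupport hg.compact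

theorem IsTest.mul (hg : IsTest g) (hh : IsTest h) : IsTest fun x => g x * h x :=
  ⟨hg.smooth.mul hh.smooth, hg.compact.mul_right⟩

theorem IsTest.sq (hg : IsTest g) : IsTest fun x => g x ^ 2 := by
  simpa only [pow_two] using hg.mul hg

theorem IsTest.integral_mul_pderiv (hg : IsTest g) (hh : IsTest h) (i : Fin d) :
    ∫ x, g x * GradientField.pderiv i h x = -∫ x, GradientField.pderiv i g x * h x :=
  integral_mul_fderiv_eq_neg_fderiv_mul_of_integrable
    ((hg.pderiv i).mul hh).integrable (hg.mul (hh.pderiv i)).integrable (hg.mul hh).integrable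
    (fun x _ => hg.differentiable x) (fun x _ => hh.differentiable x)

theorem IsTest.fderiv_fderiv (hg : IsTest g) (i j : Fin d) (x : Eucl d) :
    GradientField.pderiv i (GradientField.pderiv j g) x
      = fderiv ℝ (fderiv ℝ g) x (EuclideanSpace.basisFun (Fin d) ℝ i)
        (EuclideanSpace.basisFun (Fin d) ℝ j) := by
  have hD : ContDiff ℝ ∞ (fderiv ℝ g) := hg.smooth.fderiv_right (m := ∞) le_rfl
  change fderiv ℝ (fun y => fderiv ℝ g y (EuclideanSpace.basisFun (Fin d) ℝ j)) x _ = _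
  rw [fderiv_clm_apply (hD.differentiable (by simp) x) (differentiableAt_const _)]
  simp

theorem IsTest.pderiv_comm (hg : IsTest g) (i j : Fin d) :
    GradientField.pderiv i (GradientField.pderiv j g)
      = GradientField.pderiv j (GradientField.pderiv i g) := by
  funext x
  rw [hg.fderiv_fderiv, hg.fderiv_fderiv]
  exact ((hg.two x).isSymmSndFDerivAt (by simp)) _ _

theorem IsTest.laplacian_eq_sum (hg : IsTest g) (x : Eucl d) :
    Δ g x = ∑ i, GradientField.pderiv i (GradientField.pderiv i g) x := by
  rw [IsTest.lap_eq]
  refine Finset.sum_congr rfl fun i _ => ?_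
  rw [iteratedFDeriv_two_apply, hg.fderiv_fderiv]
  simp

theorem norm_gradient_sq (x : Eucl d) : ‖∇ g x‖ ^ 2 = ∑ i, GradientField.pderiv i g x ^ 2 := by
  rw [← real_inner_self_eq_norm_sq, ← (EuclideanSpace.basisFun (Fin d) ℝ).sum_inner_mul_inner]
  refine Finset.sum_congr rfl fun i _ => ?_
  rw [inner_gradient_left, inner_gradient_right, pow_two]
  simp [GradientField.pderiv]

/-- Two integrations by parts turn the integral into that of `(∂_i ∂_j g)²`. -/
theorem IsTest.integral_pderiv_pderiv_nonneg (hg : IsTest g) (i j : Fin d) :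
    0 ≤ ∫ x, GradientField.pderiv i (GradientField.pderiv i g) x
      * GradientField.pderiv j (GradientField.pderiv j g) x := by
  have hi := hg.pderiv i
  have hj := hg.pderiv j
  rw [(hi.pderiv i).integral_mul_pderiv hj j]
  rw [hi.pderiv_comm j i]
  have h2 := hj.integral_mul_pderiv (hi.pderiv j) i
  have h3 : ∫ x, GradientField.pderiv i (GradientField.pderiv j (GradientField.pderiv i g)) x
      * GradientField.pderiv j g x = -∫ x, GradientField.pderiv i (GradientField.pderiv j g) x
        * GradientField.pderiv j (GradientField.pderiv i g) x := by
    rw [← h2]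
    exact integral_congr_ae (Filter.Eventually.of_forall fun x => mul_comm _ _)
  rw [h3, neg_neg, hg.pderiv_comm j i]
  exact integral_nonneg fun x => mul_self_nonneg _

/-- Expand `(Δ g)²` and drop the off-diagonal terms, whose integrals are nonnegative. -/
theorem IsTest.sum_integral_pderiv_sq_le (hg : IsTest g) :
    ∑ i, ∫ x, GradientField.pderiv i (GradientField.pderiv i g) x ^ 2 ≤ ∫ x, Δ g x ^ 2 := by
  have h1 : ∫ x, Δ g x ^ 2 = ∑ i, ∑ j, ∫ x, GradientField.pderiv i (GradientField.pderiv i g) x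
      * GradientField.pderiv j (GradientField.pderiv j g) x := by
    have hint : ∀ i j, Integrable fun x => GradientField.pderiv i (GradientField.pderiv i g) x
        * GradientField.pderiv j (GradientField.pderiv j g) x := fun i j =>
      (((hg.pderiv i).pderiv i).mul ((hg.pderiv j).pderiv j)).integrable
    simp only [hg.laplacian_eq_sum, pow_two, Finset.sum_mul_sum]
    rw [integral_finsetSum _ fun i _ => integrable_finsetSum _ fun j _ => hint i j]
    exact Finset.sum_congr rfl fun i _ => integral_finsetSum _ fun j _ => hint i j
  rw [h1]
  refine Finset.sum_le_sum fun i _ => ?_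
  simp only [pow_two]
  exact Finset.single_le_sum (f := fun j => ∫ x, GradientField.pderiv i
    (GradientField.pderiv i g) x * GradientField.pderiv j (GradientField.pderiv j g) x)
    (fun j _ => hg.integral_pderiv_pderiv_nonneg i j) (Finset.mem_univ i)

theorem IsTest.integral_sum_sq_le (hg : IsTest g) :
    ∑ i, ∫ x, (GradientField.pderiv i g x ^ 2
      + GradientField.pderiv i (GradientField.pderiv i g) x ^ 2)
      ≤ ∫ x, (Δ g x ^ 2 + ‖∇ g x‖ ^ 2) := by
  have i1 : ∀ i, Integrable fun x => GradientField.pderiv i g x ^ 2 := fun i =>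
    (hg.pderiv i).sq.integrable
  have i2 : ∀ i, Integrable fun x => GradientField.pderiv i (GradientField.pderiv i g) x ^ 2 :=
    fun i => ((hg.pderiv i).pderiv i).sq.integrable
  have i3 : Integrable fun x => Δ g x ^ 2 := by
    simpa only [pow_two] using hg.integrable_mul hg
  have i4 : Integrable fun x => ‖∇ g x‖ ^ 2 := by
    simp only [norm_gradient_sq]
    exact integrable_finsetSum _ fun i _ => i1 i
  rw [integral_add i3 i4]
  simp only [integral_add (i1 _) (i2 _), Finset.sum_add_distrib, norm_gradient_sq]
  rw [integral_finsetSum _ fun i _ => i1 i, add_comm]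
  exact add_le_add hg.sum_integral_pderiv_sq_le le_rfl

end Derivatives

/-! ### Integrals over lattice cells -/

/-- The unit cell of the lattice point `z`. -/
def cell {d : ℕ} (z : Site d) : Set (Eucl d) := {x | floorSite x = z}

theorem mem_cell {d : ℕ} {z : Site d} {x : Eucl d} :
    x ∈ cell z ↔ ∀ i, (z i : ℝ) ≤ x i ∧ x i < z i + 1 := by
  simp only [cell, Set.mem_ofPred_eq, funext_iff, floorSite, Int.floor_eq_iff]

theorem measurable_floorSite {d : ℕ} : Measurable (floorSite (d := d)) :=
  measurable_pi_lambda _ fun i => Int.measurable_floor.comp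
    (by fun_prop : Continuous fun x : Eucl d => x i).measurable

theorem measurableSet_cell {d : ℕ} (z : Site d) : MeasurableSet (cell z) :=
  measurable_floorSite (measurableSet_singleton z)

theorem toLp_preimage_cell {d : ℕ} (z : Site d) :
    (MeasurableEquiv.toLp 2 (Fin d → ℝ)).symm.symm ⁻¹' (cell z)
      = Set.univ.pi fun i => Set.Ico (z i : ℝ) (z i + 1) := by
  ext y
  simp only [Set.mem_preimage, mem_cell, Set.mem_univ_pi, Set.mem_Ico]
  rfl

theorem setIntegral_cell {d : ℕ} (z : Site d) (f : Eucl d → ℝ) :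
    ∫ x in cell z, f x
      = ∫ y in Set.Icc (fun i => (z i : ℝ)) (fun i => (z i : ℝ) + 1), f (WithLp.toLp 2 y) := by
  have hmp := (EuclideanSpace.volume_preserving_symm_measurableEquiv_toLp (Fin d)).symm
  rw [← hmp.setIntegral_preimage_emb (MeasurableEquiv.measurableEmbedding _),
    toLp_preimage_cell]
  exact setIntegral_congr_set (by rw [volume_pi]; exact Measure.univ_pi_Ico_ae_eq_Icc)

theorem volume_cell {d : ℕ} (z : Site d) : volume (cell z) = 1 := by
  have hmp := (EuclideanSpace.volume_preserving_symm_measurableEquiv_toLp (Fin d)).symm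
  rw [← hmp.measure_preimage_equiv, toLp_preimage_cell, Real.volume_pi_Ico]
  simp

theorem setIntegral_cell_add {d : ℕ} (z : Site d) (i : Fin d) (f : Eucl d → ℝ) :
    ∫ x in cell (z + unitVec i), f x
      = ∫ x in cell z, f (x + EuclideanSpace.basisFun (Fin d) ℝ i) := by
  have h := (measurePreserving_add_right (volume : Measure (Eucl d))
    (EuclideanSpace.basisFun (Fin d) ℝ i)).setIntegral_preimage_emb
    (measurableEmbedding_addRight _) f (cell (z + unitVec i))
  rw [← h]
  congr 2
  ext x
  simp only [mem_cell, Set.mem_preimage, unitVec, Pi.add_apply, Pi.single_apply]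
  refine forall_congr' fun j => ?_
  rw [PiLp.add_apply, EuclideanSpace.basisFun_apply, PiLp.single_apply]
  by_cases hj : j = i
  · simp only [hj, if_true, Int.cast_add, Int.cast_one]
    constructor <;> intro h <;> constructor <;> linarith
  · simp [hj]

/-! ### Fluxes through the faces of lattice cells -/

/-- The integral of `k` over the face of the cell of `z` that is orthogonal to the `i`-th
direction and contains `z`, written as an integral over the cell. -/
def faceFlux {d : ℕ} (i : Fin d) (k : Eucl d → ℝ) (z : Site d) : ℝ :=
  ∫ x in cell z, (k x - (1 - Int.fract (x i)) * pderiv i k x)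

/-- The divergence theorem for the vector field whose only component is `F` in direction `i`; its
two boundary terms cancel. -/
theorem setIntegral_Icc_fderiv_eq_zero {n : ℕ} (i : Fin (n + 1)) {a b : Fin (n + 1) → ℝ}
    (hab : a ≤ b) {F : (Fin (n + 1) → ℝ) → ℝ} (hF : ContDiff ℝ 1 F)
    (hface : ∀ y, F (i.insertNth (b i) y) = F (i.insertNth (a i) y)) :
    ∫ y in Set.Icc a b, fderiv ℝ F y (Pi.single i 1) = 0 := by
  classical
  have hsum : ∀ y, ∑ j, (if j = i then fderiv ℝ F y else 0) (Pi.single j 1)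
      = fderiv ℝ F y (Pi.single i 1) := by
    intro y
    rw [Finset.sum_eq_single i (fun j _ hj => by simp [hj]) (fun h => absurd (Finset.mem_univ i) h)]
    simp
  have hcont : Continuous fun y => fderiv ℝ F y (Pi.single i 1) :=
    (hF.continuous_fderiv (by simp)).clm_apply continuous_const
  have h := integral_divergence_of_hasFDerivAt_off_countable' a b hab
    (fun j y => if j = i then F y else 0) (fun j y => if j = i then fderiv ℝ F y else 0) ∅
    Set.countable_empty
    (fun j => by
      by_cases hj : j = i
      · simpa [hj] using hF.continuous.continuousOn
      · simpa [hj] using continuousOn_const)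
    (fun y _ j => by
      by_cases hj : j = i
      · simpa [hj] using (hF.differentiable (by simp) y).hasFDerivAt
      · simpa [hj] using hasFDerivAt_const (0 : ℝ) y)
    (by simpa only [hsum] using hcont.continuousOn.integrableOn_compact isCompact_Icc)
  simp only [hsum] at h
  rw [h]
  refine Finset.sum_eq_zero fun j _ => ?_
  by_cases hj : j = i
  · subst hj
    simp [hface]
  · simp [hj]

section Flux

variable {d : ℕ} {k : Eucl d → ℝ}

theorem integrableOn_cell {z : Site d} {f : Eucl d → ℝ} (hf : Measurable f) {C : ℝ}
    (hC : ∀ x, |f x| ≤ C) : IntegrableOn f (cell z) :=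
  Measure.integrableOn_of_bounded (by rw [volume_cell]; simp) hf.aestronglyMeasurable (M := C)
    (Filter.Eventually.of_forall hC)

theorem IsTest.exists_bound (hk : IsTest k) : ∃ C : ℝ, ∀ x, |k x| ≤ C :=
  hk.compact.exists_bound_of_continuous hk.smooth.continuous

theorem IsTest.integrableOn_fract_mul (hk : IsTest k) (i : Fin d) (z : Site d) :
    IntegrableOn (fun x => (1 - Int.fract (x i)) * k x) (cell z) := by
  obtain ⟨C, hC⟩ := hk.exists_bound
  have hi : Measurable fun x : Eucl d => x i :=
    (by fun_prop : Continuous fun x : Eucl d => x i).measurable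
  refine integrableOn_cell (C := C)
    ((measurable_const.sub (measurable_fract.comp hi)).mul hk.smooth.continuous.measurable)
    fun x => ?_
  have h1 := Int.fract_nonneg (x i)
  have h2 := (Int.fract_lt_one (x i)).le
  rw [abs_mul, abs_of_nonneg (by linarith)]
  calc (1 - Int.fract (x i)) * |k x| ≤ 1 * |k x| := by gcongr; linarith
    _ ≤ C := by rw [one_mul]; exact hC x

theorem IsTest.translate (hk : IsTest k) (v : Eucl d) : IsTest fun x => k (x + v) :=
  ⟨hk.smooth.comp (contDiff_id.add contDiff_const),
    hk.compact.comp_homeomorph (Homeomorph.addRight v)⟩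

theorem pderiv_translate (i : Fin d) (v x : Eucl d) :
    pderiv i (fun y => k (y + v)) x = pderiv i k (x + v) := by
  simp only [pderiv, fderiv_comp_add_right]

/-- The divergence theorem on a cell. -/
theorem IsTest.setIntegral_cell_pderiv (hk : IsTest k) (i : Fin d) (z : Site d) :
    ∫ x in cell z, GradientField.pderiv i k x
      = faceFlux i k (z + unitVec i) - faceFlux i k z := by
  set e := EuclideanSpace.basisFun (Fin d) ℝ i with he
  have hke := hk.translate e
  have hw : IsTest fun x => k (x + e) + (-1 : ℝ) * k x := by
    have := hke.add (hk.smul (-1))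
    exact this
  have hwd : ∀ x, GradientField.pderiv i (fun x => k (x + e) + (-1 : ℝ) * k x) x
      = GradientField.pderiv i k (x + e) - GradientField.pderiv i k x := by
    intro x
    rw [← pderiv_translate]
    simp only [GradientField.pderiv]
    rw [fderiv_fun_add (hke.differentiable x) ((hk.differentiable x).const_mul _),
      fderiv_const_mul (hk.differentiable x)]
    simp [sub_eq_add_neg]
  have hfr : ∀ x : Eucl d, Int.fract ((x + e) i) = Int.fract (x i) := by
    intro x
    rw [PiLp.add_apply, he, EuclideanSpace.basisFun_apply, PiLp.single_apply, if_pos rfl,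
      Int.fract_add_one]
  rw [faceFlux, setIntegral_cell_add, faceFlux]
  simp only [← he, hfr]
  have i1 : IntegrableOn (fun x => k (x + e) - (1 - Int.fract (x i)) *
      GradientField.pderiv i k (x + e)) (cell z) := by
    refine hke.integrable.integrableOn.sub ?_
    simpa only [pderiv_translate] using (hke.pderiv i).integrableOn_fract_mul i z
  have i2 : IntegrableOn (fun x => k x - (1 - Int.fract (x i)) *
      GradientField.pderiv i k x) (cell z) :=
    hk.integrable.integrableOn.sub ((hk.pderiv i).integrableOn_fract_mul i z)
  have i3 : IntegrableOn (fun x => k (x + e) - (1 - Int.fract (x i)) *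
      GradientField.pderiv i k (x + e) - (k x - (1 - Int.fract (x i)) *
      GradientField.pderiv i k x)) (cell z) := i1.sub i2
  rw [← integral_sub i1 i2, ← sub_eq_zero, ← integral_sub (hk.pderiv i).integrable.integrableOn i3]
  have hd : 0 < d := i.pos
  obtain ⟨n, rfl⟩ : ∃ n, d = n + 1 := ⟨d - 1, by omega⟩
  -- `∂_i F` is the difference of the two sides' integrands. On the face `y_i = z_i` the field `F`
  -- equals `k(y + e)`, and on the opposite face it equals `k(y)`, so its values at corresponding
  -- points agree.
  let F : (Fin (n + 1) → ℝ) → ℝ := fun y =>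
    (1 - (y i - z i)) * (k (WithLp.toLp 2 y + e) + (-1 : ℝ) * k (WithLp.toLp 2 y))
      + k (WithLp.toLp 2 y)
  let L : (Fin (n + 1) → ℝ) →L[ℝ] Eucl (n + 1) :=
    ((PiLp.continuousLinearEquiv 2 ℝ (fun _ : Fin (n + 1) => ℝ)).symm :
      (Fin (n + 1) → ℝ) →L[ℝ] Eucl (n + 1))
  have hL : ∀ y, L y = WithLp.toLp 2 y := fun y => rfl
  have hLe : L (Pi.single i 1) = e := by
    rw [he, hL, EuclideanSpace.basisFun_apply]
    rfl
  have hdiffL : ∀ (u : Eucl (n + 1) → ℝ), IsTest u → ∀ y,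
      HasFDerivAt (fun y => u (WithLp.toLp 2 y)) ((fderiv ℝ u (L y)).comp L) y := fun u hu y =>
    (hu.differentiable (L y)).hasFDerivAt.comp y L.hasFDerivAt
  have hcdL : ∀ (u : Eucl (n + 1) → ℝ), IsTest u →
      ContDiff ℝ 1 (fun y => u (WithLp.toLp 2 y)) := fun u hu =>
    (hu.smooth.of_le (by simp)).comp L.contDiff
  have hlin : ∀ y, HasFDerivAt (fun y : Fin (n + 1) → ℝ => 1 - (y i - z i))
      (-(ContinuousLinearMap.proj i : (Fin (n + 1) → ℝ) →L[ℝ] ℝ)) y := fun y => by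
    have := (((ContinuousLinearMap.proj (R := ℝ) (φ := fun _ : Fin (n + 1) => ℝ) i).hasFDerivAt
      (x := y)).sub_const (z i : ℝ)).const_sub 1
    exact this
  have hF : ContDiff ℝ 1 F := by
    refine ContDiff.add (ContDiff.mul ?_ (hcdL _ hw)) (hcdL _ hk)
    exact contDiff_const.sub ((contDiff_apply ℝ ℝ i).sub contDiff_const)
  have hFd : ∀ y, fderiv ℝ F y (Pi.single i 1) =
      (1 - (y i - z i)) * (GradientField.pderiv i k (WithLp.toLp 2 y + e)
        - GradientField.pderiv i k (WithLp.toLp 2 y))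
      - (k (WithLp.toLp 2 y + e) - k (WithLp.toLp 2 y))
      + GradientField.pderiv i k (WithLp.toLp 2 y) := by
    intro y
    have h1 := (((hlin y).mul (hdiffL _ hw y)).add (hdiffL _ hk y)).fderiv
    have h2 : fderiv ℝ F y = _ := h1
    rw [h2, ← hwd]
    simp only [_root_.add_apply, _root_.smul_apply,
      ContinuousLinearMap.comp_apply, _root_.neg_apply,
      ContinuousLinearMap.proj_apply, hLe, hL, Pi.single_eq_same, smul_eq_mul,
      GradientField.pderiv, he]
    ring
  have hbox := setIntegral_Icc_fderiv_eq_zero i (a := fun i => (z i : ℝ))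
    (b := fun i => (z i : ℝ) + 1) (fun i => by simp) hF (by
      intro y
      have hshift : (WithLp.toLp 2 (i.insertNth ((z i : ℝ) + 1) y) : Eucl (n + 1))
          = WithLp.toLp 2 (i.insertNth (z i : ℝ) y) + e := by
        ext j
        rw [PiLp.add_apply, he, EuclideanSpace.basisFun_apply, PiLp.single_apply]
        refine Fin.succAboveCases i ?_ (fun j => ?_) j
        · simp
        · simp
      simp only [F, Fin.insertNth_apply_same, hshift]
      ring)
  have hcell := setIntegral_cell z fun x : Eucl (n + 1) =>
    (1 - (x i - z i)) * (GradientField.pderiv i k (x + e) - GradientField.pderiv i k x)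
      - (k (x + e) - k x) + GradientField.pderiv i k x
  simp only [hFd] at hbox
  rw [hbox] at hcell
  rw [← hcell]
  refine setIntegral_congr_fun (measurableSet_cell z) fun x hx => ?_
  have hfl : Int.fract (x i) = x i - z i := by
    have h := (mem_cell.1 hx) i
    rw [Int.fract, Int.floor_eq_iff.2 h]
  simp only [hfl]
  ring

end Flux

section Representation

variable {d : ℕ} {g k : Eucl d → ℝ}

/-- A face is null in the cell, so `L²` control of the flux must use a derivative. In the form
integrated over the cell it follows from Jensen's inequality and `0 ≤ 1 - fract ≤ 1`. -/
theorem IsTest.faceFlux_sq_le (hk : IsTest k) (i : Fin d) (z : Site d) :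
    faceFlux i k z ^ 2 ≤ ∫ x in cell z, 2 * (k x ^ 2 + GradientField.pderiv i k x ^ 2) := by
  have hp := hk.pderiv i
  have i1 : IntegrableOn (fun x => k x - (1 - Int.fract (x i)) *
      GradientField.pderiv i k x) (cell z) :=
    hk.integrable.integrableOn.sub (hp.integrableOn_fract_mul i z)
  have i2 : IntegrableOn (fun x => 2 * (k x ^ 2 + GradientField.pderiv i k x ^ 2)) (cell z) :=
    ((hk.sq.integrable.add hp.sq.integrable).const_mul 2).integrableOn
  set m := faceFlux i k z with hm
  have i3 : IntegrableOn (fun _ : Eucl d => m ^ 2) (cell z) := by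
    refine integrableOn_const ?_
    rw [volume_cell]; simp
  -- Jensen by hand: the cell has volume one and `2 m w - m² ≤ w²` pointwise for the integrand `w`
  -- of the flux.
  have e : m ^ 2 = ∫ x in cell z,
      (2 * m * (k x - (1 - Int.fract (x i)) * GradientField.pderiv i k x) - m ^ 2) := by
    rw [integral_sub (i1.const_mul _) i3, integral_const_mul, setIntegral_const, measureReal_def,
      volume_cell]
    change m ^ 2 = 2 * m * m - _
    simp
    ring
  rw [e]
  refine integral_mono ((i1.const_mul _).sub i3) i2 fun x => ?_
  have h1 := Int.fract_nonneg (x i)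
  have h2 := (Int.fract_lt_one (x i)).le
  have h3 : ((1 - Int.fract (x i)) * GradientField.pderiv i k x) ^ 2
      ≤ GradientField.pderiv i k x ^ 2 := by
    rw [mul_pow]
    have : (1 - Int.fract (x i)) ^ 2 ≤ 1 := by nlinarith
    nlinarith [sq_nonneg (GradientField.pderiv i k x)]
  have h4 := sq_nonneg (k x - (1 - Int.fract (x i)) * GradientField.pderiv i k x - m)
  have h5 := sq_nonneg (k x + (1 - Int.fract (x i)) * GradientField.pderiv i k x)
  dsimp only
  nlinarith

theorem pairwiseDisjoint_cell (s : Set (Site d)) : s.PairwiseDisjoint cell := by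
  intro z _ w _ hzw
  refine Set.disjoint_left.2 fun x hx hy => hzw ?_
  exact hx.symm.trans hy

theorem sum_setIntegral_cell_le {u : Eucl d → ℝ} (hu : Integrable u) (h0 : ∀ x, 0 ≤ u x)
    (Z : Finset (Site d)) : ∑ z ∈ Z, ∫ x in cell z, u x ≤ ∫ x, u x := by
  rw [← integral_biUnion_finset Z (fun z _ => measurableSet_cell z) (pairwiseDisjoint_cell _)
    fun z _ => hu.integrableOn]
  exact setIntegral_le_integral hu (Filter.Eventually.of_forall h0)

theorem integral_mul_floorSite {f : Eucl d → ℝ} (hf : Integrable f) {Z : Finset (Site d)}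
    (hZ : ∀ x, floorSite x ∉ Z → f x = 0) (φ : Site d → ℝ) :
    Integrable (fun x => f x * φ (floorSite x)) ∧
    ∫ x, f x * φ (floorSite x) = ∑ z ∈ Z, φ z * ∫ x in cell z, f x := by
  have h1 : ∀ x, f x * φ (floorSite x)
      = ∑ z ∈ Z, (cell z).indicator (fun x => φ z * f x) x := by
    intro x
    by_cases hx : floorSite x ∈ Z
    · have h0 : ∀ w ∈ Z, w ≠ floorSite x → (cell w).indicator (fun x => φ w * f x) x = 0 :=
        fun w _ hw => Set.indicator_of_notMem (show x ∉ cell w from fun h => hw (Eq.symm h)) _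
      rw [Finset.sum_eq_single_of_mem _ hx h0,
        Set.indicator_of_mem (show x ∈ cell (floorSite x) from rfl), mul_comm]
    · rw [hZ x hx, zero_mul, Finset.sum_eq_zero]
      intro w _
      simp [Set.indicator, hZ x hx]
  have h2 : ∀ z ∈ Z, Integrable ((cell z).indicator fun x => φ z * f x) := fun z _ =>
    (hf.const_mul _).indicator (measurableSet_cell z)
  simp only [h1]
  refine ⟨integrable_finsetSum _ h2, ?_⟩
  rw [integral_finsetSum _ h2]
  refine Finset.sum_congr rfl fun z _ => ?_
  rw [integral_indicator (measurableSet_cell z), integral_const_mul]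

theorem IsTest.exists_sites (hg : IsTest g) :
    ∃ Z : Finset (Site d), ∀ x ∈ tsupport g, floorSite x ∈ Z := by
  obtain ⟨R, hR⟩ := (hg.compact.isCompact).isBounded.exists_norm_le
  refine ⟨Finset.Icc (fun _ => ⌊-R⌋) (fun _ => ⌊R⌋), fun x hx => ?_⟩
  have h1 : ∀ i, |x i| ≤ R := fun i => (PiLp.norm_apply_le x i).trans (hR x hx)
  rw [Finset.mem_Icc]
  exact ⟨fun i => Int.floor_le_floor (abs_le.1 (h1 i)).1,
    fun i => Int.floor_le_floor (abs_le.1 (h1 i)).2⟩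

theorem tsupport_pderiv_subset (i : Fin d) : tsupport (pderiv i g) ⊆ tsupport g := by
  refine closure_minimal (fun x hx => ?_) (isClosed_tsupport g)
  refine support_fderiv_subset ℝ (f := g) ?_
  intro h
  exact hx (by simp [pderiv, h])

theorem faceFlux_eq_zero {i : Fin d} {Z : Finset (Site d)}
    (hZ : ∀ x ∈ tsupport k, floorSite x ∈ Z) {z : Site d} (hz : z ∉ Z) : faceFlux i k z = 0 := by
  refine setIntegral_eq_zero_of_forall_eq_zero fun x hx => ?_
  have h1 : x ∉ tsupport k := fun h => hz (by rw [← show floorSite x = z from hx]; exact hZ x h)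
  have h2 : x ∉ tsupport (pderiv i k) := fun h => h1 (tsupport_pderiv_subset i h)
  rw [image_eq_zero_of_notMem_tsupport h1, image_eq_zero_of_notMem_tsupport h2]
  simp

/-- Summation by parts: the hypotheses make all terms off `Z` vanish, so both sides are sums over
the whole lattice, where the shift is a bijection. -/
theorem sum_mul_sub_shift {Z : Finset (Site d)} {u : Site d → ℝ} (hu : ∀ z ∉ Z, u z = 0)
    (v : Site d) (hv : ∀ z ∉ Z, u (z + v) - u z = 0) (φ : Site d → ℝ) :
    ∑ z ∈ Z, φ z * (u (z + v) - u z) = ∑ z ∈ Z, (φ (z - v) - φ z) * u z := by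
  have s1 : Summable fun z => φ z * u z := summable_of_ne_finset_zero (s := Z)
    fun z hz => by rw [hu z hz, mul_zero]
  have s2 : Summable fun z => φ (z - v) * u z := summable_of_ne_finset_zero (s := Z)
    fun z hz => by rw [hu z hz, mul_zero]
  have e : ∀ z, (fun z => φ (z - v) * u z) (Equiv.addRight v z) = φ z * u (z + v) := by
    intro z; simp
  have s3 : Summable fun z => φ z * u (z + v) := by
    have := (Equiv.addRight v).summable_iff.2 s2
    refine this.congr fun z => ?_
    simp
  have t1 : ∑' z, φ (z - v) * u z = ∑' z, φ z * u (z + v) := by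
    rw [← (Equiv.addRight v).tsum_eq]
    exact tsum_congr e
  have e1 : ∑' z, φ z * (u (z + v) - u z) = ∑ z ∈ Z, φ z * (u (z + v) - u z) :=
    tsum_eq_sum fun z hz => by rw [hv z hz, mul_zero]
  have e2 : ∑' z, (φ (z - v) - φ z) * u z = ∑ z ∈ Z, (φ (z - v) - φ z) * u z :=
    tsum_eq_sum fun z hz => by rw [hu z hz, mul_zero]
  rw [← e1, ← e2]
  simp only [mul_sub, sub_mul]
  rw [s3.tsum_sub s1, s2.tsum_sub s1, t1]

/-- The functional `φ(Δ g)` as a linear functional of the gradients. -/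
theorem IsTest.exists_fieldAt_laplacian_eq_pairing (hg : IsTest g) :
    ∃ (S : Finset (Edge d)) (G : Edge d → ℝ),
      (∑ b ∈ S, G b ^ 2 ≤ 2 * ∫ x, (Δ g x ^ 2 + ‖∇ g x‖ ^ 2)) ∧
      ∀ η : Config d, LoopCondition η → fieldAt (Δ g) η = pairing S G η := by
  classical
  obtain ⟨Z, hZ⟩ := hg.exists_sites
  have hZ1 : ∀ i, ∀ x ∈ tsupport (GradientField.pderiv i g), floorSite x ∈ Z := fun i x hx =>
    hZ x (tsupport_pderiv_subset i hx)
  have hZ2 : ∀ i, ∀ x, floorSite x ∉ Z →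
      GradientField.pderiv i (GradientField.pderiv i g) x = 0 := fun i x hx =>
    image_eq_zero_of_notMem_tsupport fun h => hx (hZ1 i x (tsupport_pderiv_subset i h))
  let u : Fin d → Site d → ℝ := fun i => faceFlux i (GradientField.pderiv i g)
  have hinj : Function.Injective fun p : Edge d => ((p.1 - unitVec p.2, p.2) : Edge d) := by
    rintro ⟨z, i⟩ ⟨w, j⟩ h
    simp only [Prod.mk.injEq] at h
    obtain ⟨h1, rfl⟩ := h
    rw [sub_left_inj] at h1
    rw [h1]
  -- The face through which the edge `(z - e_i, i)` enters the cell of `z` carries the flux `u i z`.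
  -- The minus sign arises because summation by parts yields `φ(z - e_i) - φ(z) = -η`.
  refine ⟨(Z ×ˢ Finset.univ).image fun p => (p.1 - unitVec p.2, p.2),
    fun b => -u b.2 b.head, ?_, fun η hη => ?_⟩
  · rw [Finset.sum_image hinj.injOn, Finset.sum_product_right]
    simp only [Edge.head, sub_add_cancel, neg_sq]
    have h1 : ∀ i, ∑ z ∈ Z, u i z ^ 2 ≤ ∫ x, 2 * (GradientField.pderiv i g x ^ 2
        + GradientField.pderiv i (GradientField.pderiv i g) x ^ 2) := fun i =>
      (Finset.sum_le_sum fun z _ => (hg.pderiv i).faceFlux_sq_le i z).trans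
        (sum_setIntegral_cell_le (((hg.pderiv i).sq.integrable.add
          ((hg.pderiv i).pderiv i).sq.integrable).const_mul 2) (fun x =>
            mul_nonneg (by norm_num) (add_nonneg (sq_nonneg _) (sq_nonneg _))) Z)
    refine (Finset.sum_le_sum fun i _ => h1 i).trans ?_
    simp only [integral_const_mul, ← Finset.mul_sum]
    exact mul_le_mul_of_nonneg_left hg.integral_sum_sq_le (by norm_num)
  · obtain ⟨h0, hgr⟩ := hη.height_spec
    have hL0 : ∀ x, floorSite x ∉ Z → Δ g x = 0 := fun x hx => by
      rw [hg.laplacian_eq_sum]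
      exact Finset.sum_eq_zero fun i _ => hZ2 i x hx
    have hLi : Integrable (Δ g) :=
      hg.lap_continuous.integrable_of_hasCompactSupport hg.lap_compact
    rw [fieldAt, (integral_mul_floorSite hLi hL0 (height η)).2]
    have hcell : ∀ z, ∫ x in cell z, Δ g x = ∑ i, (u i (z + unitVec i) - u i z) := by
      intro z
      simp only [hg.laplacian_eq_sum]
      rw [integral_finsetSum _ fun i _ => ((hg.pderiv i).pderiv i).integrable.integrableOn]
      exact Finset.sum_congr rfl fun i _ => (hg.pderiv i).setIntegral_cell_pderiv i z
    rw [pairing, Finset.sum_image hinj.injOn, Finset.sum_product_right]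
    simp only [hcell, Finset.mul_sum]
    rw [Finset.sum_comm]
    refine Finset.sum_congr rfl fun i _ => ?_
    rw [sum_mul_sub_shift (u := u i) (fun z hz => faceFlux_eq_zero (hZ1 i) hz) (unitVec i)
      (fun z hz => ?_) (height η)]
    · refine Finset.sum_congr rfl fun z _ => ?_
      conv_rhs => rw [← hgr]
      simp only [grad, Edge.head, sub_add_cancel]
      ring
    -- For `z` outside `Z` the flux through the far face also vanishes: the difference of the two is
    -- the integral of `∂_i ∂_i g` over a cell where it is zero.
    · rw [← (hg.pderiv i).setIntegral_cell_pderiv i z]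
      refine setIntegral_eq_zero_of_forall_eq_zero fun x hx => hZ2 i x ?_
      rw [show floorSite x = z from hx]
      exact hz

/-! ### The field as a linear map on `H0` -/

theorem H0.integrable_mul_floorSite (f : H0 d) (φ : Site d → ℝ) :
    Integrable fun x => f.fn x * φ (floorSite x) := by
  obtain ⟨Z, hZ⟩ := f.isTest.exists_sites
  have hLi : Integrable f.fn := by
    rw [← f.lap_invLap]
    exact f.isTest.lap_continuous.integrable_of_hasCompactSupport f.isTest.lap_compact
  refine (integral_mul_floorSite hLi (Z := Z) (fun x hx => ?_) φ).1
  rw [← f.lap_invLap, f.isTest.laplacian_eq_sum]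
  refine Finset.sum_eq_zero fun i _ => image_eq_zero_of_notMem_tsupport fun h => hx (hZ x ?_)
  exact tsupport_pderiv_subset i (tsupport_pderiv_subset i h)

theorem H0.fieldAt_add (f h : H0 d) : fieldAt (f + h).fn = fieldAt f.fn + fieldAt h.fn := by
  funext η
  simp only [fieldAt, H0.fn_add, Pi.add_apply, add_mul]
  exact integral_add (f.integrable_mul_floorSite _) (h.integrable_mul_floorSite _)

theorem H0.fieldAt_smul (c : ℝ) (f : H0 d) : fieldAt (c • f).fn = c • fieldAt f.fn := by
  funext η
  simp only [fieldAt, H0.fn_smul, Pi.smul_apply, smul_eq_mul, mul_assoc]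
  exact integral_const_mul _ _

theorem H0.norm_sq_eq (f : H0 d) :
    ‖f‖ ^ 2 = ∫ x, (Δ f.invLap x ^ 2 + ‖∇ f.invLap x‖ ^ 2) := by
  rw [H0.norm_eq f f.invLap f.isTest f.lap_invLap, Real.sq_sqrt]
  exact integral_nonneg fun x => by positivity

end Representation

/-! ### The main result -/

theorem memLp_two_of_lintegral_sq_le {Ω : Type*} [MeasurableSpace Ω] {μ : Measure Ω} {X : Ω → ℝ}
    (hX : AEStronglyMeasurable X μ) {c : ℝ} (hc : 0 ≤ c)
    (h : ∫⁻ x, ENNReal.ofReal (X x ^ 2) ∂μ ≤ ENNReal.ofReal (c ^ 2)) :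
    MemLp X 2 μ ∧ eLpNorm X 2 μ ≤ ENNReal.ofReal c := by
  have h1 : eLpNorm X 2 μ ≤ ENNReal.ofReal c := by
    rw [eLpNorm_eq_lintegral_rpow_enorm_toReal (by norm_num) (by norm_num)]
    have e : ∀ x, ‖X x‖ₑ ^ (2 : ℝ≥0∞).toReal = ENNReal.ofReal (X x ^ 2) := by
      intro x
      rw [ENNReal.toReal_ofNat, Real.enorm_eq_ofReal_abs, ENNReal.ofReal_rpow_of_nonneg
        (abs_nonneg _) (by norm_num)]
      congr 1
      rw [Real.rpow_two, sq_abs]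
    simp only [e]
    refine (ENNReal.rpow_le_rpow h (by norm_num)).trans (le_of_eq ?_)
    rw [ENNReal.ofReal_rpow_of_nonneg (by positivity) (by norm_num), ENNReal.toReal_ofNat,
      ← Real.sqrt_eq_rpow, Real.sqrt_sq hc]
  exact ⟨⟨hX, h1.trans_lt ENNReal.ofReal_lt_top⟩, h1⟩

/-- The variance bound with `Γ = 2 ‖f‖²` gives `32 / a`. As it needs `Γ > 0`, the case `‖f‖ = 0` is
separate; there all coefficients vanish. -/
theorem memLp_fieldAt {d : ℕ} {ϱ : Measure ℝ} [IsFiniteMeasure ϱ] {a A : ℝ}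
    {μ : Measure (Config d)} [IsProbabilityMeasure μ]
    (hμ : IsGradientGibbs (potential ϱ) μ) (hne : ϱ ≠ 0)
    (hϱ : ∀ᵐ κ ∂ϱ, a ≤ κ ∧ κ ≤ A) (ha : 0 < a) (hA : 0 ≤ A)
    (hinv : IsTranslationInvariant μ) (herg : IsErgodic μ) (htilt : HasZeroTilt μ) (f : H0 d) :
    MemLp (fieldAt f.fn) 2 μ ∧
      eLpNorm (fieldAt f.fn) 2 μ ≤ ENNReal.ofReal (√(32 / a) * ‖f‖) := by
  obtain ⟨S, G, hG, hfield⟩ := f.isTest.exists_fieldAt_laplacian_eq_pairing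
  rw [f.lap_invLap] at hfield
  rw [← H0.norm_sq_eq] at hG
  have hae : fieldAt f.fn =ᵐ[μ] pairing S G := by
    filter_upwards [hμ.loop] with η hη
    exact hfield η hη
  rw [memLp_congr_ae hae, eLpNorm_congr_ae hae]
  rcases (norm_nonneg f).eq_or_lt with h0 | h0
  · have hz : ∀ b ∈ S, G b = 0 := by
      have h1 : ∑ b ∈ S, G b ^ 2 = 0 := by
        refine le_antisymm (hG.trans ?_) (Finset.sum_nonneg fun b _ => sq_nonneg _)
        rw [← h0]; norm_num
      rw [Finset.sum_eq_zero_iff_of_nonneg fun b _ => sq_nonneg _] at h1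
      exact fun b hb => by simpa using h1 b hb
    have hp : pairing S G = 0 := by
      funext η
      exact Finset.sum_eq_zero fun b hb => by rw [hz b hb, zero_mul]
    rw [hp]
    exact ⟨MemLp.zero, by simp⟩
  · refine memLp_two_of_lintegral_sq_le (measurable_pairing S G).aestronglyMeasurable
      (by positivity) ?_
    refine (lintegral_pairing_sq_le hμ hne hϱ ha hA hinv herg htilt S G
      (Γ := 2 * ‖f‖ ^ 2) (by positivity) hG).trans (le_of_eq ?_)
    congr 1
    rw [mul_pow, Real.sq_sqrt (by positivity)]
    ring

theorem existsUnique_extension {d : ℕ} {μ : Measure (Config d)} {c : ℝ}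
    (h : ∀ f : H0 d, MemLp (fieldAt f.fn) 2 μ ∧
      eLpNorm (fieldAt f.fn) 2 μ ≤ ENNReal.ofReal (c * ‖f‖)) :
    ∃! Φ : H d →L[ℝ] Lp ℝ 2 μ, ∀ f : H0 d, Φ (f : H d) =ᵐ[μ] fieldAt f.fn := by
  let L₀ : H0 d →ₗ[ℝ] Lp ℝ 2 μ :=
    { toFun := fun f => (h f).1.toLp _
      map_add' := fun f k => by
        rw [← MemLp.toLp_add]
        exact MemLp.toLp_congr _ _ (by rw [H0.fieldAt_add])
      map_smul' := fun r f => by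
        rw [RingHom.id_apply, ← MemLp.toLp_const_smul]
        exact MemLp.toLp_congr _ _ (by rw [H0.fieldAt_smul]) }
  -- The sign of `c` is not known, hence the maximum.
  have hbound : ∀ f, ‖L₀ f‖ ≤ max c 0 * ‖f‖ := by
    intro f
    change ‖(h f).1.toLp _‖ ≤ _
    rw [Lp.norm_toLp]
    refine ENNReal.toReal_le_of_le_ofReal (by positivity) ((h f).2.trans ?_)
    gcongr
    exact le_max_left _ _
  let L : H0 d →L[ℝ] Lp ℝ 2 μ := L₀.mkContinuous _ hbound
  let ι : H0 d →L[ℝ] H d := UniformSpace.Completion.toComplL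
  have hι : DenseRange ι := UniformSpace.Completion.denseRange_coe
  have hu : IsUniformInducing ι := UniformSpace.Completion.isUniformInducing_coe _
  have hext : ∀ f : H0 d, L.extend ι (f : H d) = L f := fun f => L.extend_eq hι hu f
  refine ⟨L.extend ι, fun f => ?_, fun Ψ hΨ => ?_⟩
  · rw [hext]
    exact (h f).1.coeFn_toLp
  · refine ContinuousLinearMap.ext fun x => ?_
    refine congrFun (hι.equalizer Ψ.continuous (L.extend ι).continuous (funext fun f => ?_)) x
    refine Lp.ext ((hΨ f).trans ?_)
    change _ =ᵐ[μ] L.extend ι (f : H d)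
    rw [hext]
    exact (h f).1.coeFn_toLp.symm

end GradientField

end

theorem lemma2p2 {d : ℕ} (hd : 0 < d)
    (ϱ : MeasureTheory.Measure ℝ) [MeasureTheory.IsFiniteMeasure ϱ] (hϱ : ϱ ≠ 0)
    (hcompact : IsCompact ϱ.support)
    (hpos : ∃ a : ℝ, 0 < a ∧ ∀ κ ∈ ϱ.support, a ≤ κ)
    (μ : MeasureTheory.Measure (GradientField.Config d)) [MeasureTheory.IsProbabilityMeasure μ]
    (hgibbs : GradientField.IsGradientGibbs (GradientField.potential ϱ) μ)
    (hinv : GradientField.IsTranslationInvariant μ)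
    (herg : GradientField.IsErgodic μ)
    (htilt : GradientField.HasZeroTilt μ) :
    (∃ c : ℝ, ∀ f : GradientField.H0 d,
      MeasureTheory.MemLp (GradientField.fieldAt f.fn) 2 μ ∧
      MeasureTheory.eLpNorm (GradientField.fieldAt f.fn) 2 μ ≤ ENNReal.ofReal (c * ‖f‖)) ∧
    ∃! Φ : GradientField.H d →L[ℝ] MeasureTheory.Lp ℝ 2 μ,
      ∀ f : GradientField.H0 d,
        Φ (f : GradientField.H d) =ᵐ[μ] GradientField.fieldAt f.fn := by
  obtain ⟨a, ha, hsupp⟩ := hpos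
  obtain ⟨A, hA⟩ := hcompact.isBounded.exists_norm_le
  -- The support carries `ϱ`; the maximum with `0` only secures a nonnegative upper bound for the
  -- couplings.
  have hae : ∀ᵐ κ ∂ϱ, a ≤ κ ∧ κ ≤ max A 0 := by
    filter_upwards [MeasureTheory.Measure.support_mem_ae (μ := ϱ)] with κ hκ
    exact ⟨hsupp κ hκ, (le_abs_self κ).trans ((hA κ hκ).trans (le_max_left _ _))⟩
  have h := GradientField.memLp_fieldAt hgibbs hϱ hae ha (le_max_right _ _) hinv herg htilt
  exact ⟨⟨_, h⟩, GradientField.existsUnique_extension h⟩
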